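/- Let $T>0$ and let $X=\{X_t,\ t\in[0,T]\}$ be a centered Gaussian measurable process, null at $0$, with stationary increments. Let $\sigma^2(t)=\operatorname{Var}(X_t)$ and suppose that $\sigma^2(t)\le C_\sigma$ on $[0,T]$. Suppose that (i) there is an even natural number $m_0$ such that for every even $m\ge m_0$ the determinant of the covariance matrix of the normalized increments $\frac{X_{t_j}-X_{t_{j-1}}}{\sigma(t_j-t_{j-1})}$, $j=1,\dots,m$, is bounded below by a constant $A_m>0$ on $\{0=t_0<t_1<\dots<t_m<T\}$; (ii) there are $\delta>0$, $\alpha>0$ and a constant $C_{\alpha,\delta}$ such that $\int_t^{t+h}\sigma(s)^{-(1+2\delta)}\,ds\le C_{\alpha,\delta}\,h^\alpha$ whenever $0\le t\le t+h\le T$ (where $0^{-(1+2\delta)}=+\infty$). Then there is a process $L=\{L_x^t,\ x\in\mathbb R,\ t\in[0,T]\}$ such that: (a) $L$ is a local time of $X$: for each $t\in[0,T]$, almost surely, $x\mapsto L_x^t$ is a version of the density with respect to Lebesgue measure of the occupation measure $\mu^t(B)=\int_0^t 1_{\{X_s\in B\}}\,ds$. Moreover $L$ is the uniform limit in quadratic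 mean $$\lim_{N\to\infty}\ \sup_{(x,t)\in\mathbb R\times[0,T]}E\left|\frac1{2\pi}\int_{-N}^N e^{-iux}\int_0^t e^{iuX_r}\,dr\,du-L_x^t\right|^2=0.$$ (b) For every even $m\ge m_0$ and all $t,t+h\in[0,T]$, $E|L_0^{t+h}-L_0^t|^m\le C_1|h|^{m\alpha}$ with $C_1=C_mA_m^{-m/2}\max(1,C_\sigma^{2\delta})^m C_{\alpha,\delta}^m$. (c) If $\delta\le 1$, then for every even $m\ge m_0$, all $x,k\in\mathbb R$ and all $t,t+h\in[0,T]$, $$E\left|L_{x+k}^{t+h}-L_{x+k}^{t}-L_x^{t+h}+L_x^t\right|^m\le C_2|h|^{m\alpha}|k|^{m\delta},\qquad C_2=C_m\max\left(1,A_m^{-\max(m,\,1+m\delta)/2}\right)\max(1,C_\sigma^{2\delta})^m C_{\alpha,\delta}^m.$$ In particular, for $m\ge 2$ and $\delta\le 1-\frac1m$, $C_2=C_m\max(1,A_m^{-m/2})\max(1,C_\sigma^{2\delta})^m C_{\alpha,\delta}^m$. In (b) and (c), $C_m>0$ depends only on $m$. Consequently $X$ has a local time that is a version of $L$ (it equals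 $L_x^t$ almost surely for each $(x,t)\in\mathbb R\times[0,T]$) and is jointly continuous in $(x,t)\in\mathbb R\times[0,T]$. -/

import Mathlib

open MeasureTheory ProbabilityTheory Set Filter Topology
open scoped ENNReal

namespace LocalTime

noncomputable section

variable {Ω : Type*} [MeasurableSpace Ω]

/-- The process `X = {X_t, t ∈ [0, T]}` (only the values `X t` with `t ∈ [0, T]` matter) is
measurable: `(t, ω) ↦ X_t(ω)` is jointly measurable on `[0, T] × Ω`. -/
def IsMeasurableProcess (T : ℝ) (X : ℝ → Ω → ℝ) : Prop :=
  Measurable fun p : Icc (0 : ℝ) T × Ω => X p.1 p.2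

/-- `{X_t, t ∈ [0, T]}` has stationary increments: the law of `X_t - X_s` depends only on `t - s`.
For a centered Gaussian process with `X_0 = 0` this is equivalent to the invariance under
time shifts of all finite-dimensional distributions of the increments, since either property
says that the variance of `X_t - X_s` is that of `X_{t-s}`. -/
def HasStationaryIncrements (P : Measure Ω) (T : ℝ) (X : ℝ → Ω → ℝ) : Prop :=
  ∀ s ∈ Icc (0 : ℝ) T, ∀ t ∈ Icc (0 : ℝ) T, s ≤ t →
    IdentDistrib (fun ω => X t ω - X s ω) (fun ω => X (t - s) ω - X 0 ω) P P

/-- A centered Gaussian measurable process on `[0, T]`, null at `0`, with stationary increments. -/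
structure IsCenteredGaussianStatIncr (P : Measure Ω) (T : ℝ) (X : ℝ → Ω → ℝ) : Prop where
  measurable : IsMeasurableProcess T X
  gaussian : IsGaussianProcess (fun t : Icc (0 : ℝ) T => X t) P
  centered : ∀ t ∈ Icc (0 : ℝ) T, ∫ ω, X t ω ∂P = 0
  null_at_zero : ∀ᵐ ω ∂P, X 0 ω = 0
  stationary : HasStationaryIncrements P T X

/-- The square root `σ(t)` of the variance function `σ²(t) = Var X_t`. -/
def sigma (P : Measure Ω) (X : ℝ → Ω → ℝ) (t : ℝ) : ℝ :=
  Real.sqrt (variance (X t) P)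

/-- The covariance matrix of the normalized increments
`(X_{t_j} - X_{t_{j-1}}) / σ(t_j - t_{j-1})`, `j = 1, …, m`, along times `t_0, …, t_m`. -/
def normIncrCov (P : Measure Ω) (X : ℝ → Ω → ℝ) {m : ℕ} (t : Fin (m + 1) → ℝ) :
    Matrix (Fin m) (Fin m) ℝ :=
  Matrix.of fun i j =>
    covariance
      (fun ω => (X (t i.succ) ω - X (t i.castSucc) ω) / sigma P X (t i.succ - t i.castSucc))
      (fun ω => (X (t j.succ) ω - X (t j.castSucc) ω) / sigma P X (t j.succ - t j.castSucc)) P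

/-- The occupation measure `μ^t(B) = ∫_0^t 1_{X_s ∈ B} ds` of the path of `ω`. -/
def occupationMeasure (X : ℝ → Ω → ℝ) (t : ℝ) (ω : Ω) : Measure ℝ :=
  (volume.restrict (Icc 0 t)).map fun s => X s ω

/-- `L x t = L_x^t` is a local time of `{X_t, t ∈ [0, T]}`: for each `t ∈ [0, T]`, almost surely,
`x ↦ L_x^t(ω)` is a version of the density of the occupation measure `μ^t` with respect to
Lebesgue measure. -/
def IsLocalTime (P : Measure Ω) (T : ℝ) (X : ℝ → Ω → ℝ) (L : ℝ → ℝ → Ω → ℝ) : Prop :=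
  (∀ x, ∀ t ∈ Icc (0 : ℝ) T, Measurable (L x t)) ∧
  ∀ t ∈ Icc (0 : ℝ) T, ∀ᵐ ω ∂P,
    AEMeasurable (fun x => L x t ω) volume ∧
    (∀ᵐ x : ℝ, 0 ≤ L x t ω) ∧
    occupationMeasure X t ω = volume.withDensity fun x => ENNReal.ofReal (L x t ω)

/-- `ψ_N(x, t, ω) = (2π)⁻¹ ∫_{-N}^N e^{-iux} ∫_0^t e^{iuX_r(ω)} dr du`, the truncated Fourier
inversion of the occupation measure. -/
def psi (X : ℝ → Ω → ℝ) (N x t : ℝ) (ω : Ω) : ℂ :=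
  (1 / (2 * Real.pi) : ℂ) *
    ∫ u in (-N)..N, Complex.exp (-(Complex.I * u * x)) *
      ∫ r in (0 : ℝ)..t, Complex.exp (Complex.I * u * (X r ω : ℝ))

/-- `lim_{N → ∞} sup_{(x,t) ∈ ℝ × [0,T]} E|ψ_N(x,t) - L_x^t|² = 0`. -/
def IsUniformL2Limit (P : Measure Ω) (T : ℝ) (X : ℝ → Ω → ℝ) (L : ℝ → ℝ → Ω → ℝ) : Prop :=
  Tendsto (fun N : ℝ => ⨆ x : ℝ, ⨆ t ∈ Icc (0 : ℝ) T,
    ∫⁻ ω, ‖psi X N x t ω - (L x t ω : ℂ)‖ₑ ^ 2 ∂P) atTop (𝓝 0)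

/-- The increment `Δ_{x,t} F(x', t') = F(x', t') - F(x', t) - F(x, t') + F(x, t)`. -/
def rectIncr (F : ℝ → ℝ → ℝ) (x t x' t' : ℝ) : ℝ :=
  F x' t' - F x' t - F x t' + F x t

end

end LocalTime

/-! Everything rests on one moment estimate. For an integrable Hermitian kernel g and even m, the
m-th moment of ∫ g(u) ∫ e^{iuX_r} dr du is at most an integral, over m times r_j and m frequencies
u_j, of ∏ |g(u_j)| times the modulus of the characteristic function of (X_{r_1}, …, X_{r_m})
(`lintegral_occInt_pow_le`). By symmetry the times may be ordered, at the cost of m!. With gaps d_j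
= r_j - r_{j-1}, summation by parts writes ∑ u_j X_{r_j} in the normalized increments with weights
w_j = σ(d_j)(u_j + … + u_m), so its variance is wᵀRw, where R is their covariance matrix.

R has unit diagonal and det R ≥ A, hence the diagonal entries of R⁻¹ are at most m!/A and each w_j
is controlled by the quadratic form. Since u_j is a difference of two consecutive partial sums,
|u_j| is at most of order 1/(σ(d_j) σ(d_{j+1})) times the square root of that form. The Gaussian
integral of ∏ |u_j|^θ is therefore at most a constant times ∏ σ(d_j)^{-(1+2θ)}: the exponent 1 is
the Jacobian, the 2θ comes from the weight (`lintegral_prod_rpow_mul_exp_le`). This product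
separates in the gaps, and assumption (ii) bounds each factor by a multiple of h^α
(`lintegral_occInt_pow_le_const`).

The kernel decides θ. Time increments of `psi` need θ = 0. Space differences of the kernel are at
most |k|^δ |u|^δ, so θ = δ gives |k|^{mδ}. The frequencies beyond M cost M^{-θ} |u|^θ, with θ =
min(δ, 1).

The local time is the sum of the dyadic differences ψ_{2^{k+1}} - ψ_{2^k}. For m large the tail
estimate beats the number of points of a fine grid, and a deterministic Lipschitz bound fills the
gaps of the grid, so almost surely the series converges uniformly on compact sets (`ae_isGoodPath`).
The sum is thus jointly continuous by construction, whatever δ is, and serves as its own continuous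
version. Fourier inversion against test functions identifies it as the occupation density, and
Fatou's lemma carries the moment bounds from ψ_{2^n} to the limit. -/

namespace LocalTime

/-! ### Linear algebra and the weighted Gaussian integral -/

/-- The lower triangular matrix of ones, which maps increments to partial sums. -/
def sumMatrix (m : ℕ) : Matrix (Fin m) (Fin m) ℝ := Matrix.of fun i j => if j ≤ i then 1 else 0

lemma det_sumMatrix (m : ℕ) : (sumMatrix m).det = 1 := by
  rw [Matrix.det_of_isLowerTriangular]
  · simp [sumMatrix]
  · intro i j hij
    have : i < j := hij
    simp [sumMatrix, this]

lemma sumMatrix_transpose_mulVec_castSucc_sub {n : ℕ} (u : Fin (n + 1) → ℝ) (i : Fin n) :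
    ((sumMatrix (n + 1)).transpose.mulVec u) i.castSucc
      - ((sumMatrix (n + 1)).transpose.mulVec u) i.succ = u i.castSucc := by
  simp only [Matrix.mulVec, dotProduct, sumMatrix, Matrix.transpose_apply, Matrix.of_apply, ite_mul,
    one_mul, zero_mul, ← Finset.sum_sub_distrib]
  rw [Finset.sum_eq_single i.castSucc]
  · simp
  · intro b _ hb
    have : i.castSucc ≤ b ↔ i.succ ≤ b := by
      have hb' : (b : ℕ) ≠ i := fun h => hb (Fin.ext h)
      simp only [Fin.le_def, Fin.val_castSucc, Fin.val_succ]
      omega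
    simp [this]
  · simp

lemma sumMatrix_transpose_mulVec_last {n : ℕ} (u : Fin (n + 1) → ℝ) :
    ((sumMatrix (n + 1)).transpose.mulVec u) (Fin.last n) = u (Fin.last n) := by
  simp only [Matrix.mulVec, dotProduct, sumMatrix, Matrix.transpose_apply, Matrix.of_apply, ite_mul,
    one_mul, zero_mul]
  rw [Finset.sum_eq_single (Fin.last n)]
  · simp
  · intro b _ hb
    have : ¬ Fin.last n ≤ b := fun h => hb (le_antisymm (Fin.le_last b) h)
    simp [this]
  · simp

/-- With v_j = u_j + … + u_m one has u_j = v_j - v_{j+1}, and |v_j| ≤ D/σ_j. Hence |u_j| ≤ D(σ_j +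
σ_{j+1})/(σ_j σ_{j+1}), which accounts for the square of ∏ σ_j in the denominator. -/
lemma prod_abs_le_of_sumMatrix {m : ℕ} (hm : m ≠ 0) (u σ : Fin m → ℝ) {c D : ℝ} (hc : 1 ≤ c) (hD : 0 ≤ D)
    (hσ : ∀ j, 0 < σ j) (hσc : ∀ j, σ j ≤ c)
    (hv : ∀ j, |σ j * ((sumMatrix m).transpose.mulVec u) j| ≤ D) :
    ∏ j, |u j| ≤ (2 * c ^ 2 * D) ^ m / (∏ j, σ j) ^ 2 := by
  obtain ⟨n, rfl⟩ := Nat.exists_eq_add_one_of_ne_zero hm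
  set v := (sumMatrix (n + 1)).transpose.mulVec u with hvdef
  have hv' : ∀ j, |v j| ≤ D / σ j := fun j => by
    rw [le_div_iff₀ (hσ j)]
    have := hv j
    rw [abs_mul, abs_of_pos (hσ j)] at this
    linarith
  have h1 : ∀ i : Fin n, |u i.castSucc| ≤ 2 * c * D / (σ i.castSucc * σ i.succ) := by
    intro i
    rw [← sumMatrix_transpose_mulVec_castSucc_sub u]
    have h2 : D / σ i.castSucc + D / σ i.succ
        = (D * (σ i.castSucc + σ i.succ)) / (σ i.castSucc * σ i.succ) := by
      field_simp [(hσ i.castSucc).ne', (hσ i.succ).ne']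
      ring
    calc _ ≤ |v i.castSucc| + |v i.succ| := abs_sub _ _
      _ ≤ D / σ i.castSucc + D / σ i.succ := add_le_add (hv' _) (hv' _)
      _ = _ := h2
      _ ≤ _ := by
        have := mul_pos (hσ i.castSucc) (hσ i.succ)
        refine div_le_div_of_nonneg_right ?_ this.le
        nlinarith [hσc i.castSucc, hσc i.succ]
  have h2 : |u (Fin.last n)| ≤ 2 * c * D / σ (Fin.last n) := by
    rw [← sumMatrix_transpose_mulVec_last u]
    refine (hv' _).trans ?_
    have := hσ (Fin.last n)
    gcongr
    nlinarith
  have hP : 0 < ∏ j, σ j := Finset.prod_pos fun j _ => hσ j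
  have hS : ∏ i : Fin n, σ i.castSucc = (∏ j, σ j) / σ (Fin.last n) := by
    rw [Fin.prod_univ_castSucc, mul_div_cancel_right₀ _ (hσ _).ne']
  have hS' : ∏ i : Fin n, σ i.succ = (∏ j, σ j) / σ 0 := by
    rw [Fin.prod_univ_succ, mul_div_cancel_left₀ _ (hσ _).ne']
  calc ∏ j, |u j| = (∏ i : Fin n, |u i.castSucc|) * |u (Fin.last n)| := Fin.prod_univ_castSucc _
    _ ≤ (∏ i : Fin n, 2 * c * D / (σ i.castSucc * σ i.succ)) * (2 * c * D / σ (Fin.last n)) := by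
        gcongr with i _
        · exact Finset.prod_nonneg fun i _ => by
            have := mul_pos (hσ i.castSucc) (hσ i.succ)
            positivity
        · exact h1 i
    -- Every σ_j occurs twice in the denominators except σ_0, which occurs once; the missing factor
    -- σ_0 is put in the numerator and later absorbed in c^{n+1}, as c ≥ 1.
    _ = (2 * c * D) ^ (n + 1) * σ 0 / (∏ j, σ j) ^ 2 := by
        rw [Finset.prod_div_distrib, Finset.prod_mul_distrib (f := fun i : Fin n => σ i.castSucc), hS, hS', Finset.prod_const,
          Finset.card_univ, Fintype.card_fin]
        have := (hσ (Fin.last n)).ne'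
        have := (hσ 0).ne'
        field_simp
        ring
    _ ≤ _ := by
        gcongr
        calc (2 * c * D) ^ (n + 1) * σ 0 ≤ (2 * c * D) ^ (n + 1) * c ^ (n + 1) := by
              gcongr
              exact (hσc 0).trans (le_self_pow₀ hc (by omega))
          _ = _ := by rw [← mul_pow]; ring

lemma exists_transpose_mul_self {ι : Type*} [Fintype ι] [DecidableEq ι] {R : Matrix ι ι ℝ}
    (hR : R.PosSemidef) : ∃ B : Matrix ι ι ℝ, R = B.transpose * B := by
  open scoped MatrixOrder in
  obtain ⟨B, hB⟩ := CStarAlgebra.nonneg_iff_eq_star_mul_self.mp hR.nonneg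
  exact ⟨B, by rw [hB]; rfl⟩

/-- Cauchy–Schwarz for the columns of B, obtained by expanding ∑ (b_i ± b_j)² ≥ 0. -/
lemma abs_entry_le_one {ι : Type*} [Fintype ι] {B : Matrix ι ι ℝ}
    (hd : ∀ i, (B.transpose * B) i i ≤ 1) (i j : ι) : |(B.transpose * B) i j| ≤ 1 := by
  have key : ∀ i j, (B.transpose * B) i j = ∑ k, B k i * B k j := fun i j => by
    simp [Matrix.mul_apply]
  have hi := hd i
  have hj := hd j
  rw [key] at hi hj
  rw [key, abs_le]
  have h1 : 0 ≤ ∑ k, (B k i + B k j) ^ 2 := Finset.sum_nonneg fun _ _ => sq_nonneg _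
  have h2 : 0 ≤ ∑ k, (B k i - B k j) ^ 2 := Finset.sum_nonneg fun _ _ => sq_nonneg _
  have e1 : ∑ k, (B k i + B k j) ^ 2
      = ∑ k, B k i * B k i + ∑ k, B k j * B k j + 2 * ∑ k, B k i * B k j := by
    rw [Finset.mul_sum, ← Finset.sum_add_distrib, ← Finset.sum_add_distrib]
    exact Finset.sum_congr rfl fun _ _ => by ring
  have e2 : ∑ k, (B k i - B k j) ^ 2
      = ∑ k, B k i * B k i + ∑ k, B k j * B k j - 2 * ∑ k, B k i * B k j := by
    rw [Finset.mul_sum, ← Finset.sum_add_distrib, ← Finset.sum_sub_distrib]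
    exact Finset.sum_congr rfl fun _ _ => by ring
  constructor <;> linarith

lemma det_le_factorial {m : ℕ} {R : Matrix (Fin m) (Fin m) ℝ} (h : ∀ i j, |R i j| ≤ 1) :
    |R.det| ≤ m.factorial := by
  have := Matrix.det_le (A := R) (abv := AbsoluteValue.abs) (x := 1) h
  simpa using this

/-- With y = Bw, Cauchy–Schwarz applied to w = B⁻¹y gives w_j² ≤ (R⁻¹)_{jj} |y|² for R = BᵀB. By
Cramer's rule (R⁻¹)_{jj} is a cofactor over det R, and the cofactor is at most m! because the
entries of R are at most 1. -/
lemma sq_le_of_gram {m : ℕ} {B : Matrix (Fin m) (Fin m) ℝ}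
    (hd : ∀ i, (B.transpose * B) i i = 1) {A : ℝ} (hA : 0 < A) (hdet : A ≤ (B.transpose * B).det)
    (w : Fin m → ℝ) (j : Fin m) :
    w j ^ 2 ≤ m.factorial / A * (B.mulVec w ⬝ᵥ B.mulVec w) := by
  set R := B.transpose * B with hR
  have hdet0 : 0 < R.det := hA.trans_le hdet
  have hBu : IsUnit B.det := by
    have : R.det = B.det * B.det := by rw [hR, Matrix.det_mul, Matrix.det_transpose]
    rw [this] at hdet0
    exact isUnit_iff_ne_zero.mpr fun h => by simp [h] at hdet0
  set y := B.mulVec w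
  have hw : w = B⁻¹.mulVec y := by
    simp only [y, Matrix.mulVec_mulVec, Matrix.nonsing_inv_mul _ hBu, Matrix.one_mulVec]
  have hinv : ∑ k, B⁻¹ j k ^ 2 = R⁻¹ j j := by
    rw [hR, Matrix.mul_inv_rev, Matrix.mul_apply]
    refine Finset.sum_congr rfl fun k _ => ?_
    rw [← Matrix.transpose_nonsing_inv, Matrix.transpose_apply, sq]
  have hadj : R⁻¹ j j ≤ m.factorial / A := by
    rw [Matrix.inv_def, Matrix.smul_apply, Ring.inverse_eq_inv', smul_eq_mul, ← div_eq_inv_mul]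
    have : R.adjugate j j ≤ m.factorial := by
      refine (le_abs_self _).trans ?_
      rw [Matrix.adjugate_apply]
      refine det_le_factorial fun a b => ?_
      rw [Matrix.updateRow_apply]
      split_ifs
      · by_cases hb : b = j
        · subst hb; simp
        · simp [hb]
      · exact abs_entry_le_one (fun i => (hd i).le) a b
    gcongr
  have hyy : y ⬝ᵥ y = ∑ k, y k ^ 2 := by simp [dotProduct, sq]
  calc w j ^ 2 = (∑ k, B⁻¹ j k * y k) ^ 2 := by rw [hw]; rfl
    _ ≤ (∑ k, B⁻¹ j k ^ 2) * ∑ k, y k ^ 2 := Finset.sum_mul_sq_le_sq_mul_sq _ _ _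
    _ ≤ _ := by
      rw [hinv, ← hyy]
      gcongr
      rw [hyy]; positivity

/-- The standard Gaussian integral in dimension `m`, with variance `2`. -/
noncomputable def gaussMass (m : ℕ) : ℝ≥0∞ :=
  ∫⁻ y : Fin m → ℝ, ENNReal.ofReal (Real.exp (-(1 / 4) * (y ⬝ᵥ y)))

lemma gaussMass_lt_top (m : ℕ) : gaussMass m < ⊤ := by
  have h : Integrable (fun y : Fin m → ℝ => Real.exp (-(1 / 4) * (y ⬝ᵥ y))) := by
    have : (fun y : Fin m → ℝ => Real.exp (-(1 / 4) * (y ⬝ᵥ y)))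
        = fun y => ∏ i, Real.exp (-(1 / 4) * (y i) ^ 2) := by
      ext y
      rw [← Real.exp_sum, dotProduct, Finset.mul_sum]
      congr 1
      exact Finset.sum_congr rfl fun _ _ => by ring
    rw [this]
    exact Integrable.fintype_prod (f := fun _ x => Real.exp (-(1 / 4) * x ^ 2))
      fun _ => integrable_exp_neg_mul_sq (by norm_num)
  exact h.lintegral_lt_top

/-- Half of the Gaussian decay absorbs the power of q, through x^m/m! ≤ e^x at x = (1 + q)/4. The
constant does not depend on p. -/
lemma rpow_mul_exp_le {m : ℕ} {q p : ℝ} (hq : 0 ≤ q) (hp0 : 0 ≤ p) (hp : p ≤ m) :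
    q ^ p * Real.exp (-(1 / 2) * q)
      ≤ m.factorial * 4 ^ m * Real.exp (1 / 4) * Real.exp (-(1 / 4) * q) := by
  have h1 : q ^ p ≤ (1 + q) ^ m := by
    calc q ^ p ≤ (1 + q) ^ p := Real.rpow_le_rpow hq (by linarith) hp0
      _ ≤ (1 + q) ^ (m : ℝ) := Real.rpow_le_rpow_of_exponent_le (by linarith) hp
      _ = _ := Real.rpow_natCast _ _
  have h2 := Real.pow_div_factorial_le_exp ((1 + q) / 4) (by positivity) m
  rw [div_le_iff₀ (by positivity), div_pow, div_le_iff₀ (by positivity)] at h2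
  calc q ^ p * Real.exp (-(1 / 2) * q)
      ≤ (Real.exp ((1 + q) / 4) * m.factorial * 4 ^ m) * Real.exp (-(1 / 2) * q) := by
        gcongr
        exact h1.trans h2
    _ = m.factorial * 4 ^ m * (Real.exp ((1 + q) / 4) * Real.exp (-(1 / 2) * q)) := by ring
    _ = _ := by
        rw [mul_assoc _ (Real.exp (1 / 4)), ← Real.exp_add, ← Real.exp_add]
        ring_nf

lemma lintegral_comp_mulVec {m : ℕ} {M : Matrix (Fin m) (Fin m) ℝ} (hM : M.det ≠ 0)
    (f : (Fin m → ℝ) → ℝ≥0∞) (hf : Measurable f) :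
    ∫⁻ u, f (M.mulVec u) = ENNReal.ofReal |M.det⁻¹| * ∫⁻ y, f y := by
  have h := Real.map_matrix_volume_pi_eq_smul_volume_pi hM
  have hmeas : Measurable (Matrix.toLin' M) := (LinearMap.continuous_of_finiteDimensional _).measurable
  calc ∫⁻ u, f (M.mulVec u) = ∫⁻ u, f (Matrix.toLin' M u) := by simp
    _ = ∫⁻ y, f y ∂(Measure.map (Matrix.toLin' M) volume) := (lintegral_map hf hmeas).symm
    _ = _ := by rw [h, lintegral_smul_measure, smul_eq_mul]

/-- The constant of `lintegral_prod_rpow_mul_exp_le`. -/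
noncomputable def gaussConst (m : ℕ) : ℝ :=
  2 ^ m * (m.factorial : ℝ) ^ m * (m.factorial * 4 ^ m * Real.exp (1 / 4)) * ((gaussMass m).toReal + 1)

lemma gaussConst_pos (m : ℕ) : 0 < gaussConst m := by
  unfold gaussConst
  positivity

/-- Writing R = BᵀB, the substitution y = B diag(σ) Sᵀu, with S the matrix of partial sums, turns
the quadratic form into |y|². Since det S = 1, the Jacobian is at most A^{-1/2} (∏ σ_j)⁻¹. The
weight contributes A^{-mθ/2} c^{2mθ} (∏ σ_j)^{-2θ} and a power of |y| that the exponential absorbs.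
The bound θ ≤ 1 keeps the remaining constant independent of θ. -/
theorem lintegral_prod_rpow_mul_exp_le {m : ℕ} (hm : m ≠ 0) {R : Matrix (Fin m) (Fin m) ℝ}
    (hR : R.PosSemidef) (hd : ∀ i, R i i = 1) {A : ℝ} (hA : 0 < A) (hdet : A ≤ R.det)
    (σ : Fin m → ℝ) {c θ : ℝ} (hc : 1 ≤ c) (hσ : ∀ j, 0 < σ j) (hσc : ∀ j, σ j ≤ c)
    (hθ : 0 ≤ θ) (hθ1 : θ ≤ 1)
    (w : (Fin m → ℝ) → Fin m → ℝ)
    (hw : ∀ u j, w u j = σ j * ((sumMatrix m).transpose.mulVec u) j) :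
    ∫⁻ u : Fin m → ℝ, ENNReal.ofReal ((∏ j, |u j|) ^ θ
        * Real.exp (-(1 / 2) * (w u ⬝ᵥ R.mulVec (w u))))
      ≤ ENNReal.ofReal (gaussConst m * A ^ (-((1 + (m : ℝ) * θ) / 2))
        * c ^ (2 * (m : ℝ) * θ) * (∏ j, σ j) ^ (-(1 + 2 * θ))) := by
  obtain ⟨B, rfl⟩ := exists_transpose_mul_self hR
  set M := B * Matrix.diagonal σ * (sumMatrix m).transpose with hM
  set p := ∏ j, σ j with hp
  have hp0 : 0 < p := Finset.prod_pos fun j _ => hσ j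
  have hwM : ∀ u, B.mulVec (w u) = M.mulVec u := by
    intro u
    rw [hM, ← Matrix.mulVec_mulVec, ← Matrix.mulVec_mulVec]
    congr 1
    ext j
    rw [hw, Matrix.mulVec_diagonal]
  have hQ : ∀ u, w u ⬝ᵥ (B.transpose * B).mulVec (w u) = M.mulVec u ⬝ᵥ M.mulVec u := by
    intro u
    rw [← Matrix.mulVec_mulVec, Matrix.dotProduct_mulVec, Matrix.vecMul_transpose, hwM]
  have hBdet : (B.transpose * B).det = B.det ^ 2 := by
    rw [Matrix.det_mul, Matrix.det_transpose, sq]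
  have hMdet : M.det = B.det * p := by
    rw [hM, Matrix.det_mul, Matrix.det_mul, Matrix.det_transpose, det_sumMatrix,
      Matrix.det_diagonal, mul_one]
  rw [hBdet] at hdet
  have hB0 : B.det ≠ 0 := fun h => by rw [h] at hdet; norm_num at hdet; linarith
  have hM0 : M.det ≠ 0 := by rw [hMdet]; exact mul_ne_zero hB0 hp0.ne'
  have hMinv : |M.det⁻¹| ≤ A ^ (-(1 / 2 : ℝ)) * p⁻¹ := by
    rw [hMdet, mul_inv, abs_mul, abs_of_pos (inv_pos.mpr hp0), abs_inv, Real.rpow_neg hA.le,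
      ← Real.sqrt_eq_rpow]
    have : Real.sqrt A ≤ |B.det| := by
      rw [← Real.sqrt_sq_eq_abs]; exact Real.sqrt_le_sqrt hdet
    have := Real.sqrt_pos.mpr hA
    gcongr
  set F : ℝ := (m.factorial : ℝ) with hF
  have hF1 : 1 ≤ F := by rw [hF]; exact_mod_cast Nat.one_le_iff_ne_zero.mpr (Nat.factorial_ne_zero m)
  have hm0 : (0 : ℝ) ≤ (m : ℝ) := Nat.cast_nonneg m
  set k1 : ℝ := 2 ^ m * F ^ m * (F * 4 ^ m * Real.exp (1 / 4)) with hk1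
  set k2 : ℝ := k1 * A ^ (-((m : ℝ) * θ / 2)) * c ^ (2 * (m : ℝ) * θ) * p ^ (-(2 * θ)) with hk2
  have hk20 : 0 ≤ k2 := by positivity
  have hpt : ∀ u, (∏ j, |u j|) ^ θ * Real.exp (-(1 / 2) * (w u ⬝ᵥ (B.transpose * B).mulVec (w u)))
      ≤ k2 * Real.exp (-(1 / 4) * (M.mulVec u ⬝ᵥ M.mulVec u)) := by
    intro u
    rw [hQ]
    set q := M.mulVec u ⬝ᵥ M.mulVec u with hq
    have hq0 : 0 ≤ q := by
      rw [hq, dotProduct]; exact Finset.sum_nonneg fun _ _ => mul_self_nonneg _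
    have hwj : ∀ j, |σ j * ((sumMatrix m).transpose.mulVec u) j| ≤ Real.sqrt (F / A * q) := by
      intro j
      rw [← hw, ← Real.sqrt_sq_eq_abs]
      refine Real.sqrt_le_sqrt ?_
      have := sq_le_of_gram hd hA (hBdet ▸ hdet) (w u) j
      rwa [hwM] at this
    -- The number D of that lemma is √(m! q / A), where q = |Mu|² is the quadratic form.
    have h1 := prod_abs_le_of_sumMatrix hm u σ hc (Real.sqrt_nonneg _) hσ hσc hwj
    have h2 : (∏ j, |u j|) ^ θ
        ≤ ((2 * c ^ 2 * Real.sqrt (F / A * q)) ^ m / p ^ 2) ^ θ :=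
      Real.rpow_le_rpow (Finset.prod_nonneg fun _ _ => abs_nonneg _) h1 hθ
    have h3 : ((2 * c ^ 2 * Real.sqrt (F / A * q)) ^ m / p ^ 2) ^ θ
        = (2 : ℝ) ^ (m * θ) * F ^ (m * θ / 2) * A ^ (-((m : ℝ) * θ / 2)) * c ^ (2 * (m : ℝ) * θ)
          * p ^ (-(2 * θ)) * q ^ (m * θ / 2) := by
      rw [Real.div_rpow (by positivity) (by positivity), ← Real.rpow_natCast _ m,
        ← Real.rpow_mul (by positivity), Real.mul_rpow (by positivity) (by positivity),
        Real.mul_rpow (by positivity) (by positivity), Real.sqrt_eq_rpow,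
        ← Real.rpow_mul (by positivity), Real.mul_rpow (by positivity) hq0,
        Real.div_rpow (by positivity) hA.le, ← Real.rpow_natCast c 2,
        ← Real.rpow_mul (by positivity), ← Real.rpow_natCast p 2, ← Real.rpow_mul hp0.le,
        Real.rpow_neg hp0.le, Real.rpow_neg hA.le]
      push_cast
      rw [show (2 : ℝ) * (m * θ) = 2 * m * θ by ring, show (1 / 2 : ℝ) * (m * θ) = m * θ / 2 by ring]
      field_simp
    have h4 : (2 : ℝ) ^ (m * θ) ≤ 2 ^ m := by
      rw [← Real.rpow_natCast]
      exact Real.rpow_le_rpow_of_exponent_le (by norm_num) (by nlinarith)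
    have h5 : F ^ (m * θ / 2) ≤ F ^ m := by
      rw [← Real.rpow_natCast]
      exact Real.rpow_le_rpow_of_exponent_le hF1 (by nlinarith)
    have h6 := rpow_mul_exp_le (m := m) hq0 (show 0 ≤ m * θ / 2 by positivity) (by nlinarith)
    calc (∏ j, |u j|) ^ θ * Real.exp (-(1 / 2) * q)
        ≤ ((2 : ℝ) ^ (m * θ) * F ^ (m * θ / 2) * A ^ (-((m : ℝ) * θ / 2)) * c ^ (2 * (m : ℝ) * θ)
          * p ^ (-(2 * θ)) * q ^ (m * θ / 2)) * Real.exp (-(1 / 2) * q) := by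
          rw [← h3]; gcongr
      _ = (2 : ℝ) ^ (m * θ) * F ^ (m * θ / 2) * (A ^ (-((m : ℝ) * θ / 2)) * c ^ (2 * (m : ℝ) * θ)
          * p ^ (-(2 * θ))) * (q ^ (m * θ / 2) * Real.exp (-(1 / 2) * q)) := by ring
      _ ≤ 2 ^ m * F ^ m * (A ^ (-((m : ℝ) * θ / 2)) * c ^ (2 * (m : ℝ) * θ)
          * p ^ (-(2 * θ))) * (F * 4 ^ m * Real.exp (1 / 4) * Real.exp (-(1 / 4) * q)) := by
          gcongr
      _ = _ := by rw [hk2, hk1]; ring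
  have hmeas : Measurable fun y : Fin m → ℝ => ENNReal.ofReal (Real.exp (-(1 / 4) * (y ⬝ᵥ y))) := by
    unfold dotProduct
    fun_prop
  calc _ ≤ ∫⁻ u : Fin m → ℝ, ENNReal.ofReal k2
          * ENNReal.ofReal (Real.exp (-(1 / 4) * (M.mulVec u ⬝ᵥ M.mulVec u))) := by
        refine lintegral_mono fun u => ?_
        rw [← ENNReal.ofReal_mul hk20]
        exact ENNReal.ofReal_le_ofReal (hpt u)
    _ = ENNReal.ofReal k2 * (ENNReal.ofReal |M.det⁻¹| * gaussMass m) := by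
        rw [lintegral_const_mul' _ _ ENNReal.ofReal_ne_top,
          lintegral_comp_mulVec hM0 _ hmeas, gaussMass]
    _ ≤ ENNReal.ofReal k2 * (ENNReal.ofReal (A ^ (-(1 / 2 : ℝ)) * p⁻¹)
          * ENNReal.ofReal ((gaussMass m).toReal + 1)) := by
        gcongr
        rw [← ENNReal.ofReal_toReal (gaussMass_lt_top m).ne]
        exact ENNReal.ofReal_le_ofReal (by simp)
    _ = _ := by
        rw [← ENNReal.ofReal_mul (by positivity), ← ENNReal.ofReal_mul hk20]
        congr 1
        rw [hk2, hk1, gaussConst, ← hF, show -((1 + (m : ℝ) * θ) / 2) = -(m * θ / 2) + -(1 / 2) by ring,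
          show -(1 + 2 * θ) = -(2 * θ) + -1 by ring, Real.rpow_add hA, Real.rpow_add hp0,
          Real.rpow_neg_one]
        ring

end LocalTime

/-! ### The moment formula and the ordering of the times -/

namespace LocalTime

lemma lintegral_fin_prod_eq_prod {m : ℕ} (f : Fin m → ℝ → ℝ≥0∞) (hf : ∀ i, Measurable (f i)) :
    ∫⁻ x : Fin m → ℝ, ∏ i, f i (x i) = ∏ i, ∫⁻ y, f i y := by
  induction m with
  | zero => simp [lintegral_unique, volume_pi]
  | succ n ih =>
    have h := (volume_preserving_piFinSuccAbove (fun _ : Fin (n + 1) => ℝ) 0).symm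
    rw [← h.lintegral_comp_emb (MeasurableEquiv.measurableEmbedding _)]
    simp only [MeasurableEquiv.piFinSuccAbove_symm_apply, Fin.insertNthEquiv, Equiv.coe_fn_mk,
      Fin.insertNth_zero', Fin.prod_univ_succ, Fin.cons_zero, Fin.cons_succ]
    rw [Measure.volume_eq_prod, lintegral_prod_mul (g := fun y : Fin n → ℝ => ∏ x, f x.succ (y x))
      (hf 0).aemeasurable, ih _ fun i => hf i.succ]
    exact (Finset.measurable_prod _ fun i _ => (hf i.succ).comp (measurable_pi_apply i)).aemeasurable

lemma lintegral_comp_perm {m : ℕ} (σ : Equiv.Perm (Fin m)) (G : (Fin m → ℝ) → ℝ≥0∞) :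
    ∫⁻ r : Fin m → ℝ, G (r ∘ σ) = ∫⁻ r, G r := by
  have h := volume_measurePreserving_piCongrLeft (fun _ : Fin m => ℝ) σ.symm
  refine Eq.trans ?_ (h.lintegral_comp_emb (MeasurableEquiv.measurableEmbedding _) G)
  refine lintegral_congr fun r => congrArg G ?_
  ext i
  have h1 := (Equiv.piCongrLeft_apply_apply (fun _ : Fin m => ℝ) σ.symm r (σ i)).symm
  rw [Equiv.symm_apply_apply] at h1
  exact h1

lemma measurableSet_monotone (m : ℕ) : MeasurableSet {r : Fin m → ℝ | Monotone r} := by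
  have : {r : Fin m → ℝ | Monotone r} = ⋂ i, ⋂ j, ⋂ _ : i ≤ j, {r | r i ≤ r j} := by
    ext r; simp [Monotone]
  rw [this]
  exact MeasurableSet.iInter fun i => MeasurableSet.iInter fun j => MeasurableSet.iInter fun _ =>
    measurableSet_le (measurable_pi_apply i) (measurable_pi_apply j)

/-- Every r is sorted by some permutation, so F is dominated by the sum over permutations of its
restriction to the ordered cone. Ties are counted several times, which is harmless for an upper
bound. -/
lemma lintegral_le_factorial_mul_monotone {m : ℕ} (F : (Fin m → ℝ) → ℝ≥0∞) (hF : Measurable F)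
    (hsym : ∀ (σ : Equiv.Perm (Fin m)) r, F (r ∘ σ) = F r) :
    ∫⁻ r, F r ≤ m.factorial * ∫⁻ r, {r : Fin m → ℝ | Monotone r}.indicator F r := by
  set G := {r : Fin m → ℝ | Monotone r}.indicator F with hG
  have hGm : Measurable G := hF.indicator (measurableSet_monotone m)
  calc ∫⁻ r, F r ≤ ∫⁻ r, ∑ σ : Equiv.Perm (Fin m), G (r ∘ σ) := by
        refine lintegral_mono fun r => ?_
        refine le_trans ?_ (Finset.single_le_sum (fun _ _ => zero_le) (Finset.mem_univ (Tuple.sort r)))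
        rw [hG, indicator_of_mem (Tuple.monotone_sort r : r ∘ _ ∈ {r | Monotone r}), hsym]
    _ = ∑ σ : Equiv.Perm (Fin m), ∫⁻ r, G r := by
        rw [lintegral_finsetSum]
        · exact Finset.sum_congr rfl fun σ _ => lintegral_comp_perm σ G
        · exact fun σ _ => hGm.comp (measurable_pi_lambda _ fun i => measurable_pi_apply _)
    _ = _ := by
        rw [Finset.sum_const, Finset.card_univ, Fintype.card_perm, Fintype.card_fin, nsmul_eq_mul]

variable {Ω : Type*} [MeasurableSpace Ω]

/-- The Fourier-type integral `∫ g(u) ∫_s^t e^{iuX_r} dr du`. -/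
noncomputable def occInt (X : ℝ → Ω → ℝ) (g : ℝ → ℂ) (s t : ℝ) (ω : Ω) : ℂ :=
  ∫ u, g u * ∫ r in Ico s t, Complex.exp (Complex.I * u * (X r ω : ℝ))

/-- The modulus of the characteristic function of `(X_{r_1}, …, X_{r_m})`. -/
noncomputable def jointCharNorm (P : Measure Ω) (X : ℝ → Ω → ℝ) {m : ℕ} (u r : Fin m → ℝ) : ℝ≥0∞ :=
  ‖∫ ω, Complex.exp (Complex.I * ((∑ j, u j * X (r j) ω : ℝ) : ℂ)) ∂P‖ₑ

/-- The integrand in the time variables of the moment formula. -/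
noncomputable def timeKernel (P : Measure Ω) (X : ℝ → Ω → ℝ) (g : ℝ → ℂ) {m : ℕ}
    (r : Fin m → ℝ) : ℝ≥0∞ :=
  ∫⁻ u : Fin m → ℝ, (∏ j, ‖g (u j)‖ₑ) * jointCharNorm P X u r

lemma enorm_prod_eq {ι : Type*} (s : Finset ι) (f : ι → ℂ) : ‖∏ i ∈ s, f i‖ₑ = ∏ i ∈ s, ‖f i‖ₑ := by
  simp only [← ofReal_norm, norm_prod, ENNReal.ofReal_prod_of_nonneg fun i _ => norm_nonneg (f i)]

lemma norm_exp_I_mul (a b : ℝ) : ‖Complex.exp (Complex.I * a * b)‖ = 1 := by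
  rw [mul_assoc, ← Complex.ofReal_mul, Complex.norm_exp_I_mul_ofReal]

variable {P : Measure Ω} {X : ℝ → Ω → ℝ}

lemma measurable_comp_process (hX : Measurable (Function.uncurry X)) {β : Type*} [MeasurableSpace β]
    {f : β → ℝ} {h : β → Ω} (hf : Measurable f) (hh : Measurable h) :
    Measurable fun b => X (f b) (h b) := hX.comp (hf.prodMk hh)

lemma measurable_jointCharNorm [SFinite P] (hX : Measurable (Function.uncurry X)) (m : ℕ) :
    Measurable fun p : (Fin m → ℝ) × (Fin m → ℝ) => jointCharNorm P X p.1 p.2 := by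
  unfold jointCharNorm
  refine Measurable.enorm (StronglyMeasurable.measurable ?_)
  refine StronglyMeasurable.integral_prod_right
    (f := fun (p : (Fin m → ℝ) × (Fin m → ℝ)) ω =>
      Complex.exp (Complex.I * ((∑ j, p.1 j * X (p.2 j) ω : ℝ) : ℂ))) ?_
  refine Measurable.stronglyMeasurable ?_
  refine Complex.measurable_exp.comp (measurable_const.mul (Complex.measurable_ofReal.comp ?_))
  refine Finset.measurable_sum _ fun j _ => Measurable.mul (by fun_prop) ?_
  exact measurable_comp_process hX (by fun_prop) (by fun_prop)

lemma measurable_timeKernel [SFinite P] (hX : Measurable (Function.uncurry X)) {g : ℝ → ℂ}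
    (hg : Measurable g) (m : ℕ) : Measurable (timeKernel P X g (m := m)) := by
  unfold timeKernel
  refine Measurable.lintegral_prod_right' (f := fun p : (Fin m → ℝ) × (Fin m → ℝ) =>
    (∏ j, ‖g (p.2 j)‖ₑ) * jointCharNorm P X p.2 p.1) ?_
  have h1 := measurable_jointCharNorm (P := P) hX m
  have h2 := h1.comp (measurable_snd.prodMk measurable_fst)
  refine Measurable.mul ?_ h2
  exact Finset.measurable_prod (f := fun j (p : (Fin m → ℝ) × (Fin m → ℝ)) => ‖g (p.2 j)‖ₑ) _
    fun j _ => (hg.comp ((measurable_pi_apply j).comp measurable_snd)).enorm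

lemma timeKernel_comp_perm (g : ℝ → ℂ) {m : ℕ} (σ : Equiv.Perm (Fin m)) (r : Fin m → ℝ) :
    timeKernel P X g (r ∘ σ) = timeKernel P X g r := by
  unfold timeKernel
  rw [← lintegral_comp_perm σ]
  refine lintegral_congr fun u => ?_
  simp only [Function.comp_apply, jointCharNorm]
  congr 1
  · exact Equiv.prod_comp σ fun j => ‖g (u j)‖ₑ
  · congr 2
    ext ω
    rw [Equiv.sum_comp σ fun j => u j * X (r j) ω]

lemma integrable_occInt_integrand (hX : Measurable (Function.uncurry X)) {g : ℝ → ℂ}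
    (hgi : Integrable g) (hg : Measurable g) (s t : ℝ) (ω : Ω) :
    Integrable (fun p : ℝ × ℝ => g p.1 * Complex.exp (Complex.I * p.1 * (X p.2 ω : ℝ)))
      (volume.prod (volume.restrict (Ico s t))) := by
  have h1 : Integrable (fun p : ℝ × ℝ => g p.1) (volume.prod (volume.restrict (Ico s t))) :=
    hgi.comp_fst _
  refine h1.mono ?_ (ae_of_all _ fun p => ?_)
  · refine Measurable.aestronglyMeasurable ?_
    have := measurable_comp_process hX (f := fun p : ℝ × ℝ => p.2) (h := fun _ => ω)
      (by fun_prop) (by fun_prop)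
    fun_prop
  · rw [norm_mul, norm_exp_I_mul, mul_one]

lemma occInt_eq_integral_prod (hX : Measurable (Function.uncurry X)) {g : ℝ → ℂ}
    (hgi : Integrable g) (hg : Measurable g) (s t : ℝ) (ω : Ω) :
    occInt X g s t ω = ∫ p : ℝ × ℝ, g p.1 * Complex.exp (Complex.I * p.1 * (X p.2 ω : ℝ))
      ∂(volume.prod (volume.restrict (Ico s t))) := by
  rw [integral_prod _ (integrable_occInt_integrand hX hgi hg s t ω)]
  simp only [occInt, integral_const_mul]

lemma measurable_occInt (hX : Measurable (Function.uncurry X)) {g : ℝ → ℂ}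
    (hg : Measurable g) (s t : ℝ) : Measurable (occInt X g s t) := by
  unfold occInt
  refine (StronglyMeasurable.integral_prod_right (f := fun ω u =>
    g u * ∫ r in Ico s t, Complex.exp (Complex.I * u * (X r ω : ℝ))) ?_).measurable
  refine StronglyMeasurable.mul (f := fun p : Ω × ℝ => g p.2)
    (hg.comp measurable_snd).stronglyMeasurable ?_
  refine StronglyMeasurable.integral_prod_right (f := fun (p : Ω × ℝ) r =>
    Complex.exp (Complex.I * p.2 * (X r p.1 : ℝ))) ?_
  refine Measurable.stronglyMeasurable ?_
  have := measurable_comp_process hX (f := fun p : (Ω × ℝ) × ℝ => p.2) (h := fun p => p.1.1)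
      (by fun_prop) (by fun_prop)
  simp only [Function.uncurry_def]
  fun_prop

-- The integral is real: conjugation amounts to the substitution u ↦ -u when g is Hermitian.
omit [MeasurableSpace Ω] in
lemma conj_occInt {g : ℝ → ℂ} (hg : ∀ u, (starRingEnd ℂ) (g u) = g (-u)) (s t : ℝ) (ω : Ω) :
    (starRingEnd ℂ) (occInt X g s t ω) = occInt X g s t ω := by
  unfold occInt
  rw [← integral_conj, ← integral_neg_eq_self]
  refine integral_congr_ae (ae_of_all _ fun u => ?_)
  simp only [map_mul, hg, neg_neg]
  congr 1
  rw [← integral_conj]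
  refine integral_congr_ae (ae_of_all _ fun r => ?_)
  simp only [← Complex.exp_conj, map_mul, Complex.conj_I, Complex.conj_ofReal]
  congr 1
  push_cast
  ring

/-- The integral is real and m is even, so the m-th power of its modulus is its m-th power, an
integral over m copies of the (u, r) space. Fubini puts the expectation inside, where it is a joint
characteristic function, and only then are moduli taken, so that its decay is kept. -/
theorem lintegral_occInt_pow_le [IsProbabilityMeasure P] (hX : Measurable (Function.uncurry X))
    {g : ℝ → ℂ} (hgi : Integrable g) (hg : Measurable g)
    (hconj : ∀ u, (starRingEnd ℂ) (g u) = g (-u)) {s t : ℝ} {m : ℕ} (hm : Even m) :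
    ∫⁻ ω, ‖occInt X g s t ω‖ₑ ^ m ∂P
      ≤ ∫⁻ r, timeKernel P X g r ∂(Measure.pi fun _ : Fin m => volume.restrict (Ico s t)) := by
  set μ := (volume : Measure ℝ).restrict (Ico s t) with hμ
  set ν := Measure.pi fun _ : Fin m => (volume : Measure ℝ).prod μ with hν
  set f : Ω → (Fin m → ℝ × ℝ) → ℂ := fun ω p =>
    ∏ j, (g (p j).1 * Complex.exp (Complex.I * (p j).1 * (X (p j).2 ω : ℝ))) with hf
  have hpow : ∀ ω, occInt X g s t ω ^ m = ∫ p, f ω p ∂ν := by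
    intro ω
    rw [occInt_eq_integral_prod hX hgi hg, hν, hf]
    simp only
    rw [integral_fintype_prod_eq_pow (ι := Fin m) (μ := (volume : Measure ℝ).prod μ)
      (fun p : ℝ × ℝ => g p.1 * Complex.exp (Complex.I * p.1 * (X p.2 ω : ℝ))), Fintype.card_fin]
  have hfm : Measurable (Function.uncurry f) := by
    refine Finset.measurable_prod _ fun j _ => ?_
    have := measurable_comp_process hX (f := fun p : Ω × (Fin m → ℝ × ℝ) => (p.2 j).2)
      (h := fun p => p.1) (by fun_prop) (by fun_prop)
    fun_prop
  have hfn : ∀ ω p, ‖f ω p‖ = ∏ j, ‖g (p j).1‖ := by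
    intro ω p
    simp only [hf, norm_prod, norm_mul, norm_exp_I_mul, mul_one]
  have hfi : Integrable (Function.uncurry f) (P.prod ν) := by
    have h0 : Integrable (fun p : ℝ × ℝ => ‖g p.1‖) ((volume : Measure ℝ).prod μ) :=
      (hgi.comp_fst _).norm
    have h1 : Integrable (fun p : Fin m → ℝ × ℝ => ∏ j, ‖g (p j).1‖) ν :=
      Integrable.fintype_prod (f := fun _ (p : ℝ × ℝ) => ‖g p.1‖)
        (μ := fun _ => (volume : Measure ℝ).prod μ) fun _ => h0
    have h2 : Integrable (fun q : Ω × (Fin m → ℝ × ℝ) => ∏ j, ‖g (q.2 j).1‖) (P.prod ν) :=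
      h1.comp_snd _
    exact h2.mono' hfm.aestronglyMeasurable (ae_of_all _ fun q => (hfn q.1 q.2).le)
  have hreal : ∀ ω, ‖occInt X g s t ω‖ₑ ^ m
      = ENNReal.ofReal ((occInt X g s t ω ^ m).re) ∧ 0 ≤ (occInt X g s t ω ^ m).re := by
    intro ω
    obtain ⟨y, hy⟩ := Complex.conj_eq_iff_real.mp (conj_occInt (X := X) hconj s t ω)
    rw [hy, ← Complex.ofReal_pow, Complex.ofReal_re]
    refine ⟨?_, hm.pow_nonneg y⟩
    rw [← hm.pow_abs, ENNReal.ofReal_pow (abs_nonneg y), ← Real.norm_eq_abs, ofReal_norm]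
    congr 1
    rw [← ofReal_norm, ← ofReal_norm, Complex.norm_real]
  have hint : Integrable (fun ω => occInt X g s t ω ^ m) P := by
    simp only [hpow]
    exact hfi.integral_prod_left
  calc ∫⁻ ω, ‖occInt X g s t ω‖ₑ ^ m ∂P
      = ENNReal.ofReal (∫ ω, (occInt X g s t ω ^ m).re ∂P) := by
        have hre : Integrable (fun ω => (occInt X g s t ω ^ m).re) P := hint.re
        rw [ofReal_integral_eq_lintegral_ofReal hre (ae_of_all _ fun ω => (hreal ω).2)]
        exact lintegral_congr fun ω => (hreal ω).1
    _ ≤ ‖∫ ω, occInt X g s t ω ^ m ∂P‖ₑ := by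
        rw [← ofReal_norm]
        refine ENNReal.ofReal_le_ofReal ?_
        have : ∫ ω, (occInt X g s t ω ^ m).re ∂P = (∫ ω, occInt X g s t ω ^ m ∂P).re :=
          integral_re hint
        rw [this]
        exact Complex.re_le_norm _
    _ = ‖∫ p, ∫ ω, f ω p ∂P ∂ν‖ₑ := by
        simp only [hpow]
        rw [integral_integral_swap hfi]
    _ ≤ ∫⁻ p, ‖∫ ω, f ω p ∂P‖ₑ ∂ν := enorm_integral_le_lintegral_enorm _
    _ = ∫⁻ p, (∏ j, ‖g (p j).1‖ₑ) * jointCharNorm P X (fun j => (p j).1) (fun j => (p j).2) ∂ν := by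
        refine lintegral_congr fun p => ?_
        have : ∀ ω, f ω p = (∏ j, g (p j).1)
            * Complex.exp (Complex.I * ((∑ j, (p j).1 * X (p j).2 ω : ℝ) : ℂ)) := by
          intro ω
          simp only [hf, Finset.prod_mul_distrib, ← Complex.exp_sum]
          congr 2
          push_cast
          rw [Finset.mul_sum]
          exact Finset.sum_congr rfl fun _ _ => by ring
        simp only [this, integral_const_mul, enorm_mul, jointCharNorm]
        congr 1
        exact enorm_prod_eq _ _
    _ = ∫⁻ q, (∏ j, ‖g (q.1 j)‖ₑ) * jointCharNorm P X q.1 q.2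
          ∂((Measure.pi fun _ : Fin m => volume).prod (Measure.pi fun _ : Fin m => μ)) := by
        have h := measurePreserving_arrowProdEquivProdArrow ℝ ℝ (Fin m) (fun _ => volume) (fun _ => μ)
        rw [← h.lintegral_comp_emb (MeasurableEquiv.measurableEmbedding _)]
        rfl
    _ = _ := by
        rw [lintegral_prod_symm _ ?_]
        · rfl
        · refine Measurable.aemeasurable (Measurable.mul ?_ (measurable_jointCharNorm hX m))
          exact Finset.measurable_prod
            (f := fun j (p : (Fin m → ℝ) × (Fin m → ℝ)) => ‖g (p.1 j)‖ₑ) _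
            fun j _ => (hg.comp ((measurable_pi_apply j).comp measurable_fst)).enorm

end LocalTime

/-! ### Gaussian increments and their covariance -/

namespace LocalTime

variable {Ω : Type*} [MeasurableSpace Ω]

/-- A jointly measurable centered Gaussian process with stationary increments whose standard
deviation is bounded by `c` and whose negative moment `σ ^ (-(1 + 2δ))` has integrals of order
`h ^ α` over intervals of length `h`. -/
structure IsRegularProcess (P : Measure Ω) (T : ℝ) (X : ℝ → Ω → ℝ) (c δ α K : ℝ) : Prop where
  measurable_uncurry : Measurable (Function.uncurry X)
  gaussian : IsCenteredGaussianStatIncr P T X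
  one_le : 1 ≤ c
  sigma_le : ∀ t ∈ Icc (0 : ℝ) T, sigma P X t ≤ c
  delta_pos : 0 < δ
  lintegral_le : ∀ t ∈ Icc (0 : ℝ) T, ∀ h : ℝ, 0 ≤ h → t + h ≤ T →
    ∫⁻ s in Icc t (t + h), ENNReal.ofReal (sigma P X s) ^ (-(1 + 2 * δ)) ≤ ENNReal.ofReal (K * h ^ α)

/-- The determinant of the covariance matrix of `m` consecutive normalized increments is bounded
below by `A`. -/
def HasDetLowerBound (P : Measure Ω) (T : ℝ) (X : ℝ → Ω → ℝ) (m : ℕ) (A : ℝ) : Prop :=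
  0 < A ∧ ∀ t : Fin (m + 1) → ℝ, t 0 = 0 → StrictMono t → t (Fin.last m) < T →
    A ≤ (normIncrCov P X t).det

variable {P : Measure Ω} {X : ℝ → Ω → ℝ} {T : ℝ}

lemma measurable_sigma [SFinite P] (hX : Measurable (Function.uncurry X)) :
    Measurable (sigma P X) := by
  have h1 : Measurable fun t => ∫ ω, X t ω ∂P :=
    (StronglyMeasurable.integral_prod_right hX.stronglyMeasurable).measurable
  have h2 : Measurable fun t => ∫⁻ ω, ‖X t ω - ∫ ω', X t ω' ∂P‖ₑ ^ 2 ∂P := by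
    refine Measurable.lintegral_prod_right' (f := fun p : ℝ × Ω =>
      ‖X p.1 p.2 - ∫ ω', X p.1 ω' ∂P‖ₑ ^ 2) ?_
    have h3 : Measurable fun p : ℝ × Ω => X p.1 p.2 := hX
    have h4 : Measurable fun p : ℝ × Ω => ∫ ω', X p.1 ω' ∂P := h1.comp measurable_fst
    exact ((h3.sub h4).enorm).pow_const 2
  exact (Real.continuous_sqrt.measurable).comp h2.ennreal_toReal

namespace IsCenteredGaussianStatIncr

lemma hasGaussianLaw_sum (hX : IsCenteredGaussianStatIncr P T X) {m : ℕ} (u r : Fin m → ℝ)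
    (hr : ∀ j, r j ∈ Icc (0 : ℝ) T) : HasGaussianLaw (fun ω => ∑ j, u j * X (r j) ω) P :=
  ((hX.gaussian.comp_right fun j : Fin m => (⟨r j, hr j⟩ : Icc (0 : ℝ) T)).smul
    u).hasGaussianLaw_fun_sum (I := Finset.univ)

lemma memLp_two (hX : IsCenteredGaussianStatIncr P T X) {t : ℝ} (ht : t ∈ Icc (0 : ℝ) T) :
    MemLp (X t) 2 P := (hX.gaussian.hasGaussianLaw_eval ⟨t, ht⟩).memLp_two

/-- A linear combination of the process is one Gaussian variable, and the expectation is its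
characteristic function at 1; the mean only affects the phase. -/
lemma jointCharNorm_eq [IsProbabilityMeasure P] (hX : IsCenteredGaussianStatIncr P T X) {m : ℕ}
    (u r : Fin m → ℝ) (hr : ∀ j, r j ∈ Icc (0 : ℝ) T) :
    jointCharNorm P X u r
      = ENNReal.ofReal (Real.exp (-(1 / 2) * variance (fun ω => ∑ j, u j * X (r j) ω) P)) := by
  have hg := hX.hasGaussianLaw_sum u r hr
  have h1 : ∫ ω, Complex.exp (Complex.I * ((∑ j, u j * X (r j) ω : ℝ) : ℂ)) ∂P
      = charFun (P.map fun ω => ∑ j, u j * X (r j) ω) 1 := by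
    rw [charFun_apply_real, integral_map hg.aemeasurable (by fun_prop)]
    refine integral_congr_ae (ae_of_all _ fun ω => ?_)
    simp only [Complex.ofReal_one, one_mul, mul_comm Complex.I]
  rw [jointCharNorm, h1, hg.map_eq_gaussianReal, charFun_gaussianReal, ← ofReal_norm,
    Complex.norm_exp]
  congr 2
  simp [Real.coe_toNNReal _ (variance_nonneg _ _)]
  ring

lemma variance_sub (hX : IsCenteredGaussianStatIncr P T X) {s t : ℝ} (hs : s ∈ Icc (0 : ℝ) T)
    (ht : t ∈ Icc (0 : ℝ) T) (hst : s ≤ t) :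
    variance (fun ω => X t ω - X s ω) P = sigma P X (t - s) ^ 2 := by
  rw [(hX.stationary s hs t ht hst).variance_eq, sigma, Real.sq_sqrt (variance_nonneg _ _)]
  refine variance_congr ?_
  filter_upwards [hX.null_at_zero] with ω h
  rw [h, sub_zero]

lemma sigma_zero (hX : IsCenteredGaussianStatIncr P T X) : sigma P X 0 = 0 := by
  have h : variance (X 0) P = variance (fun _ : Ω => (0 : ℝ)) P := variance_congr hX.null_at_zero
  rw [sigma, h]
  have : variance (fun _ : Ω => (0 : ℝ)) P = 0 := variance_zero P
  rw [this, Real.sqrt_zero]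

end IsCenteredGaussianStatIncr

/-- The normalized increment of the process between `t_{j}` and `t_{j+1}`. -/
noncomputable def normIncr (P : Measure Ω) (X : ℝ → Ω → ℝ) {m : ℕ} (t : Fin (m + 1) → ℝ) (j : Fin m)
    (ω : Ω) : ℝ :=
  (X (t j.succ) ω - X (t j.castSucc) ω) / sigma P X (t j.succ - t j.castSucc)

lemma memLp_normIncr (hX : IsCenteredGaussianStatIncr P T X) {m : ℕ} {t : Fin (m + 1) → ℝ}
    (ht : ∀ j, t j ∈ Icc (0 : ℝ) T) (j : Fin m) : MemLp (normIncr P X t j) 2 P := by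
  have h := ((hX.memLp_two (ht j.succ)).sub (hX.memLp_two (ht j.castSucc))).mul_const
    (sigma P X (t j.succ - t j.castSucc))⁻¹
  exact h

lemma variance_sum_normIncr [IsProbabilityMeasure P] (hX : IsCenteredGaussianStatIncr P T X) {m : ℕ}
    {t : Fin (m + 1) → ℝ} (ht : ∀ j, t j ∈ Icc (0 : ℝ) T) (w : Fin m → ℝ) :
    variance (fun ω => ∑ j, w j * normIncr P X t j ω) P
      = w ⬝ᵥ (normIncrCov P X t).mulVec w := by
  have hm : ∀ j, MemLp (fun ω => w j * normIncr P X t j ω) 2 P := fun j =>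
    (memLp_normIncr hX ht j).const_mul _
  have hm' : AEMeasurable (fun ω => ∑ j, w j * normIncr P X t j ω) P :=
    (memLp_finsetSum _ fun j _ => hm j).aestronglyMeasurable.aemeasurable
  rw [← covariance_self hm', covariance_fun_sum_fun_sum hm hm, dotProduct]
  refine Finset.sum_congr rfl fun i _ => ?_
  rw [Matrix.mulVec, dotProduct, Finset.mul_sum]
  refine Finset.sum_congr rfl fun j _ => ?_
  rw [covariance_const_mul_left, covariance_const_mul_right]
  change w i * (w j * covariance (normIncr P X t i) (normIncr P X t j) P)
    = w i * (covariance (normIncr P X t i) (normIncr P X t j) P * w j)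
  ring

lemma posSemidef_normIncrCov [IsProbabilityMeasure P] (hX : IsCenteredGaussianStatIncr P T X) {m : ℕ}
    {t : Fin (m + 1) → ℝ} (ht : ∀ j, t j ∈ Icc (0 : ℝ) T) : (normIncrCov P X t).PosSemidef := by
  refine Matrix.PosSemidef.of_dotProduct_mulVec_nonneg ?_ fun w => ?_
  · ext i j
    simp only [Matrix.conjTranspose_apply, normIncrCov, Matrix.of_apply, star_trivial]
    exact covariance_comm _ _
  · rw [star_trivial, ← variance_sum_normIncr hX ht]
    exact variance_nonneg _ _

lemma normIncrCov_diag (hX : IsCenteredGaussianStatIncr P T X) {m : ℕ}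
    {t : Fin (m + 1) → ℝ} (ht : ∀ j, t j ∈ Icc (0 : ℝ) T) {j : Fin m} (hj : t j.castSucc ≤ t j.succ)
    (hσ : 0 < sigma P X (t j.succ - t j.castSucc)) : normIncrCov P X t j j = 1 := by
  have h : normIncrCov P X t j j = covariance (normIncr P X t j) (normIncr P X t j) P := rfl
  rw [h, covariance_self (memLp_normIncr hX ht j).aestronglyMeasurable.aemeasurable]
  have h2 : normIncr P X t j = fun ω => (sigma P X (t j.succ - t j.castSucc))⁻¹
      * (X (t j.succ) ω - X (t j.castSucc) ω) := by
    ext ω; rw [normIncr, div_eq_inv_mul]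
  rw [h2, variance_const_mul, hX.variance_sub (ht _) (ht _) hj]
  field_simp

lemma cons_sumMatrix_succ_sub_castSucc {m : ℕ} (d : Fin m → ℝ) (j : Fin m) :
    (Fin.cons 0 ((sumMatrix m).mulVec d) : Fin (m + 1) → ℝ) j.succ
      - (Fin.cons 0 ((sumMatrix m).mulVec d) : Fin (m + 1) → ℝ) j.castSucc = d j := by
  obtain ⟨n, rfl⟩ : ∃ n, m = n + 1 := ⟨m - 1, by have := j.pos; omega⟩
  rw [Fin.cons_succ]
  refine Fin.cases ?_ (fun i => ?_) j
  · rw [Fin.castSucc_zero, Fin.cons_zero, sub_zero]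
    simp only [Matrix.mulVec, dotProduct, sumMatrix, Matrix.of_apply, ite_mul, one_mul, zero_mul]
    rw [Finset.sum_eq_single 0] <;> simp +contextual
  · rw [← Fin.succ_castSucc, Fin.cons_succ]
    simp only [Matrix.mulVec, dotProduct, sumMatrix, Matrix.of_apply, ite_mul, one_mul, zero_mul,
      ← Finset.sum_sub_distrib]
    rw [Finset.sum_eq_single i.succ]
    · simp
    · intro b _ hb
      have hb' : (b : ℕ) ≠ i + 1 := fun h => hb (Fin.ext h)
      have : b ≤ i.succ ↔ b ≤ i.castSucc := by
        simp only [Fin.le_def, Fin.val_castSucc, Fin.val_succ]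
        omega
      simp [this]
    · simp

/-- Summation by parts: the partial sums of the increments recover f(r_j) because f vanishes at 0,
and moving the summation matrix to the other side transposes it. -/
lemma sum_mul_eq_sum_increments {m : ℕ} (u r : Fin m → ℝ) (f : ℝ → ℝ) (hf : f 0 = 0) :
    ∑ j, u j * f (r j) = ∑ j, ((sumMatrix m).transpose.mulVec u) j
      * (f ((Fin.cons 0 r : Fin (m + 1) → ℝ) j.succ) - f ((Fin.cons 0 r : Fin (m + 1) → ℝ) j.castSucc)) := by
  set D : Fin m → ℝ := fun j => f ((Fin.cons 0 r : Fin (m + 1) → ℝ) j.succ)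
    - f ((Fin.cons 0 r : Fin (m + 1) → ℝ) j.castSucc) with hD
  have h : (sumMatrix m).mulVec D = fun j => f (r j) := by
    have key : ∀ i : Fin (m + 1), (Fin.cons 0 ((sumMatrix m).mulVec D) : Fin (m + 1) → ℝ) i
        = f ((Fin.cons 0 r : Fin (m + 1) → ℝ) i) := by
      intro i
      induction i using Fin.induction with
      | zero => simp [hf]
      | succ i ih =>
        have := cons_sumMatrix_succ_sub_castSucc D i
        rw [ih] at this
        simp only [hD] at this ⊢
        linarith
    ext j
    have := key j.succ
    simpa using this
  calc ∑ j, u j * f (r j) = u ⬝ᵥ (sumMatrix m).mulVec D := by rw [h]; rfl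
    _ = _ := by rw [Matrix.dotProduct_mulVec, ← Matrix.mulVec_transpose]; rfl

end LocalTime

/-! ### The moment estimate for general kernels -/

namespace LocalTime

variable {Ω : Type*} [MeasurableSpace Ω] {P : Measure Ω} {X : ℝ → Ω → ℝ} {T : ℝ}

/-- The function `σ(s) ^ (-(1 + 2δ))`, with value `∞` where `σ` vanishes. -/
noncomputable def sigmaPow (P : Measure Ω) (X : ℝ → Ω → ℝ) (δ s : ℝ) : ℝ≥0∞ :=
  ENNReal.ofReal (sigma P X s) ^ (-(1 + 2 * δ))

/-- Each factor σ_j^{2(δ-θ)} is at most c^{2(δ-θ)}, so the single integrability assumption, with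
exponent 1 + 2δ, serves all θ ≤ δ. The powers of c add up to 2mδ whatever θ is. -/
lemma prod_rpow_le_of_le {m : ℕ} (σ : Fin m → ℝ) {c δ θ : ℝ} (hσ : ∀ j, 0 < σ j)
    (hσc : ∀ j, σ j ≤ c) (hc : 1 ≤ c) (hθ : θ ≤ δ) :
    c ^ (2 * (m : ℝ) * θ) * (∏ j, σ j) ^ (-(1 + 2 * θ))
      ≤ c ^ (2 * (m : ℝ) * δ) * ∏ j, σ j ^ (-(1 + 2 * δ)) := by
  have hc0 : 0 < c := by linarith
  have h1 : ∀ j, σ j ^ (-(1 + 2 * θ)) ≤ c ^ (2 * (δ - θ)) * σ j ^ (-(1 + 2 * δ)) := fun j => by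
    rw [show -(1 + 2 * θ) = 2 * (δ - θ) + -(1 + 2 * δ) by ring, Real.rpow_add (hσ j)]
    have := hσ j
    gcongr
    exact hσc j
  rw [← Real.finsetProd_rpow _ _ fun j _ => (hσ j).le]
  calc c ^ (2 * (m : ℝ) * θ) * ∏ j, σ j ^ (-(1 + 2 * θ))
      ≤ c ^ (2 * (m : ℝ) * θ) * ∏ j, (c ^ (2 * (δ - θ)) * σ j ^ (-(1 + 2 * δ))) := by
        gcongr with j _
        · exact fun j _ => Real.rpow_nonneg (hσ j).le _
        · exact h1 j
    _ = _ := by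
        rw [Finset.prod_mul_distrib, Finset.prod_const, Finset.card_univ, Fintype.card_fin,
          ← mul_assoc, ← Real.rpow_natCast, ← Real.rpow_mul hc0.le, ← Real.rpow_add hc0]
        ring_nf

/-- The constant of `timeKernel_le`. -/
noncomputable def kernelConst (m : ℕ) (A a c δ θ : ℝ) : ℝ :=
  a ^ m * (gaussConst m * A ^ (-((1 + (m : ℝ) * θ) / 2)) * c ^ (2 * (m : ℝ) * δ))

theorem timeKernel_le [IsProbabilityMeasure P] {c δ α K : ℝ} (hX : IsRegularProcess P T X c δ α K)
    {m : ℕ} (hm : m ≠ 0) {A : ℝ} (hA : HasDetLowerBound P T X m A) {g : ℝ → ℂ} {a θ : ℝ}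
    (ha : 0 < a) (hθ : 0 ≤ θ) (hθ1 : θ ≤ 1) (hθδ : θ ≤ δ) (hg : ∀ u, ‖g u‖ ≤ a * |u| ^ θ)
    (d : Fin m → ℝ) (hmono : Monotone ((sumMatrix m).mulVec d))
    (hmem : ∀ j, (sumMatrix m).mulVec d j ∈ Ico (0 : ℝ) T) :
    timeKernel P X g ((sumMatrix m).mulVec d)
      ≤ ENNReal.ofReal (kernelConst m A a c δ θ) * ∏ j, sigmaPow P X δ (d j) := by
  have hG := hX.gaussian
  have hδ := hX.delta_pos
  have hc0 : 0 < c := by linarith [hX.one_le]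
  have hA0 := hA.1
  have hK0 : 0 < kernelConst m A a c δ θ := by
    have := gaussConst_pos m
    unfold kernelConst; positivity
  set r := (sumMatrix m).mulVec d with hr
  set t : Fin (m + 1) → ℝ := Fin.cons 0 r with ht
  have hd : ∀ j, t j.succ - t j.castSucc = d j := cons_sumMatrix_succ_sub_castSucc d
  have hT : 0 < T := by
    have := hmem ⟨0, by omega⟩
    exact this.1.trans_lt this.2
  have htm : ∀ j, t j ∈ Ico (0 : ℝ) T := by
    intro j
    refine Fin.cases ?_ (fun i => ?_) j
    · simpa [ht] using hT
    · simpa [ht] using hmem i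
  have htm' : ∀ j, t j ∈ Icc (0 : ℝ) T := fun j => Ico_subset_Icc_self (htm j)
  have hd0 : ∀ j, 0 ≤ d j := by
    have htmono : Monotone t := by
      intro i j hij
      induction i using Fin.cases with
      | zero => simpa [ht] using (htm j).1
      | succ i =>
        induction j using Fin.cases with
        | zero => exact absurd hij (by simp)
        | succ j => simpa [ht] using hmono (Fin.succ_le_succ_iff.mp hij)
    intro j
    rw [← hd]
    exact sub_nonneg.mpr (htmono (Fin.castSucc_le_succ j))
  have hdmem : ∀ j, d j ∈ Icc (0 : ℝ) T := fun j => by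
    refine ⟨hd0 j, ?_⟩
    rw [← hd]
    linarith [(htm j.succ).2, (htm j.castSucc).1]
  -- If σ vanishes at some gap, the right-hand side is infinite: one factor is ∞ and no other is 0,
  -- since σ is finite. Otherwise all gaps are nonzero, because σ(0) = 0, so the times increase
  -- strictly and the determinant bound applies.
  by_cases hpos : ∀ j, 0 < sigma P X (d j)
  swap
  · push Not at hpos
    obtain ⟨j, hj⟩ := hpos
    have h1 : sigmaPow P X δ (d j) = ⊤ := by
      rw [sigmaPow, ENNReal.ofReal_of_nonpos hj, ENNReal.zero_rpow_of_neg (by linarith)]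
    have h2 : ∏ j, sigmaPow P X δ (d j) = ⊤ := by
      rw [← Finset.mul_prod_erase _ _ (Finset.mem_univ j), h1, ENNReal.top_mul]
      refine Finset.prod_ne_zero_iff.mpr fun i _ => ?_
      rw [sigmaPow]
      intro h0
      rw [ENNReal.rpow_eq_zero_iff] at h0
      rcases h0 with h0 | h0
      · linarith [h0.2]
      · exact ENNReal.ofReal_ne_top h0.1
    rw [h2, ENNReal.mul_top]
    · exact le_top
    · simpa using hK0
  have hstrict : StrictMono t := by
    rw [Fin.strictMono_iff_lt_succ]
    intro j
    have h0 : d j ≠ 0 := fun h => by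
      have := hpos j
      rw [h, hG.sigma_zero] at this
      exact this.false
    have := (hd0 j).lt_of_ne' h0
    rw [← hd] at this
    linarith
  -- The determinant bound requires the last time to be strictly less than T, which is why times
  -- range over half-open intervals.
  have hdet := hA.2 t (by simp [ht]) hstrict (htm _).2
  set R := normIncrCov P X t with hRdef
  have hR : R.PosSemidef := posSemidef_normIncrCov hG htm'
  have hdiag : ∀ j, R j j = 1 := fun j =>
    normIncrCov_diag hG htm' (by have := hd j; have := hd0 j; linarith) (by rw [hd]; exact hpos j)
  set w : (Fin m → ℝ) → Fin m → ℝ := fun u j =>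
    sigma P X (d j) * ((sumMatrix m).transpose.mulVec u) j with hw
  have hvar : ∀ u : Fin m → ℝ, variance (fun ω => ∑ j, u j * X (r j) ω) P
      = w u ⬝ᵥ R.mulVec (w u) := by
    intro u
    rw [hRdef, ← variance_sum_normIncr hG htm']
    refine variance_congr ?_
    filter_upwards [hG.null_at_zero] with ω h0
    rw [sum_mul_eq_sum_increments u r (fun s => X s ω) h0]
    refine Finset.sum_congr rfl fun j _ => ?_
    simp only [hw, normIncr, hd]
    have := (hpos j).ne'
    field_simp
    rfl
  have hσc : ∀ j, sigma P X (d j) ≤ c := fun j => hX.sigma_le _ (hdmem j)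
  have hbound := lintegral_prod_rpow_mul_exp_le hm hR hdiag hA0 hdet (fun j => sigma P X (d j))
    hX.one_le hpos hσc hθ hθ1 w (fun _ _ => rfl)
  have hprod := prod_rpow_le_of_le (fun j => sigma P X (d j)) hpos hσc hX.one_le hθδ
  have hgC := gaussConst_pos m
  calc timeKernel P X g r
      ≤ ∫⁻ u : Fin m → ℝ, ENNReal.ofReal (a ^ m) * ENNReal.ofReal ((∏ j, |u j|) ^ θ
        * Real.exp (-(1 / 2) * (w u ⬝ᵥ R.mulVec (w u)))) := by
        refine lintegral_mono fun u => ?_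
        rw [hG.jointCharNorm_eq u r fun j => Ico_subset_Icc_self (hmem j), hvar,
          ← ENNReal.ofReal_mul (by positivity), ← enorm_prod_eq, ← ofReal_norm, norm_prod,
          ← ENNReal.ofReal_mul (by positivity), ← mul_assoc]
        refine ENNReal.ofReal_le_ofReal (mul_le_mul_of_nonneg_right ?_ (Real.exp_pos _).le)
        rw [← Real.finsetProd_rpow _ _ fun j _ => abs_nonneg _]
        calc ∏ j, ‖g (u j)‖ ≤ ∏ j, (a * |u j| ^ θ) :=
              Finset.prod_le_prod (fun _ _ => norm_nonneg _) fun j _ => hg _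
          _ = _ := by
              rw [Finset.prod_mul_distrib, Finset.prod_const, Finset.card_univ, Fintype.card_fin]
    _ = ENNReal.ofReal (a ^ m) * ∫⁻ u : Fin m → ℝ, ENNReal.ofReal ((∏ j, |u j|) ^ θ
        * Real.exp (-(1 / 2) * (w u ⬝ᵥ R.mulVec (w u)))) :=
        lintegral_const_mul' _ _ ENNReal.ofReal_ne_top
    _ ≤ ENNReal.ofReal (a ^ m) * ENNReal.ofReal (gaussConst m * A ^ (-((1 + (m : ℝ) * θ) / 2))
        * c ^ (2 * (m : ℝ) * θ) * (∏ j, sigma P X (d j)) ^ (-(1 + 2 * θ))) := by gcongr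
    _ ≤ ENNReal.ofReal (a ^ m) * ENNReal.ofReal (gaussConst m * A ^ (-((1 + (m : ℝ) * θ) / 2))
        * (c ^ (2 * (m : ℝ) * δ) * ∏ j, sigma P X (d j) ^ (-(1 + 2 * δ)))) := by
        rw [mul_assoc (gaussConst m * _)]
        gcongr
    _ = _ := by
        have : ∏ j, sigmaPow P X δ (d j)
            = ENNReal.ofReal (∏ j, sigma P X (d j) ^ (-(1 + 2 * δ))) := by
          rw [ENNReal.ofReal_prod_of_nonneg fun j _ => Real.rpow_nonneg (hpos j).le _]
          refine Finset.prod_congr rfl fun j _ => ?_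
          rw [sigmaPow, ENNReal.ofReal_rpow_of_pos (hpos j)]
        rw [this, ← ENNReal.ofReal_mul (by positivity), ← ENNReal.ofReal_mul hK0.le, kernelConst]
        congr 1
        ring

lemma lintegral_sumMatrix {m : ℕ} (f : (Fin m → ℝ) → ℝ≥0∞) (hf : Measurable f) :
    ∫⁻ r, f r = ∫⁻ d, f ((sumMatrix m).mulVec d) := by
  rw [lintegral_comp_mulVec (by rw [det_sumMatrix]; norm_num) f hf, det_sumMatrix]
  simp

/-- After ordering the times, the unimodular change of variables to gaps makes the bound of
`timeKernel_le` a product of functions of single coordinates, and Tonelli's theorem separates them.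
-/
theorem lintegral_occInt_pow_le_const [IsProbabilityMeasure P] {c δ α K : ℝ}
    (hX : IsRegularProcess P T X c δ α K)
    {m : ℕ} (hm : m ≠ 0) (hme : Even m) {A : ℝ} (hA : HasDetLowerBound P T X m A) {g : ℝ → ℂ}
    {a θ : ℝ} (ha : 0 < a) (hθ : 0 ≤ θ) (hθ1 : θ ≤ 1) (hθδ : θ ≤ δ)
    (hg : ∀ u, ‖g u‖ ≤ a * |u| ^ θ) (hgm : Measurable g) (hgi : Integrable g)
    (hconj : ∀ u, (starRingEnd ℂ) (g u) = g (-u)) {s t : ℝ} (hs : 0 ≤ s) (hst : s ≤ t)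
    (ht : t ≤ T) :
    ∫⁻ ω, ‖occInt X g s t ω‖ₑ ^ m ∂P
      ≤ ENNReal.ofReal (m.factorial * kernelConst m A a c δ θ)
        * ENNReal.ofReal (K * (t - s) ^ α) ^ m := by
  have hXm := hX.measurable_uncurry
  set B : Set (Fin m → ℝ) := Set.univ.pi fun _ => Ico s t with hB
  have hBm : MeasurableSet B := MeasurableSet.univ_pi fun _ => measurableSet_Ico
  set F := B.indicator (timeKernel P X g (m := m)) with hF
  have hFm : Measurable F := (measurable_timeKernel hXm hgm m).indicator hBm
  have hsym : ∀ (σ : Equiv.Perm (Fin m)) r, F (r ∘ σ) = F r := by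
    intro σ r
    have hiff : r ∘ σ ∈ B ↔ r ∈ B := by
      simp only [hB, mem_univ_pi, Function.comp_apply]
      exact ⟨fun h i => by simpa using h (σ.symm i), fun h i => h _⟩
    by_cases hr : r ∈ B
    · rw [hF, indicator_of_mem hr, indicator_of_mem (hiff.mpr hr), timeKernel_comp_perm]
    · rw [hF, indicator_of_notMem hr, indicator_of_notMem fun h => hr (hiff.mp h)]
  -- The coordinate of index 0 is the earliest time itself, in [s, t]; the others are gaps, in [0, t
  -- - s]. Both windows have length t - s, so assumption (ii) gives the same bound for each.
  set I : Fin m → Set ℝ := fun j => if (j : ℕ) = 0 then Icc s t else Icc 0 (t - s) with hI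
  have hIm : ∀ j, MeasurableSet (I j) := fun j => by
    simp only [hI]; split_ifs <;> exact measurableSet_Icc
  have hφm : Measurable (sigmaPow P X δ) :=
    (ENNReal.measurable_ofReal.comp (measurable_sigma hXm)).pow_const _
  have hK0 : 0 ≤ kernelConst m A a c δ θ := by
    have := gaussConst_pos m
    have := hA.1
    have := hX.one_le
    unfold kernelConst; positivity
  have hpt : ∀ d : Fin m → ℝ, {r : Fin m → ℝ | Monotone r}.indicator F ((sumMatrix m).mulVec d)
      ≤ ENNReal.ofReal (kernelConst m A a c δ θ)
        * ∏ j, (I j).indicator (sigmaPow P X δ) (d j) := by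
    intro d
    by_cases h1 : Monotone ((sumMatrix m).mulVec d)
    swap
    · rw [indicator_of_notMem (by exact h1)]; exact zero_le
    rw [indicator_of_mem (by exact h1)]
    by_cases h2 : (sumMatrix m).mulVec d ∈ B
    swap
    · rw [hF, indicator_of_notMem h2]; exact zero_le
    rw [hF, indicator_of_mem h2]
    have h3 : ∀ j, (sumMatrix m).mulVec d j ∈ Ico s t := fun j => h2 j (mem_univ j)
    refine (timeKernel_le hX hm hA ha hθ hθ1 hθδ hg d h1
      fun j => ⟨hs.trans (h3 j).1, (h3 j).2.trans_le ht⟩).trans ?_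
    gcongr with j _
    have hj : d j ∈ I j := by
      obtain ⟨n, rfl⟩ := Nat.exists_eq_add_one_of_ne_zero hm
      have h4 := cons_sumMatrix_succ_sub_castSucc d j
      rw [Fin.cons_succ] at h4
      induction j using Fin.cases with
      | zero =>
        rw [Fin.castSucc_zero, Fin.cons_zero, sub_zero] at h4
        simp only [hI, Fin.val_zero, if_true]
        rw [← h4]
        exact Ico_subset_Icc_self (h3 0)
      | succ i =>
        rw [← Fin.succ_castSucc, Fin.cons_succ] at h4
        simp only [hI, Fin.val_succ, Nat.add_eq_zero_iff, one_ne_zero, and_false, if_false]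
        have h5 := h1 (show i.castSucc ≤ i.succ from Fin.castSucc_le_succ i)
        rw [← h4]
        constructor
        · linarith
        · linarith [(h3 i.succ).2, (h3 i.castSucc).1]
    rw [indicator_of_mem hj]
  calc ∫⁻ ω, ‖occInt X g s t ω‖ₑ ^ m ∂P
      ≤ ∫⁻ r, timeKernel P X g r ∂(Measure.pi fun _ : Fin m => volume.restrict (Ico s t)) :=
        lintegral_occInt_pow_le hXm hgi hgm hconj hme
    _ = ∫⁻ r, F r := by
        rw [← Measure.restrict_pi_pi, ← volume_pi, lintegral_indicator hBm]
    _ ≤ m.factorial * ∫⁻ r, {r : Fin m → ℝ | Monotone r}.indicator F r :=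
        lintegral_le_factorial_mul_monotone F hFm hsym
    _ = m.factorial * ∫⁻ d, {r : Fin m → ℝ | Monotone r}.indicator F ((sumMatrix m).mulVec d) := by
        rw [lintegral_sumMatrix _ (hFm.indicator (measurableSet_monotone m))]
    _ ≤ m.factorial * ∫⁻ d : Fin m → ℝ, ENNReal.ofReal (kernelConst m A a c δ θ)
        * ∏ j, (I j).indicator (sigmaPow P X δ) (d j) := by
        gcongr with d
        exact hpt d
    _ = m.factorial * (ENNReal.ofReal (kernelConst m A a c δ θ)
        * ∏ j, ∫⁻ y in I j, sigmaPow P X δ y) := by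
        rw [lintegral_const_mul' _ _ ENNReal.ofReal_ne_top,
          lintegral_fin_prod_eq_prod _ fun j => hφm.indicator (hIm j)]
        simp only [lintegral_indicator (hIm _)]
    _ ≤ m.factorial * (ENNReal.ofReal (kernelConst m A a c δ θ)
        * ∏ _j : Fin m, ENNReal.ofReal (K * (t - s) ^ α)) := by
        gcongr with j _
        simp only [hI]
        split_ifs
        · have := hX.lintegral_le s ⟨hs, hst.trans ht⟩ (t - s) (by linarith) (by linarith)
          rwa [add_sub_cancel] at this
        · have := hX.lintegral_le 0 ⟨le_rfl, hs.trans (hst.trans ht)⟩ (t - s) (by linarith)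
            (by linarith)
          rwa [zero_add] at this
    _ = _ := by
        rw [Finset.prod_const, Finset.card_univ, Fintype.card_fin, ← mul_assoc,
          ENNReal.ofReal_mul (p := (m.factorial : ℝ)) (by positivity), ENNReal.ofReal_natCast]

end LocalTime

/-! ### Truncated Fourier kernels and the increments of `psi` -/

namespace LocalTime

variable {Ω : Type*} [MeasurableSpace Ω] {P : Measure Ω} {X : ℝ → Ω → ℝ} {T : ℝ}

lemma integrable_exp_process (hX : Measurable (Function.uncurry X)) (s t u : ℝ) (ω : Ω) :
    Integrable (fun r => Complex.exp (Complex.I * u * (X r ω : ℝ))) (volume.restrict (Ico s t)) := by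
  refine (integrable_const (1 : ℝ)).mono' ?_ (ae_of_all _ fun r => (norm_exp_I_mul _ _).le)
  have := measurable_comp_process hX (f := fun r : ℝ => r) (h := fun _ => ω)
      (by fun_prop) (by fun_prop)
  exact Measurable.aestronglyMeasurable (by fun_prop)

lemma integrable_occInt_outer (hX : Measurable (Function.uncurry X)) {g : ℝ → ℂ}
    (hgi : Integrable g) (hg : Measurable g) (s t : ℝ) (ω : Ω) :
    Integrable fun u => g u * ∫ r in Ico s t, Complex.exp (Complex.I * u * (X r ω : ℝ)) := by
  have h := (integrable_occInt_integrand hX hgi hg s t ω).integral_prod_left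
  simpa only [integral_const_mul] using h

lemma occInt_add_interval (hX : Measurable (Function.uncurry X)) {g : ℝ → ℂ}
    (hgi : Integrable g) (hg : Measurable g) {r s t : ℝ} (hrs : r ≤ s) (hst : s ≤ t) (ω : Ω) :
    occInt X g r t ω = occInt X g r s ω + occInt X g s t ω := by
  unfold occInt
  rw [← integral_add (integrable_occInt_outer hX hgi hg r s ω)
    (integrable_occInt_outer hX hgi hg s t ω)]
  refine integral_congr_ae (ae_of_all _ fun u => ?_)
  simp only
  rw [← mul_add, ← Ico_union_Ico_eq_Ico hrs hst, setIntegral_union ?_ measurableSet_Ico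
    (integrable_exp_process hX r s u ω) (integrable_exp_process hX s t u ω)]
  exact Set.disjoint_left.mpr fun a ha hb => absurd ha.2 (not_lt.mpr hb.1)

lemma occInt_sub (hX : Measurable (Function.uncurry X)) {g g' : ℝ → ℂ}
    (hgi : Integrable g) (hg : Measurable g) (hgi' : Integrable g') (hg' : Measurable g')
    (s t : ℝ) (ω : Ω) :
    occInt X (fun u => g u - g' u) s t ω = occInt X g s t ω - occInt X g' s t ω := by
  unfold occInt
  rw [← integral_sub (integrable_occInt_outer hX hgi hg s t ω)
    (integrable_occInt_outer hX hgi' hg' s t ω)]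
  refine integral_congr_ae (ae_of_all _ fun u => ?_)
  simp only
  ring

omit [MeasurableSpace Ω] in
lemma norm_integral_exp_le {s t : ℝ} (hst : s ≤ t) (u : ℝ) (ω : Ω) :
    ‖∫ r in Ico s t, Complex.exp (Complex.I * u * (X r ω : ℝ))‖ ≤ t - s := by
  have h := norm_setIntegral_le_of_norm_le_const (μ := volume) (s := Ico s t) (C := 1)
    (f := fun r => Complex.exp (Complex.I * u * (X r ω : ℝ))) measure_Ico_lt_top
    fun r _ => (norm_exp_I_mul _ _).le
  rwa [one_mul, Real.volume_real_Ico_of_le hst] at h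

omit [MeasurableSpace Ω] in
lemma norm_occInt_le_of_indicator {g : ℝ → ℂ} {N C : ℝ}
    (hN : 0 ≤ N) (hC : 0 ≤ C) (hg : ∀ u, ‖g u‖ ≤ (Icc (-N) N).indicator (fun _ => C) u)
    {s t : ℝ} (hst : s ≤ t) (ω : Ω) :
    ‖occInt X g s t ω‖ ≤ 2 * N * C * (t - s) := by
  have hts : 0 ≤ t - s := by linarith
  have hi : Integrable ((Icc (-N) N).indicator fun _ => C * (t - s)) :=
    (integrable_indicator_iff measurableSet_Icc).mpr (integrableOn_const measure_Icc_lt_top.ne)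
  calc ‖occInt X g s t ω‖ ≤ ∫ u, (Icc (-N) N).indicator (fun _ => C * (t - s)) u := by
        refine norm_integral_le_of_norm_le hi (ae_of_all _ fun u => ?_)
        rw [norm_mul]
        have h1 := hg u
        by_cases hu : u ∈ Icc (-N) N
        · rw [indicator_of_mem hu] at h1 ⊢
          exact mul_le_mul h1 (norm_integral_exp_le hst u ω) (norm_nonneg _) hC
        · rw [indicator_of_notMem hu] at h1 ⊢
          rw [le_antisymm h1 (norm_nonneg _), zero_mul]
    _ = _ := by
        rw [integral_indicator measurableSet_Icc, setIntegral_const,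
          Real.volume_real_Icc_of_le (by linarith), smul_eq_mul]
        ring

/-- The truncated Fourier kernel `(2π)⁻¹ 1_{|u| ≤ N} e^{-iux}`. -/
noncomputable def fourierKernel (N x u : ℝ) : ℂ :=
  (Icc (-N) N).indicator
    (fun u => (1 / (2 * Real.pi) : ℂ) * Complex.exp (-(Complex.I * u * x))) u

lemma fourierKernel_of_mem {N u : ℝ} (hu : u ∈ Icc (-N) N) (x : ℝ) :
    fourierKernel N x u = (1 / (2 * Real.pi) : ℂ) * Complex.exp (-(Complex.I * u * x)) :=
  indicator_of_mem hu _

lemma fourierKernel_of_notMem {N u : ℝ} (hu : u ∉ Icc (-N) N) (x : ℝ) : fourierKernel N x u = 0 :=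
  indicator_of_notMem hu _

lemma norm_exp_neg_I_mul (a b : ℝ) : ‖Complex.exp (-(Complex.I * a * b))‖ = 1 := by
  have := norm_exp_I_mul (-a) b
  rw [← this]
  congr 2
  push_cast
  ring

lemma norm_inv_two_pi_le : ‖(1 / (2 * Real.pi) : ℂ)‖ ≤ 1 / 2 := by
  have hpi := Real.pi_gt_three
  rw [norm_div, norm_mul, norm_one, Complex.norm_real, Real.norm_of_nonneg Real.pi_pos.le]
  norm_num
  exact inv_le_one_of_one_le₀ (by linarith)

lemma norm_fourierKernel_le (N x u : ℝ) :
    ‖fourierKernel N x u‖ ≤ (Icc (-N) N).indicator (fun _ => (1 : ℝ)) u := by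
  by_cases hu : u ∈ Icc (-N) N
  · rw [fourierKernel_of_mem hu, indicator_of_mem hu, norm_mul, norm_exp_neg_I_mul, mul_one]
    linarith [norm_inv_two_pi_le]
  · rw [fourierKernel_of_notMem hu, indicator_of_notMem hu, norm_zero]

lemma measurable_fourierKernel (N x : ℝ) : Measurable (fourierKernel N x) :=
  Measurable.indicator (by fun_prop) measurableSet_Icc

lemma integrable_fourierKernel (N x : ℝ) : Integrable (fourierKernel N x) := by
  have hi : Integrable ((Icc (-N) N).indicator fun _ => (1 : ℝ)) :=
    (integrable_indicator_iff measurableSet_Icc).mpr (by simp)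
  exact hi.mono' (measurable_fourierKernel N x).aestronglyMeasurable
    (ae_of_all _ (norm_fourierKernel_le N x))

lemma conj_fourierKernel (N x u : ℝ) :
    (starRingEnd ℂ) (fourierKernel N x u) = fourierKernel N x (-u) := by
  have hiff : -u ∈ Icc (-N) N ↔ u ∈ Icc (-N) N := by
    simp only [mem_Icc]; constructor <;> rintro ⟨h1, h2⟩ <;> constructor <;> linarith
  by_cases hu : u ∈ Icc (-N) N
  · rw [fourierKernel_of_mem hu, fourierKernel_of_mem (hiff.mpr hu), map_mul, ← Complex.exp_conj]
    simp [map_ofNat]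
  · rw [fourierKernel_of_notMem hu, fourierKernel_of_notMem fun h => hu (hiff.mp h), map_zero]

lemma norm_exp_sub_exp_le (u x y : ℝ) :
    ‖Complex.exp (-(Complex.I * u * x)) - Complex.exp (-(Complex.I * u * y))‖ ≤ |u| * |x - y| := by
  have h : Complex.exp (-(Complex.I * u * x)) - Complex.exp (-(Complex.I * u * y))
      = Complex.exp (-(Complex.I * u * y)) * (Complex.exp (Complex.I * ((u * (y - x) : ℝ) : ℂ)) - 1) := by
    rw [mul_sub, mul_one, ← Complex.exp_add]
    congr 2
    push_cast
    ring
  rw [h, norm_mul, norm_exp_neg_I_mul, one_mul]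
  refine (Real.norm_exp_I_mul_ofReal_sub_one_le).trans ?_
  rw [Real.norm_eq_abs, abs_mul, abs_sub_comm]

lemma norm_fourierKernel_sub_le (N x y u : ℝ) :
    ‖fourierKernel N x u - fourierKernel N y u‖ ≤ (Icc (-N) N).indicator (fun u => |u| * |x - y|) u := by
  by_cases hu : u ∈ Icc (-N) N
  · rw [fourierKernel_of_mem hu, fourierKernel_of_mem hu, indicator_of_mem hu, ← mul_sub, norm_mul]
    calc _ ≤ 1 * (|u| * |x - y|) := mul_le_mul (by linarith [norm_inv_two_pi_le])
          (norm_exp_sub_exp_le _ _ _) (norm_nonneg _) zero_le_one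
      _ = _ := one_mul _
  · rw [fourierKernel_of_notMem hu, fourierKernel_of_notMem hu, indicator_of_notMem hu, sub_zero,
      norm_zero]

/-- Interpolation: the difference is at most min(1, |u||x - y|), and min(1, z) ≤ z^θ for 0 ≤ θ ≤ 1.
This is where δ ≤ 1 enters the bound on rectangular increments. -/
lemma norm_fourierKernel_sub_le_rpow (N x y u : ℝ) {θ : ℝ} (hθ : 0 ≤ θ) (hθ1 : θ ≤ 1) :
    ‖fourierKernel N x u - fourierKernel N y u‖ ≤ |x - y| ^ θ * |u| ^ θ := by
  have h0 : 0 ≤ |u| * |x - y| := by positivity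
  rw [mul_comm, ← Real.mul_rpow (abs_nonneg _) (abs_nonneg _)]
  by_cases hu : u ∈ Icc (-N) N
  · rcases le_or_gt (|u| * |x - y|) 1 with h | h
    · refine (norm_fourierKernel_sub_le N x y u).trans ?_
      rw [indicator_of_mem hu]
      exact Real.self_le_rpow_of_le_one h0 h hθ1
    · rw [fourierKernel_of_mem hu, fourierKernel_of_mem hu, ← mul_sub, norm_mul]
      have h1 : ‖Complex.exp (-(Complex.I * u * x)) - Complex.exp (-(Complex.I * u * y))‖ ≤ 2 := by
        refine (norm_sub_le _ _).trans ?_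
        rw [norm_exp_neg_I_mul, norm_exp_neg_I_mul]; norm_num
      calc _ ≤ 1 / 2 * (2 : ℝ) := mul_le_mul norm_inv_two_pi_le h1 (norm_nonneg _) (by norm_num)
        _ = 1 := by norm_num
        _ ≤ _ := Real.one_le_rpow h.le hθ
  · rw [fourierKernel_of_notMem hu, fourierKernel_of_notMem hu, sub_zero, norm_zero]
    positivity

/-- The difference lives on |u| > M, where (|u|/M)^θ ≥ 1 while the kernel is at most 1. -/
lemma norm_fourierKernel_tail_le {M N : ℝ} (hM : 0 < M) (hMN : M ≤ N) (x u : ℝ) {θ : ℝ} (hθ : 0 ≤ θ) :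
    ‖fourierKernel N x u - fourierKernel M x u‖ ≤ M ^ (-θ) * |u| ^ θ := by
  by_cases hu : u ∈ Icc (-M) M
  · have hu' : u ∈ Icc (-N) N := ⟨by linarith [hu.1], by linarith [hu.2]⟩
    rw [fourierKernel_of_mem hu, fourierKernel_of_mem hu', sub_self, norm_zero]
    positivity
  · rw [fourierKernel_of_notMem hu, sub_zero]
    have h1 : M ≤ |u| := by
      by_contra h
      exact hu (abs_le.mp (not_le.mp h).le)
    have h2 : ‖fourierKernel N x u‖ ≤ 1 := (norm_fourierKernel_le N x u).trans
      (indicator_le_self' (fun _ _ => zero_le_one) u)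
    refine h2.trans ?_
    rw [Real.rpow_neg hM.le, inv_mul_eq_div, le_div_iff₀ (by positivity), one_mul]
    exact Real.rpow_le_rpow hM.le h1 hθ

omit [MeasurableSpace Ω] in
lemma psi_eq_occInt {N t : ℝ} (hN : 0 ≤ N) (ht : 0 ≤ t) (x : ℝ) (ω : Ω) :
    psi X N x t ω = occInt X (fourierKernel N x) 0 t ω := by
  have h : ∀ u, fourierKernel N x u * ∫ r in Ico 0 t, Complex.exp (Complex.I * u * (X r ω : ℝ))
      = (Icc (-N) N).indicator (fun u => (1 / (2 * Real.pi) : ℂ) * (Complex.exp (-(Complex.I * u * x))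
        * ∫ r in (0 : ℝ)..t, Complex.exp (Complex.I * u * (X r ω : ℝ)))) u := by
    intro u
    simp only [intervalIntegral.integral_of_le ht, ← integral_Ico_eq_integral_Ioc]
    by_cases hu : u ∈ Icc (-N) N
    · rw [fourierKernel_of_mem hu, indicator_of_mem hu, mul_assoc]
    · rw [fourierKernel_of_notMem hu, indicator_of_notMem hu, zero_mul]
  rw [occInt]
  simp only [h]
  rw [integral_indicator measurableSet_Icc, integral_const_mul, integral_Icc_eq_integral_Ioc,
    ← intervalIntegral.integral_of_le (by linarith), psi]

lemma measurable_psi (hX : Measurable (Function.uncurry X)) {N t : ℝ} (hN : 0 ≤ N) (ht : 0 ≤ t)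
    (x : ℝ) : Measurable (psi X N x t) := by
  have : psi X N x t = occInt X (fourierKernel N x) 0 t := funext fun ω => psi_eq_occInt hN ht x ω
  rw [this]
  exact measurable_occInt hX (measurable_fourierKernel N x) 0 t

omit [MeasurableSpace Ω] in
lemma psi_im (N x : ℝ) {t : ℝ} (hN : 0 ≤ N) (ht : 0 ≤ t) (ω : Ω) : (psi X N x t ω).im = 0 := by
  rw [psi_eq_occInt hN ht]
  exact Complex.conj_eq_iff_im.mp (conj_occInt (conj_fourierKernel N x) 0 t ω)

lemma psi_sub_psi_time (hX : Measurable (Function.uncurry X)) {N s t : ℝ} (hN : 0 ≤ N)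
    (hs : 0 ≤ s) (hst : s ≤ t) (x : ℝ) (ω : Ω) :
    psi X N x t ω - psi X N x s ω = occInt X (fourierKernel N x) s t ω := by
  rw [psi_eq_occInt hN (hs.trans hst), psi_eq_occInt hN hs, occInt_add_interval hX
    (integrable_fourierKernel N x) (measurable_fourierKernel N x) hs hst]
  ring

lemma psi_rect (hX : Measurable (Function.uncurry X)) {N s t : ℝ} (hN : 0 ≤ N)
    (hs : 0 ≤ s) (hst : s ≤ t) (x y : ℝ) (ω : Ω) :
    (psi X N y t ω - psi X N y s ω) - (psi X N x t ω - psi X N x s ω)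
      = occInt X (fun u => fourierKernel N y u - fourierKernel N x u) s t ω := by
  rw [psi_sub_psi_time hX hN hs hst, psi_sub_psi_time hX hN hs hst, occInt_sub hX
    (integrable_fourierKernel N y) (measurable_fourierKernel N y)
    (integrable_fourierKernel N x) (measurable_fourierKernel N x)]

lemma psi_tail (hX : Measurable (Function.uncurry X)) {M N t : ℝ} (hM : 0 ≤ M) (hN : 0 ≤ N)
    (ht : 0 ≤ t) (x : ℝ) (ω : Ω) :
    psi X N x t ω - psi X M x t ω
      = occInt X (fun u => fourierKernel N x u - fourierKernel M x u) 0 t ω := by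
  rw [psi_eq_occInt hN ht, psi_eq_occInt hM ht, occInt_sub hX
    (integrable_fourierKernel N x) (measurable_fourierKernel N x)
    (integrable_fourierKernel M x) (measurable_fourierKernel M x)]

/-- A bound valid for every path, since only |e^{iuX}| = 1 is used. Its growth in N is harmless: it
serves to interpolate between points of a grid whose mesh shrinks faster. -/
lemma norm_psi_sub_le (hX : Measurable (Function.uncurry X)) {N : ℝ} (hN : 0 ≤ N) {s t : ℝ}
    (hs : s ∈ Icc 0 T) (ht : t ∈ Icc 0 T) (x y : ℝ) (ω : Ω) :
    ‖psi X N x t ω - psi X N y s ω‖ ≤ 2 * N ^ 2 * T * |x - y| + 2 * N * |t - s| := by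
  have h1 : ‖psi X N x t ω - psi X N y t ω‖ ≤ 2 * N ^ 2 * T * |x - y| := by
    rw [psi_eq_occInt hN ht.1, psi_eq_occInt hN ht.1, ← occInt_sub hX
      (integrable_fourierKernel N x) (measurable_fourierKernel N x)
      (integrable_fourierKernel N y) (measurable_fourierKernel N y)]
    have h := norm_occInt_le_of_indicator (X := X) hN (C := N * |x - y|) (by positivity)
      (g := fun u => fourierKernel N x u - fourierKernel N y u) (fun u => ?_) ht.1 ω
    · refine h.trans ?_
      have : 0 ≤ |x - y| := abs_nonneg _
      calc 2 * N * (N * |x - y|) * (t - 0) ≤ 2 * N * (N * |x - y|) * T := by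
            gcongr
            linarith [ht.2]
        _ = _ := by ring
    · refine (norm_fourierKernel_sub_le N x y u).trans ?_
      refine indicator_le_indicator' fun hu => ?_
      gcongr
      exact abs_le.mpr hu
  have h2 : ∀ s t : ℝ, 0 ≤ s → s ≤ t → ‖psi X N y t ω - psi X N y s ω‖ ≤ 2 * N * (t - s) := by
    intro s t hs hst
    rw [psi_sub_psi_time hX hN hs hst]
    simpa using norm_occInt_le_of_indicator hN zero_le_one (norm_fourierKernel_le N y) hst ω
  have h3 : ‖psi X N y t ω - psi X N y s ω‖ ≤ 2 * N * |t - s| := by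
    rcases le_total s t with h | h
    · rw [abs_of_nonneg (by linarith)]; exact h2 s t hs.1 h
    · rw [norm_sub_rev, abs_sub_comm, abs_of_nonneg (by linarith)]; exact h2 t s ht.1 h
  calc _ ≤ _ := norm_sub_le_norm_sub_add_norm_sub _ (psi X N y t ω) _
    _ ≤ _ := add_le_add h1 h3

end LocalTime

/-! ### Moments of `psi` and uniform convergence along dyadic frequencies -/

namespace LocalTime

variable {Ω : Type*} [MeasurableSpace Ω] {P : Measure Ω} {X : ℝ → Ω → ℝ} {T : ℝ}

section Moments

variable [IsProbabilityMeasure P] {c δ α K : ℝ} {m : ℕ} {A : ℝ}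

theorem lintegral_psi_time_le (hX : IsRegularProcess P T X c δ α K) (hm : m ≠ 0) (hme : Even m)
    (hA : HasDetLowerBound P T X m A) {N : ℝ} (hN : 0 ≤ N) (x : ℝ) {s t : ℝ} (hs : 0 ≤ s)
    (hst : s ≤ t) (ht : t ≤ T) :
    ∫⁻ ω, ‖psi X N x t ω - psi X N x s ω‖ₑ ^ m ∂P
      ≤ ENNReal.ofReal (m.factorial * kernelConst m A 1 c δ 0)
        * ENNReal.ofReal (K * (t - s) ^ α) ^ m := by
  simp only [psi_sub_psi_time hX.measurable_uncurry hN hs hst]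
  refine lintegral_occInt_pow_le_const hX hm hme hA zero_lt_one le_rfl zero_le_one
    hX.delta_pos.le (fun u => ?_) (measurable_fourierKernel N x) (integrable_fourierKernel N x)
    (conj_fourierKernel N x) hs hst ht
  rw [Real.rpow_zero, mul_one]
  exact (norm_fourierKernel_le N x u).trans (indicator_le_self' (fun _ _ => zero_le_one) u)

theorem lintegral_psi_rect_le (hX : IsRegularProcess P T X c δ α K) (hm : m ≠ 0) (hme : Even m)
    (hA : HasDetLowerBound P T X m A) {N : ℝ} (hN : 0 ≤ N) {x y : ℝ} (hxy : x ≠ y) {s t : ℝ}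
    (hs : 0 ≤ s) (hst : s ≤ t) (ht : t ≤ T) {θ : ℝ} (hθ : 0 ≤ θ) (hθ1 : θ ≤ 1) (hθδ : θ ≤ δ) :
    ∫⁻ ω, ‖(psi X N y t ω - psi X N y s ω) - (psi X N x t ω - psi X N x s ω)‖ₑ ^ m ∂P
      ≤ ENNReal.ofReal (m.factorial * kernelConst m A (|y - x| ^ θ) c δ θ)
        * ENNReal.ofReal (K * (t - s) ^ α) ^ m := by
  simp only [psi_rect hX.measurable_uncurry hN hs hst]
  have h0 : 0 < |y - x| := abs_pos.mpr (sub_ne_zero.mpr hxy.symm)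
  exact lintegral_occInt_pow_le_const hX hm hme hA (by positivity) hθ hθ1 hθδ
    (fun u => norm_fourierKernel_sub_le_rpow N y x u hθ hθ1)
    ((measurable_fourierKernel N y).sub (measurable_fourierKernel N x))
    ((integrable_fourierKernel N y).sub (integrable_fourierKernel N x))
    (fun u => by rw [map_sub, conj_fourierKernel, conj_fourierKernel]) hs hst ht

theorem lintegral_psi_tail_le (hX : IsRegularProcess P T X c δ α K) (hm : m ≠ 0) (hme : Even m)
    (hA : HasDetLowerBound P T X m A) {M N : ℝ} (hM : 0 < M) (hMN : M ≤ N) (x : ℝ) {t : ℝ}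
    (ht : t ∈ Icc 0 T) {θ : ℝ} (hθ : 0 ≤ θ) (hθ1 : θ ≤ 1) (hθδ : θ ≤ δ) :
    ∫⁻ ω, ‖psi X N x t ω - psi X M x t ω‖ₑ ^ m ∂P
      ≤ ENNReal.ofReal (m.factorial * kernelConst m A (M ^ (-θ)) c δ θ)
        * ENNReal.ofReal (K * t ^ α) ^ m := by
  simp only [psi_tail hX.measurable_uncurry hM.le (hM.le.trans hMN) ht.1]
  have := lintegral_occInt_pow_le_const hX hm hme hA (by positivity) hθ hθ1 hθδ
    (fun u => norm_fourierKernel_tail_le hM hMN x u hθ)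
    ((measurable_fourierKernel N x).sub (measurable_fourierKernel M x))
    ((integrable_fourierKernel N x).sub (integrable_fourierKernel M x))
    (fun u => by rw [map_sub, conj_fourierKernel, conj_fourierKernel]) le_rfl ht.1 ht.2
  rwa [sub_zero] at this

lemma kernelConst_eq (m : ℕ) (A a c δ θ : ℝ) :
    kernelConst m A a c δ θ = a ^ m * kernelConst m A 1 c δ θ := by
  simp [kernelConst]

lemma kernelConst_pos {m : ℕ} {A a c δ θ : ℝ} (hA : 0 < A) (ha : 0 < a) (hc : 1 ≤ c) :
    0 < kernelConst m A a c δ θ := by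
  have := gaussConst_pos m
  unfold kernelConst
  positivity

theorem exists_lintegral_psi_tail_le (hX : IsRegularProcess P T X c δ α K) (hα : 0 < α) (hm : m ≠ 0)
    (hme : Even m) (hA : HasDetLowerBound P T X m A) {θ : ℝ} (hθ : 0 ≤ θ) (hθ1 : θ ≤ 1)
    (hθδ : θ ≤ δ) :
    ∃ B : ℝ≥0∞, B ≠ ⊤ ∧ ∀ M N x t : ℝ, 0 < M → M ≤ N → t ∈ Icc 0 T →
      ∫⁻ ω, ‖psi X N x t ω - psi X M x t ω‖ₑ ^ m ∂P ≤ B * ENNReal.ofReal (M ^ (-θ)) ^ m := by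
  refine ⟨ENNReal.ofReal (m.factorial * kernelConst m A 1 c δ θ) * ENNReal.ofReal (|K| * T ^ α) ^ m,
    ENNReal.mul_ne_top ENNReal.ofReal_ne_top (ENNReal.pow_ne_top ENNReal.ofReal_ne_top), ?_⟩
  intro M N x t hM hMN ht
  refine (lintegral_psi_tail_le hX hm hme hA hM hMN x ht hθ hθ1 hθδ).trans ?_
  have hk := kernelConst_pos (m := m) (δ := δ) (θ := θ) hA.1 zero_lt_one hX.one_le
  have ht0 := ht.1
  have h1 : ENNReal.ofReal (K * t ^ α) ≤ ENNReal.ofReal (|K| * T ^ α) := by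
    refine ENNReal.ofReal_le_ofReal ?_
    calc K * t ^ α ≤ |K| * t ^ α := by gcongr; exact le_abs_self K
      _ ≤ _ := by
        gcongr
        exact ht.2
  rw [kernelConst_eq, mul_comm (_ ^ m), ← mul_assoc, ENNReal.ofReal_mul (by positivity),
    ENNReal.ofReal_pow (by positivity), mul_right_comm]
  gcongr

end Moments

/-- The dyadic difference `ψ_{2^{k+1}} - ψ_{2^k}`. -/
noncomputable def psiDiff (X : ℝ → Ω → ℝ) (k : ℕ) (x t : ℝ) (ω : Ω) : ℂ :=
  psi X (2 ^ (k + 1)) x t ω - psi X (2 ^ k) x t ω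

/-- The Lipschitz constant of ψ_N in space is of order N², that is 4^k here, so a mesh 8^{-k} leaves
an oscillation of order 2^{-k}. Each of the two frequencies contributes 12T. -/
lemma norm_psiDiff_sub_le (hX : Measurable (Function.uncurry X)) (k : ℕ) {s t : ℝ}
    (hs : s ∈ Icc 0 T) (ht : t ∈ Icc 0 T) {x y : ℝ} (hx : |x - y| ≤ (1 / 8) ^ k)
    (htt : |t - s| ≤ T * (1 / 8) ^ k) (ω : Ω) :
    ‖psiDiff X k x t ω - psiDiff X k y s ω‖ ≤ 24 * T * (1 / 2) ^ k := by
  have hT : 0 ≤ T := hs.1.trans hs.2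
  have h1 := norm_psi_sub_le (T := T) hX (N := 2 ^ (k + 1)) (by positivity) hs ht x y ω
  have h2 := norm_psi_sub_le (T := T) hX (N := 2 ^ k) (by positivity) hs ht x y ω
  have key : ∀ N : ℝ, 0 ≤ N → N ≤ 2 * 2 ^ k →
      2 * N ^ 2 * T * |x - y| + 2 * N * |t - s| ≤ 12 * T * (1 / 2) ^ k := by
    intro N hN0 hN
    have e1 : (2 : ℝ) ^ k * 2 ^ k * (1 / 8) ^ k = (1 / 2) ^ k := by
      rw [← mul_pow, ← mul_pow]; norm_num
    have e2 : (2 : ℝ) ^ k * (1 / 8) ^ k ≤ (1 / 2) ^ k := by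
      rw [← mul_pow]; gcongr; norm_num
    calc 2 * N ^ 2 * T * |x - y| + 2 * N * |t - s|
        ≤ 2 * (2 * 2 ^ k) ^ 2 * T * (1 / 8) ^ k + 2 * (2 * 2 ^ k) * (T * (1 / 8) ^ k) := by gcongr
      _ = 8 * T * (2 ^ k * 2 ^ k * (1 / 8) ^ k) + 4 * T * (2 ^ k * (1 / 8) ^ k) := by ring
      _ ≤ 8 * T * (1 / 2) ^ k + 4 * T * (1 / 2) ^ k := by rw [e1]; gcongr
      _ = _ := by ring
  have h3 := key (2 ^ (k + 1)) (by positivity) (by rw [pow_succ]; linarith)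
  have h4 := key (2 ^ k) (by positivity) (by have : (0 : ℝ) < 2 ^ k := by positivity
                                             linarith)
  calc ‖psiDiff X k x t ω - psiDiff X k y s ω‖
      = ‖(psi X (2 ^ (k + 1)) x t ω - psi X (2 ^ (k + 1)) y s ω)
          - (psi X (2 ^ k) x t ω - psi X (2 ^ k) y s ω)‖ := by
        congr 1; simp only [psiDiff]; ring
    _ ≤ _ := norm_sub_le _ _
    _ ≤ _ := by linarith

/-- The paths along which the dyadic differences are uniformly summable on compact sets. -/
def IsGoodPath (T : ℝ) (X : ℝ → Ω → ℝ) (ω : Ω) : Prop :=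
  ∀ n : ℕ, ∃ u : ℕ → ℝ, Summable u ∧
    ∀ k, ∀ x ∈ Icc (-(n : ℝ)) n, ∀ t ∈ Icc 0 T, ‖psiDiff X k x t ω‖ ≤ u k

lemma exists_int_near {n k : ℕ} {x : ℝ} (hx : x ∈ Icc (-(n : ℝ)) n) :
    ∃ i ∈ Finset.Icc (-((n * 8 ^ k : ℕ) : ℤ)) ((n * 8 ^ k : ℕ) : ℤ),
      |x - i * (1 / 8) ^ k| ≤ (1 / 8) ^ k := by
  have h8 : (0 : ℝ) < 8 ^ k := by positivity
  refine ⟨⌊x * 8 ^ k⌋, ?_, ?_⟩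
  · rw [Finset.mem_Icc]
    constructor
    · rw [Int.le_floor]
      push_cast
      nlinarith [hx.1]
    · have : (⌊x * 8 ^ k⌋ : ℝ) ≤ ((n * 8 ^ k : ℕ) : ℤ) := by
        refine (Int.floor_le _).trans ?_
        push_cast
        nlinarith [hx.2]
      exact_mod_cast this
  · have h1 := Int.floor_le (x * 8 ^ k)
    have h2 := Int.lt_floor_add_one (x * 8 ^ k)
    have e : x - ⌊x * 8 ^ k⌋ * (1 / 8) ^ k = (x * 8 ^ k - ⌊x * 8 ^ k⌋) * (1 / 8) ^ k := by
      rw [sub_mul, mul_assoc, ← mul_pow]; norm_num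
    rw [e, abs_mul, abs_of_nonneg (by linarith : 0 ≤ x * 8 ^ k - ⌊x * 8 ^ k⌋),
      abs_of_nonneg (by positivity)]
    exact mul_le_of_le_one_left (by positivity) (by linarith)

lemma exists_nat_near (k : ℕ) {t : ℝ} (hT : 0 < T) (ht : t ∈ Icc 0 T) :
    ∃ j ∈ Finset.range (8 ^ k + 1), T * (j * (1 / 8) ^ k) ∈ Icc 0 T ∧
      |t - T * (j * (1 / 8) ^ k)| ≤ T * (1 / 8) ^ k := by
  have h8 : (0 : ℝ) < 8 ^ k := by positivity
  have e8 : (8 : ℝ) ^ k * (1 / 8) ^ k = 1 := by rw [← mul_pow]; norm_num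
  have h0 : 0 ≤ t / T * 8 ^ k := by have := ht.1; positivity
  have h1 := Nat.floor_le h0
  have h2 := Nat.lt_floor_add_one (t / T * 8 ^ k)
  have h3 : t / T ≤ 1 := (div_le_one hT).mpr ht.2
  have h4 : (⌊t / T * 8 ^ k⌋₊ : ℝ) ≤ 8 ^ k := h1.trans (mul_le_of_le_one_left h8.le h3)
  have h5 : (⌊t / T * 8 ^ k⌋₊ : ℝ) * (1 / 8) ^ k ≤ 1 := by
    calc _ ≤ (8 : ℝ) ^ k * (1 / 8) ^ k := by gcongr
      _ = 1 := e8
  refine ⟨⌊t / T * 8 ^ k⌋₊, ?_, ⟨by positivity, by nlinarith⟩, ?_⟩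
  · rw [Finset.mem_range, Nat.lt_succ_iff]
    exact_mod_cast h4
  · have e : t - T * (⌊t / T * 8 ^ k⌋₊ * (1 / 8) ^ k)
        = T * ((t / T * 8 ^ k - ⌊t / T * 8 ^ k⌋₊) * (1 / 8) ^ k) := by
      have : t = T * (t / T * (8 ^ k * (1 / 8) ^ k)) := by rw [e8]; field_simp
      nth_rewrite 1 [this]
      ring
    rw [e, abs_mul, abs_of_pos hT, abs_mul,
      abs_of_nonneg (by linarith : 0 ≤ t / T * 8 ^ k - ⌊t / T * 8 ^ k⌋₊),
      abs_of_nonneg (by positivity : (0 : ℝ) ≤ (1 / 8) ^ k)]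
    gcongr
    exact mul_le_of_le_one_left (by positivity) (by linarith)

/-- On [-n, n] × [0, T] the grid of mesh 8^{-k} has of order 64^k points. With moments of order
256^{-k}, even the sum over the grid weighted by 2^k has expectation of order 2^{-k}, so almost
surely the total W is finite and bounds every weighted term. The values between grid points follow
from `norm_psiDiff_sub_le`. -/
theorem ae_isGoodPath (hX : Measurable (Function.uncurry X)) (hT : 0 < T) {m : ℕ} (hm : m ≠ 0)
    {B : ℝ≥0∞} (hB : B ≠ ⊤)
    (hmom : ∀ k : ℕ, ∀ x, ∀ t ∈ Icc 0 T, ∫⁻ ω, ‖psiDiff X k x t ω‖ₑ ^ m ∂P ≤ B * (1 / 256) ^ k) :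
    ∀ᵐ ω ∂P, IsGoodPath T X ω := by
  unfold IsGoodPath
  rw [ae_all_iff]
  intro n
  set I : ℕ → Finset ℤ := fun k =>
    Finset.Icc (-((n * 8 ^ k : ℕ) : ℤ)) ((n * 8 ^ k : ℕ) : ℤ) with hI
  set J : ℕ → Finset ℕ := fun k =>
    (Finset.range (8 ^ k + 1)).filter fun j => T * (j * (1 / 8) ^ k) ∈ Icc 0 T with hJ
  set F : ℕ → Ω → ℝ≥0∞ := fun k ω => ∑ i ∈ I k, ∑ j ∈ J k,
    2 ^ k * ‖psiDiff X k (i * (1 / 8) ^ k) (T * (j * (1 / 8) ^ k)) ω‖ₑ ^ m with hF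
  have hmeas : ∀ k x t, t ∈ Icc 0 T → Measurable fun ω => ‖psiDiff X k x t ω‖ₑ ^ m := by
    intro k x t ht
    have h1 : Measurable (psi X (2 ^ (k + 1)) x t) := measurable_psi hX (by positivity) ht.1 x
    have h2 : Measurable (psi X (2 ^ k) x t) := measurable_psi hX (by positivity) ht.1 x
    exact ((h1.sub h2).enorm).pow_const m
  have hFm : ∀ k, Measurable (F k) := fun k =>
    Finset.measurable_sum _ fun i _ => Finset.measurable_sum _ fun j hj =>
      (hmeas k _ _ (Finset.mem_filter.mp hj).2).const_mul _
  have hFint : ∀ k, ∫⁻ ω, F k ω ∂P ≤ (4 * n + 2) * B * (1 / 2) ^ k := by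
    intro k
    have hle : ∀ i ∈ I k, ∀ j ∈ J k,
        ∫⁻ ω, 2 ^ k * ‖psiDiff X k (i * (1 / 8) ^ k) (T * (j * (1 / 8) ^ k)) ω‖ₑ ^ m ∂P
          ≤ 2 ^ k * (B * (1 / 256) ^ k) := by
      intro i _ j hj
      rw [lintegral_const_mul' _ _ (by simp)]
      gcongr
      exact hmom k _ _ (Finset.mem_filter.mp hj).2
    have hcI : ((I k).card : ℝ≥0∞) ≤ (2 * n + 1) * 8 ^ k := by
      have h1 : (I k).card ≤ (2 * n + 1) * 8 ^ k := by
        rw [hI, Int.card_Icc]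
        have : 1 ≤ 8 ^ k := Nat.one_le_pow _ _ (by norm_num)
        have e : (2 * n + 1) * 8 ^ k = 2 * (n * 8 ^ k) + 8 ^ k := by ring
        rw [e]
        omega
      exact_mod_cast h1
    have hcJ : ((J k).card : ℝ≥0∞) ≤ 2 * 8 ^ k := by
      have h1 : (J k).card ≤ 2 * 8 ^ k := by
        refine (Finset.card_filter_le _ _).trans ?_
        rw [Finset.card_range]
        have : 1 ≤ 8 ^ k := Nat.one_le_pow _ _ (by norm_num)
        omega
      exact_mod_cast h1
    calc ∫⁻ ω, F k ω ∂P = ∑ i ∈ I k, ∑ j ∈ J k,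
          ∫⁻ ω, 2 ^ k * ‖psiDiff X k (i * (1 / 8) ^ k) (T * (j * (1 / 8) ^ k)) ω‖ₑ ^ m ∂P := by
          simp only [hF]
          rw [lintegral_finsetSum]
          · refine Finset.sum_congr rfl fun i _ => ?_
            rw [lintegral_finsetSum' _ fun j hj =>
              ((hmeas k _ _ (Finset.mem_filter.mp hj).2).const_mul _).aemeasurable]
          · exact fun i _ => Finset.measurable_sum _ fun j hj =>
              (hmeas k _ _ (Finset.mem_filter.mp hj).2).const_mul _
      _ ≤ ∑ i ∈ I k, ∑ j ∈ J k, 2 ^ k * (B * (1 / 256) ^ k) :=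
          Finset.sum_le_sum fun i hi => Finset.sum_le_sum fun j hj => hle i hi j hj
      _ = (I k).card * ((J k).card * (2 ^ k * (B * (1 / 256) ^ k))) := by
          simp only [Finset.sum_const, nsmul_eq_mul]
      _ ≤ ((2 * n + 1) * 8 ^ k) * ((2 * 8 ^ k) * (2 ^ k * (B * (1 / 256) ^ k))) := by gcongr
      _ = (4 * n + 2) * B * (8 * 8 * 2 * (1 / 256)) ^ k := by
          simp only [mul_pow]; ring
      _ = _ := by
          congr 2
          rw [← ENNReal.toReal_eq_toReal_iff' (by finiteness) (by finiteness)]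
          simp only [ENNReal.toReal_mul, ENNReal.toReal_div, ENNReal.toReal_one,
            ENNReal.toReal_ofNat]
          norm_num
  have hsum : ∫⁻ ω, ∑' k, F k ω ∂P ≠ ⊤ := by
    rw [lintegral_tsum fun k => (hFm k).aemeasurable]
    refine ne_top_of_le_ne_top ?_ (ENNReal.tsum_le_tsum hFint)
    rw [ENNReal.tsum_mul_left, ENNReal.tsum_geometric]
    refine ENNReal.mul_ne_top (ENNReal.mul_ne_top (by finiteness) hB) ?_
    simp
  filter_upwards [ae_lt_top (Measurable.tsum hFm) hsum] with ω hω
  set W := ∑' k, F k ω with hW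
  -- The weight 2^k becomes geometric decay after the m-th root: 2^k |ψDiff|^m ≤ W means |ψDiff| ≤
  -- W^{1/m} ρ^k.
  set ρ : ℝ := (1 / 2) ^ (1 / (m : ℝ)) with hρ
  have hm0 : (0 : ℝ) < m := by exact_mod_cast Nat.pos_of_ne_zero hm
  have hρ0 : 0 ≤ ρ := by positivity
  have hρ1 : ρ < 1 := Real.rpow_lt_one (by norm_num) (by norm_num) (by positivity)
  have hρm : ρ ^ m = 1 / 2 := by
    rw [hρ, ← Real.rpow_natCast, ← Real.rpow_mul (by norm_num), one_div_mul_cancel hm0.ne',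
      Real.rpow_one]
  refine ⟨fun k => W.toReal ^ (1 / (m : ℝ)) * ρ ^ k + 24 * T * (1 / 2) ^ k, ?_, ?_⟩
  · exact ((summable_geometric_of_lt_one hρ0 hρ1).mul_left _).add
      ((summable_geometric_of_lt_one (by norm_num) (by norm_num)).mul_left _)
  intro k x hx t ht
  obtain ⟨i, hi, hix⟩ := exists_int_near (k := k) hx
  obtain ⟨j, hj, hjT, hjt⟩ := exists_nat_near k hT ht
  set y : ℝ := i * (1 / 8) ^ k
  set s : ℝ := T * (j * (1 / 8) ^ k)
  have h1 := norm_psiDiff_sub_le hX k hjT ht hix hjt ω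
  have h2 : 2 ^ k * ‖psiDiff X k y s ω‖ₑ ^ m ≤ W := by
    calc _ ≤ ∑ j ∈ J k, 2 ^ k * ‖psiDiff X k y (T * (j * (1 / 8) ^ k)) ω‖ₑ ^ m :=
          Finset.single_le_sum (f := fun j : ℕ =>
            2 ^ k * ‖psiDiff X k y (T * (j * (1 / 8) ^ k)) ω‖ₑ ^ m) (fun _ _ => zero_le)
            (Finset.mem_filter.mpr ⟨hj, hjT⟩)
      _ ≤ F k ω := Finset.single_le_sum (f := fun i : ℤ => ∑ j ∈ J k,
            2 ^ k * ‖psiDiff X k (i * (1 / 8) ^ k) (T * (j * (1 / 8) ^ k)) ω‖ₑ ^ m)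
            (fun _ _ => zero_le) hi
      _ ≤ W := ENNReal.le_tsum k
  have h3 : 2 ^ k * ‖psiDiff X k y s ω‖ ^ m ≤ W.toReal := by
    have := ENNReal.toReal_mono hω.ne h2
    simpa using this
  have h4 : ‖psiDiff X k y s ω‖ ≤ W.toReal ^ (1 / (m : ℝ)) * ρ ^ k := by
    refine le_of_pow_le_pow_left₀ hm (by positivity) ?_
    rw [mul_pow, ← pow_mul, mul_comm k m, pow_mul, hρm, ← Real.rpow_natCast (_ ^ _) m,
      ← Real.rpow_mul ENNReal.toReal_nonneg, one_div_mul_cancel hm0.ne', Real.rpow_one, one_div,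
      inv_pow, ← div_eq_mul_inv, le_div_iff₀ (by positivity), mul_comm]
    exact h3
  calc ‖psiDiff X k x t ω‖ = ‖psiDiff X k y s ω + (psiDiff X k x t ω - psiDiff X k y s ω)‖ := by
        congr 1; ring
    _ ≤ _ := norm_add_le _ _
    _ ≤ _ := add_le_add h4 h1

end LocalTime

/-! ### Fourier inversion and the limit process -/

namespace LocalTime

variable {Ω : Type*} [MeasurableSpace Ω] {P : Measure Ω} {X : ℝ → Ω → ℝ} {T : ℝ}

section Inversion

open FourierTransform

/-- Inversion for Schwartz functions, rescaled from the e^{2πi} convention to the normalization of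
`fourierKernel`. -/
lemma exists_fourier_inversion {φ : ℝ → ℂ} (hφ : ContDiff ℝ (⊤ : ℕ∞) φ) (hc : HasCompactSupport φ) :
    ∃ Φ : ℝ → ℂ, Measurable Φ ∧ Integrable Φ ∧
      (∀ u : ℝ, Φ u = ∫ x : ℝ, φ x * ((1 / (2 * Real.pi) : ℂ) * Complex.exp (-(Complex.I * u * x)))) ∧
      ∀ y : ℝ, ∫ u : ℝ, Φ u * Complex.exp (Complex.I * u * y) = φ y := by
  set f := hc.toSchwartzMap hφ with hf
  have hfφ : (f : ℝ → ℂ) = φ := rfl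
  have hpi : (0 : ℝ) < 2 * Real.pi := by positivity
  have hpi' : (Real.pi : ℂ) ≠ 0 := Complex.ofReal_ne_zero.mpr Real.pi_ne_zero
  have hF : (𝓕 f : SchwartzMap ℝ ℂ) = 𝓕 φ := SchwartzMap.fourier_coe f
  have hcont : Continuous (𝓕 φ) := hF ▸ (𝓕 f : SchwartzMap ℝ ℂ).continuous
  have hint : Integrable (𝓕 φ) := hF ▸ (𝓕 f : SchwartzMap ℝ ℂ).integrable
  have hφi : Integrable φ := f.integrable
  refine ⟨fun u => (1 / (2 * Real.pi) : ℂ) * 𝓕 φ ((2 * Real.pi)⁻¹ * u), ?_, ?_, fun u => ?_, fun y => ?_⟩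
  · exact (Continuous.measurable (by fun_prop))
  · exact (hint.comp_mul_left' (inv_ne_zero hpi.ne')).const_mul _
  · simp only
    rw [Real.fourier_real_eq_integral_exp_smul, ← integral_const_mul]
    refine integral_congr_ae (ae_of_all _ fun x => ?_)
    have : ((-2 * Real.pi * x * ((2 * Real.pi)⁻¹ * u) : ℝ) : ℂ) * Complex.I
        = -(Complex.I * u * x) := by
      push_cast
      field_simp
    simp only [this, smul_eq_mul]
    ring
  · have hinv : 𝓕⁻ (𝓕 φ) y = φ y := by
      rw [Continuous.fourierInv_fourier_eq hφ.continuous hφi hint]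
    rw [Real.fourierInv_eq'] at hinv
    set g : ℝ → ℂ := fun ξ => (1 / (2 * Real.pi) : ℂ)
      * (Complex.exp (((2 * Real.pi * inner ℝ ξ y : ℝ) : ℂ) * Complex.I) • 𝓕 φ ξ) with hg
    have h1 : ∀ u : ℝ, (1 / (2 * Real.pi) : ℂ) * 𝓕 φ ((2 * Real.pi)⁻¹ * u)
        * Complex.exp (Complex.I * u * y) = g ((2 * Real.pi)⁻¹ * u) := by
      intro u
      have : ((2 * Real.pi * inner ℝ ((2 * Real.pi)⁻¹ * u) y : ℝ) : ℂ) * Complex.I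
          = Complex.I * u * y := by
        have h2 : (inner ℝ ((2 * Real.pi)⁻¹ * u) y : ℝ) = y * ((2 * Real.pi)⁻¹ * u) := rfl
        rw [h2]
        push_cast
        field_simp
      simp only [hg, this, smul_eq_mul]
      ring
    simp only [h1]
    rw [Measure.integral_comp_mul_left, inv_inv, abs_of_pos hpi, hg, integral_const_mul, hinv,
      Complex.real_smul]
    push_cast
    field_simp

lemma measurable_integral_exp (hX : Measurable (Function.uncurry X)) (t : ℝ) (ω : Ω) :
    Measurable fun u : ℝ => ∫ r in Ico 0 t, Complex.exp (Complex.I * u * (X r ω : ℝ)) := by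
  refine (StronglyMeasurable.integral_prod_right (f := fun (u : ℝ) r =>
    Complex.exp (Complex.I * u * (X r ω : ℝ))) ?_).measurable
  refine Measurable.stronglyMeasurable ?_
  have := measurable_comp_process hX (f := fun p : ℝ × ℝ => p.2) (h := fun _ => ω)
      (by fun_prop) (by fun_prop)
  simp only [Function.uncurry_def]
  fun_prop

/-- By Fubini, ∫ φ ψ_N is the integral over [-N, N] of Φ(u) ∫ e^{iuX_r} dr. As Φ is integrable, the
limit is the integral over ℝ, and inversion under a second Fubini gives ∫ φ(X_r) dr. No probability
is involved: this holds for each path. -/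
theorem tendsto_integral_mul_psi (hX : Measurable (Function.uncurry X)) {φ : ℝ → ℂ}
    (hφ : ContDiff ℝ (⊤ : ℕ∞) φ) (hc : HasCompactSupport φ) {t : ℝ} (ht : 0 ≤ t) (ω : Ω) :
    Tendsto (fun N => ∫ x, φ x * psi X N x t ω) atTop (𝓝 (∫ r in Ico 0 t, φ (X r ω))) := by
  obtain ⟨Φ, hΦm, hΦi, hΦ, hinv⟩ := exists_fourier_inversion hφ hc
  have hφi : Integrable φ := (hc.toSchwartzMap hφ).integrable
  set I : ℝ → ℂ := fun u => ∫ r in Ico 0 t, Complex.exp (Complex.I * u * (X r ω : ℝ)) with hI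
  have hIm : Measurable I := measurable_integral_exp hX t ω
  have hIn : ∀ u, ‖I u‖ ≤ t := fun u => by
    simpa using norm_integral_exp_le (X := X) ht u ω
  have hlim : ∫ u, Φ u * I u = ∫ r in Ico 0 t, φ (X r ω) := by
    have h1 := integrable_occInt_integrand hX hΦi hΦm 0 t ω
    calc ∫ u, Φ u * I u = ∫ u, ∫ r in Ico 0 t, Φ u * Complex.exp (Complex.I * u * (X r ω : ℝ)) := by
          simp only [integral_const_mul, hI]
      _ = ∫ r in Ico 0 t, ∫ u, Φ u * Complex.exp (Complex.I * u * (X r ω : ℝ)) :=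
          integral_integral_swap h1
      _ = _ := by simp only [hinv]
  have hΦI : Integrable fun u => Φ u * I u := integrable_occInt_outer hX hΦi hΦm 0 t ω
  have htend := intervalIntegral_tendsto_integral hΦI tendsto_neg_atTop_atBot tendsto_id
  rw [hlim] at htend
  refine htend.congr' ?_
  filter_upwards [eventually_ge_atTop 0] with N hN
  have hprod : Integrable (Function.uncurry fun (x u : ℝ) => φ x * (fourierKernel N x u * I u)) := by
    have hb : Integrable ((Icc (-N) N).indicator fun _ => t) :=
      (integrable_indicator_iff measurableSet_Icc).mpr (integrableOn_const measure_Icc_lt_top.ne)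
    have h2 : Integrable (fun p : ℝ × ℝ => ‖φ p.1‖ * (Icc (-N) N).indicator (fun _ => t) p.2)
      (volume.prod volume) := hφi.norm.mul_prod hb
    refine h2.mono' ?_ (ae_of_all _ fun p => ?_)
    · refine Measurable.aestronglyMeasurable ?_
      have h3 : Measurable fun p : ℝ × ℝ => fourierKernel N p.1 p.2 := by
        have : (fun p : ℝ × ℝ => fourierKernel N p.1 p.2) = (Prod.snd ⁻¹' (Icc (-N) N)).indicator
            fun p : ℝ × ℝ => (1 / (2 * Real.pi) : ℂ) * Complex.exp (-(Complex.I * p.2 * p.1)) := by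
          ext p; rfl
        rw [this]
        exact Measurable.indicator (by fun_prop) (measurableSet_Icc.preimage measurable_snd)
      have h4 := hφ.continuous.measurable
      simp only [Function.uncurry_def]
      fun_prop
    · simp only [Function.uncurry_def, norm_mul]
      have h5 := norm_fourierKernel_le N p.1 p.2
      gcongr
      by_cases hu : p.2 ∈ Icc (-N) N
      · rw [indicator_of_mem hu] at h5 ⊢
        simpa using mul_le_mul h5 (hIn p.2) (norm_nonneg _) zero_le_one
      · rw [indicator_of_notMem hu] at h5 ⊢
        rw [le_antisymm h5 (norm_nonneg _), zero_mul]
  calc ∫ u in (-N)..N, Φ u * I u = ∫ u, (Icc (-N) N).indicator (fun u => Φ u * I u) u := by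
        rw [integral_indicator measurableSet_Icc, integral_Icc_eq_integral_Ioc,
          ← intervalIntegral.integral_of_le (by linarith)]
    _ = ∫ u, ∫ x, φ x * (fourierKernel N x u * I u) := by
        refine integral_congr_ae (ae_of_all _ fun u => ?_)
        simp only
        by_cases hu : u ∈ Icc (-N) N
        · rw [indicator_of_mem hu, hΦ, ← integral_mul_const]
          refine integral_congr_ae (ae_of_all _ fun x => ?_)
          simp only [fourierKernel_of_mem hu]
          ring
        · rw [indicator_of_notMem hu]
          simp [fourierKernel_of_notMem hu]
    _ = ∫ x, ∫ u, φ x * (fourierKernel N x u * I u) := (integral_integral_swap hprod).symm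
    _ = ∫ x, φ x * psi X N x t ω := by
        refine integral_congr_ae (ae_of_all _ fun x => ?_)
        simp only
        rw [integral_const_mul, psi_eq_occInt hN ht, occInt]

end Inversion

/-- The local time: the real part of the limit of `ψ_{2^k}`, on the event `G`. -/
noncomputable def localTime (X : ℝ → Ω → ℝ) (G : Set Ω) (x t : ℝ) : Ω → ℝ :=
  G.indicator fun ω => (psi X 1 x t ω + ∑' k, psiDiff X k x t ω).re

omit [MeasurableSpace Ω] in
lemma psi_one_add_sum (n : ℕ) (x t : ℝ) (ω : Ω) :
    psi X 1 x t ω + ∑ k ∈ Finset.range n, psiDiff X k x t ω = psi X (2 ^ n) x t ω := by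
  have := Finset.sum_range_sub (fun k => psi X (2 ^ k) x t ω) n
  simp only [psiDiff]
  rw [this, pow_zero]
  ring

section GoodPath

variable {G : Set Ω} (hG : ∀ ω ∈ G, IsGoodPath T X ω) {ω : Ω}

omit [MeasurableSpace Ω] in
lemma tendsto_psi_of_isGoodPath (hω : IsGoodPath T X ω) (x : ℝ) {t : ℝ} (ht : t ∈ Icc 0 T) :
    Tendsto (fun n : ℕ => psi X (2 ^ n) x t ω) atTop
      (𝓝 (psi X 1 x t ω + ∑' k, psiDiff X k x t ω)) := by
  obtain ⟨n, hn⟩ := exists_nat_ge |x|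
  obtain ⟨u, hu, h⟩ := hω n
  have hs : Summable fun k => psiDiff X k x t ω :=
    Summable.of_norm_bounded hu fun k => h k x (abs_le.mp hn) t ht
  simp only [← psi_one_add_sum]
  exact hs.hasSum.tendsto_sum_nat.const_add _

omit [MeasurableSpace Ω] in
include hG in
lemma tendsto_psi_localTime (hω : ω ∈ G) (x : ℝ) {t : ℝ} (ht : t ∈ Icc 0 T) :
    Tendsto (fun n : ℕ => psi X (2 ^ n) x t ω) atTop (𝓝 (localTime X G x t ω : ℂ)) := by
  have h := tendsto_psi_of_isGoodPath (hG ω hω) x ht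
  have h1 : (psi X 1 x t ω + ∑' k, psiDiff X k x t ω).im = 0 := by
    have h2 := (Complex.continuous_im.tendsto _).comp h
    refine tendsto_nhds_unique h2 (tendsto_const_nhds.congr fun n => ?_)
    exact (psi_im _ x (by positivity) ht.1 ω).symm
  have h3 : (localTime X G x t ω : ℂ) = psi X 1 x t ω + ∑' k, psiDiff X k x t ω := by
    rw [localTime, indicator_of_mem hω]
    exact Complex.ext (by simp) (by simp [h1])
  rw [h3]
  exact h

lemma continuousOn_psi (hX : Measurable (Function.uncurry X)) {N : ℝ} (hN : 0 ≤ N) (ω : Ω) :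
    ContinuousOn (fun p : ℝ × ℝ => psi X N p.1 p.2 ω) (univ ×ˢ Icc 0 T) := by
  rcases le_or_gt 0 T with hT | hT
  swap
  · rw [Icc_eq_empty (not_le.mpr hT), prod_empty]
    exact continuousOn_empty _
  have hL : LipschitzOnWith (2 * N ^ 2 * T + 2 * N).toNNReal
      (fun p : ℝ × ℝ => psi X N p.1 p.2 ω) (univ ×ˢ Icc 0 T) := by
    refine LipschitzOnWith.of_dist_le_mul fun p hp q hq => ?_
    rw [Real.coe_toNNReal _ (by positivity), dist_eq_norm]
    refine (norm_psi_sub_le hX hN hq.2 hp.2 p.1 q.1 ω).trans ?_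
    have h1 : |p.1 - q.1| ≤ dist p q := by rw [← Real.dist_eq]; exact le_max_left _ _
    have h2 : |p.2 - q.2| ≤ dist p q := by rw [← Real.dist_eq]; exact le_max_right _ _
    rw [add_mul]
    gcongr
  exact hL.continuousOn

-- The Weierstrass test on compact boxes gives continuity of the sum; outside G the process is 0.
include hG in
lemma continuousOn_localTime (hX : Measurable (Function.uncurry X)) (ω : Ω) :
    ContinuousOn (fun p : ℝ × ℝ => localTime X G p.1 p.2 ω) (univ ×ˢ Icc 0 T) := by
  by_cases hω : ω ∈ G
  swap
  · simp only [localTime, indicator_of_notMem hω]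
    exact continuousOn_const
  simp only [localTime, indicator_of_mem hω]
  refine Complex.continuous_re.comp_continuousOn ?_
  have h1 : ContinuousOn (fun p : ℝ × ℝ => psi X 1 p.1 p.2 ω) (univ ×ˢ Icc 0 T) :=
    continuousOn_psi hX zero_le_one ω
  refine h1.add fun p hp => ?_
  -- The strict inequality makes the box a neighbourhood of p in the strip.
  obtain ⟨n, hn⟩ := exists_nat_gt |p.1|
  obtain ⟨u, hu, h⟩ := hG ω hω n
  have h2 : ContinuousOn (fun p : ℝ × ℝ => ∑' k, psiDiff X k p.1 p.2 ω)
      (Icc (-(n : ℝ)) n ×ˢ Icc 0 T) := by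
    refine continuousOn_tsum (fun k => ?_) hu fun k q hq => h k q.1 hq.1 q.2 hq.2
    have h3 : ContinuousOn (fun p : ℝ × ℝ => psiDiff X k p.1 p.2 ω) (univ ×ˢ Icc 0 T) :=
      (continuousOn_psi hX (by positivity) ω).sub (continuousOn_psi hX (by positivity) ω)
    exact h3.mono (prod_mono (subset_univ _) subset_rfl)
  have hp' : p ∈ Icc (-(n : ℝ)) n ×ˢ Icc 0 T := ⟨abs_le.mp hn.le, hp.2⟩
  refine (h2 p hp').mono_of_mem_nhdsWithin ?_
  have h4 : Icc (-(n : ℝ)) n ∈ 𝓝 p.1 :=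
    Icc_mem_nhds (by linarith [neg_abs_le p.1]) (by linarith [le_abs_self p.1])
  rw [mem_nhdsWithin_iff_exists_mem_nhds_inter]
  refine ⟨Prod.fst ⁻¹' Icc (-(n : ℝ)) n, continuous_fst.continuousAt.preimage_mem_nhds h4, ?_⟩
  rintro q ⟨hq1, hq2⟩
  exact ⟨hq1, hq2.2⟩

include hG in
lemma measurable_localTime (hX : Measurable (Function.uncurry X)) (hGm : MeasurableSet G) (x : ℝ)
    {t : ℝ} (ht : t ∈ Icc 0 T) : Measurable (localTime X G x t) := by
  refine measurable_of_tendsto_metrizable (f := fun (n : ℕ) => G.indicator fun ω =>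
    (psi X (2 ^ n) x t ω).re) (fun n => ?_) ?_
  · exact (Complex.measurable_re.comp (measurable_psi hX (by positivity) ht.1 x)).indicator hGm
  · rw [tendsto_pi_nhds]
    intro ω
    by_cases hω : ω ∈ G
    · simp only [indicator_of_mem hω, localTime]
      exact (Complex.continuous_re.tendsto _).comp (tendsto_psi_of_isGoodPath (hG ω hω) x ht)
    · simp only [indicator_of_notMem hω, localTime]
      exact tendsto_const_nhds

-- Both sides are limits of ∫ φ ψ_{2^k}: one by dominated convergence, as the convergence is uniform
-- on the support of φ, the other by Fourier inversion.
include hG in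
lemma integral_mul_localTime (hX : Measurable (Function.uncurry X)) (hω : ω ∈ G) {t : ℝ}
    (ht : t ∈ Icc 0 T) {φ : ℝ → ℂ} (hφ : ContDiff ℝ (⊤ : ℕ∞) φ) (hc : HasCompactSupport φ) :
    ∫ x, φ x * (localTime X G x t ω : ℂ) = ∫ r in Ico 0 t, φ (X r ω) := by
  have hN : Tendsto (fun k : ℕ => (2 : ℝ) ^ k) atTop atTop :=
    tendsto_pow_atTop_atTop_of_one_lt (by norm_num)
  have h1 := (tendsto_integral_mul_psi hX hφ hc ht.1 ω).comp hN
  refine tendsto_nhds_unique ?_ h1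
  obtain ⟨R, hR⟩ := hc.isBounded.subset_closedBall (0 : ℝ)
  obtain ⟨n, hn⟩ := exists_nat_ge R
  obtain ⟨u, hu, h⟩ := hG ω hω n
  have hφi : Integrable φ := (hc.toSchwartzMap hφ).integrable
  have hT : 0 ≤ T := ht.1.trans ht.2
  have hcx : ∀ N : ℝ, 0 ≤ N → Continuous fun x => psi X N x t ω := fun N hN => by
    have h3 := continuousOn_psi (T := T) hX hN ω
    exact continuousOn_univ.mp (h3.comp (f := fun x : ℝ => (x, t)) (by fun_prop)
      fun x _ => ⟨mem_univ _, ht⟩)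
  refine tendsto_integral_of_dominated_convergence (fun x => ‖φ x‖ * (2 * T + ∑' k, u k))
    (fun k => ?_) (hφi.norm.mul_const _) (fun k => ae_of_all _ fun x => ?_)
    (ae_of_all _ fun x => ?_)
  · exact (hφ.continuous.mul (hcx _ (by positivity))).aestronglyMeasurable
  · by_cases hx : φ x = 0
    · simp [hx]
    have hxn : x ∈ Icc (-(n : ℝ)) n := by
      have := hR (subset_tsupport φ hx)
      rw [mem_closedBall_zero_iff, Real.norm_eq_abs] at this
      exact abs_le.mp (this.trans hn)
    simp only [norm_mul]
    gcongr
    rw [← psi_one_add_sum]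
    refine (norm_add_le _ _).trans (add_le_add ?_ ?_)
    · rw [psi_eq_occInt zero_le_one ht.1]
      have := norm_occInt_le_of_indicator (X := X) zero_le_one zero_le_one
        (norm_fourierKernel_le 1 x) ht.1 ω
      linarith [ht.2]
    · have h5 : ∀ k, ‖psiDiff X k x t ω‖ ≤ u k := fun k => h k x hxn t ht
      exact (norm_sum_le_of_le _ fun k _ => h5 k).trans
        (hu.sum_le_tsum _ fun k _ => (norm_nonneg _).trans (h5 k))
  · exact (tendsto_psi_localTime hG hω x ht).const_mul _

end GoodPath

end LocalTime

/-! ### From test functions to the occupation density -/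

namespace LocalTime

variable {Ω : Type*} [MeasurableSpace Ω] {P : Measure Ω} {X : ℝ → Ω → ℝ} {T : ℝ}

/-- A bump function equal to `1` on a closed ball that exhausts the ball of radius `r`. -/
noncomputable def exhaustingBump (c : ℝ) {r : ℝ} (hr : 0 < r) (n : ℕ) : ContDiffBump c where
  rIn := r * (1 - 1 / (n + 2))
  rOut := r
  rIn_pos := by
    have : (1 : ℝ) / (n + 2) < 1 := by
      rw [div_lt_one (by positivity)]; linarith [(Nat.cast_nonneg n : (0 : ℝ) ≤ n)]
    exact mul_pos hr (by linarith)
  rIn_lt_rOut := by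
    have : (0 : ℝ) < 1 / (n + 2) := by positivity
    nlinarith

lemma tendsto_exhaustingBump (c : ℝ) {r : ℝ} (hr : 0 < r) (x : ℝ) :
    Tendsto (fun n => exhaustingBump c hr n x) atTop
      (𝓝 ((Metric.ball c r).indicator (fun _ => (1 : ℝ)) x)) := by
  by_cases hx : x ∈ Metric.ball c r
  · rw [indicator_of_mem hx]
    have h1 : Tendsto (fun n : ℕ => r * (1 - 1 / ((n : ℝ) + 2))) atTop (𝓝 (r * (1 - 0))) := by
      have h2 : Tendsto (fun n : ℕ => 1 / ((n : ℝ) + 2)) atTop (𝓝 0) :=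
        tendsto_const_nhds.div_atTop (tendsto_atTop_add_const_right _ _ tendsto_natCast_atTop_atTop)
      exact (h2.const_sub 1).const_mul r
    rw [sub_zero, mul_one] at h1
    refine tendsto_const_nhds.congr' ?_
    filter_upwards [h1.eventually_const_lt (Metric.mem_ball.mp hx)] with n hn
    exact ((exhaustingBump c hr n).one_of_mem_closedBall
      (Metric.mem_closedBall.mpr hn.le)).symm
  · rw [indicator_of_notMem hx]
    refine tendsto_const_nhds.congr fun n => ?_
    by_contra h
    have h2 : x ∈ Function.support (exhaustingBump c hr n) := fun h' => h h'.symm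
    rw [ContDiffBump.support_eq] at h2
    exact hx h2

lemma exhaustingBump_le_indicator (c : ℝ) {r : ℝ} (hr : 0 < r) (n : ℕ) (x : ℝ) :
    exhaustingBump c hr n x ≤ (Metric.ball c r).indicator (fun _ => (1 : ℝ)) x := by
  by_cases hx : x ∈ Metric.ball c r
  · rw [indicator_of_mem hx]
    exact (exhaustingBump c hr n).le_one
  · rw [indicator_of_notMem hx]
    refine le_of_eq ?_
    by_contra h
    have h2 : x ∈ Function.support (exhaustingBump c hr n) := h
    rw [ContDiffBump.support_eq] at h2
    exact hx h2

/-- A continuous function whose integrals against smooth bump functions are those of a finite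
measure is a nonnegative density of that measure. -/
theorem eq_withDensity_of_integral_bump {μ : Measure ℝ} [IsFiniteMeasure μ] {ℓ : ℝ → ℝ}
    (hℓ : Continuous ℓ)
    (h : ∀ (c : ℝ) (b : ContDiffBump c), ∫ x, b x * ℓ x = ∫ x, b x ∂μ) :
    (∀ x, 0 ≤ ℓ x) ∧ μ = volume.withDensity fun x => ENNReal.ofReal (ℓ x) := by
  -- The bumps converge pointwise to the indicator of the open ball and are dominated by it, so both
  -- sides of the hypothesis pass to the limit.
  have hball : ∀ c r : ℝ, 0 < r → ∫ x in Metric.ball c r, ℓ x = μ.real (Metric.ball c r) := by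
    intro c r hr
    have hi : IntegrableOn ℓ (Metric.ball c r) :=
      (hℓ.continuousOn.integrableOn_compact (isCompact_closedBall c r)).mono_set
        Metric.ball_subset_closedBall
    have h1 : Tendsto (fun n => ∫ x, exhaustingBump c hr n x * ℓ x) atTop
        (𝓝 (∫ x in Metric.ball c r, ℓ x)) := by
      rw [← integral_indicator Metric.isOpen_ball.measurableSet]
      refine tendsto_integral_of_dominated_convergence
        (fun x => ‖(Metric.ball c r).indicator ℓ x‖) (fun n => ?_) ?_
        (fun n => ae_of_all _ fun x => ?_) (ae_of_all _ fun x => ?_)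
      · exact ((exhaustingBump c hr n).continuous.mul hℓ).aestronglyMeasurable
      · exact ((integrable_indicator_iff Metric.isOpen_ball.measurableSet).mpr hi).norm
      · rw [norm_mul, Real.norm_of_nonneg (exhaustingBump c hr n).nonneg, norm_indicator_eq_indicator_norm]
        have := exhaustingBump_le_indicator c hr n x
        by_cases hx : x ∈ Metric.ball c r
        · rw [indicator_of_mem hx] at this ⊢
          exact mul_le_of_le_one_left (norm_nonneg _) this
        · rw [indicator_of_notMem hx] at this ⊢
          rw [le_antisymm this (exhaustingBump c hr n).nonneg, zero_mul]
      · have := (tendsto_exhaustingBump c hr x).mul_const (ℓ x)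
        convert this using 2
        by_cases hx : x ∈ Metric.ball c r
        · rw [indicator_of_mem hx, indicator_of_mem hx, one_mul]
        · rw [indicator_of_notMem hx, indicator_of_notMem hx, zero_mul]
    have h2 : Tendsto (fun n => ∫ x, exhaustingBump c hr n x ∂μ) atTop
        (𝓝 (μ.real (Metric.ball c r))) := by
      have : μ.real (Metric.ball c r) = ∫ x, (Metric.ball c r).indicator (fun _ => (1 : ℝ)) x ∂μ := by
        rw [integral_indicator Metric.isOpen_ball.measurableSet]; simp
      rw [this]
      refine tendsto_integral_of_dominated_convergence (fun _ => 1) (fun n => ?_)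
        (integrable_const _) (fun n => ae_of_all _ fun x => ?_)
        (ae_of_all _ fun x => tendsto_exhaustingBump c hr x)
      · exact (exhaustingBump c hr n).continuous.aestronglyMeasurable
      · rw [Real.norm_of_nonneg (exhaustingBump c hr n).nonneg]
        exact (exhaustingBump c hr n).le_one
    refine tendsto_nhds_unique h1 ?_
    simp only [h]
    exact h2
  -- Were ℓ negative at a point, its integral over a small ball would be negative, yet it is the
  -- measure of that ball.
  have hnonneg : ∀ x, 0 ≤ ℓ x := by
    intro x
    by_contra! hx
    have h1 : ∀ᶠ y in 𝓝 x, ℓ y < ℓ x / 2 := hℓ.continuousAt.eventually_lt_const (by linarith)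
    obtain ⟨r, hr, hr'⟩ := Metric.eventually_nhds_iff_ball.mp h1
    have h2 := hball x r hr
    have h3 : ∫ y in Metric.ball x r, ℓ y ≤ ∫ _ in Metric.ball x r, ℓ x / 2 := by
      refine setIntegral_mono_on ?_ ?_ Metric.isOpen_ball.measurableSet fun y hy => (hr' y hy).le
      · exact (hℓ.continuousOn.integrableOn_compact (isCompact_closedBall x r)).mono_set
          Metric.ball_subset_closedBall
      · exact integrableOn_const measure_ball_lt_top.ne
    rw [h2, setIntegral_const, smul_eq_mul] at h3
    have h4 : 0 < volume.real (Metric.ball x r) :=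
      ENNReal.toReal_pos (Metric.measure_ball_pos volume x hr).ne' measure_ball_lt_top.ne
    have h5 : 0 ≤ μ.real (Metric.ball x r) := measureReal_nonneg
    nlinarith
  refine ⟨hnonneg, Real.measure_ext_Ioo_rat fun a b => ?_⟩
  rcases le_or_gt (b : ℝ) a with hab | hab
  · simp [Ioo_eq_empty (not_lt.mpr hab)]
  have hI : Ioo (a : ℝ) b = Metric.ball (((a : ℝ) + b) / 2) ((b - a) / 2) := Real.Ioo_eq_ball _ _
  have h1 := hball (((a : ℝ) + b) / 2) ((b - a) / 2) (by linarith)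
  rw [← hI] at h1
  rw [withDensity_apply _ measurableSet_Ioo, ← ofReal_integral_eq_lintegral_ofReal ?_
    (ae_of_all _ hnonneg), h1, measureReal_def, ENNReal.ofReal_toReal (measure_ne_top _ _)]
  exact (hℓ.continuousOn.integrableOn_compact isCompact_Icc).mono_set Ioo_subset_Icc_self

theorem occupationMeasure_eq_withDensity {G : Set Ω} (hG : ∀ ω ∈ G, IsGoodPath T X ω)
    (hX : Measurable (Function.uncurry X)) {ω : Ω} (hω : ω ∈ G) {t : ℝ} (ht : t ∈ Icc 0 T) :
    (∀ x, 0 ≤ localTime X G x t ω) ∧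
      occupationMeasure X t ω
        = volume.withDensity fun x => ENNReal.ofReal (localTime X G x t ω) := by
  have hcont : Continuous fun x => localTime X G x t ω :=
    continuousOn_univ.mp ((continuousOn_localTime hG hX ω).comp (f := fun x : ℝ => (x, t))
      (by fun_prop) fun x _ => ⟨mem_univ _, ht⟩)
  have hpath : Measurable fun s => X s ω := measurable_comp_process hX measurable_id measurable_const
  have : IsFiniteMeasure (occupationMeasure X t ω) := by unfold occupationMeasure; infer_instance
  refine eq_withDensity_of_integral_bump hcont fun c b => ?_
  have hφ : ContDiff ℝ (⊤ : ℕ∞) fun x => (b x : ℂ) := Complex.ofRealCLM.contDiff.comp b.contDiff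
  have hc : HasCompactSupport fun x => (b x : ℂ) :=
    b.hasCompactSupport.comp_left (g := fun y : ℝ => (y : ℂ)) Complex.ofReal_zero
  have h1 := integral_mul_localTime hG hX hω ht hφ hc
  simp only [← Complex.ofReal_mul] at h1
  rw [integral_complex_ofReal, integral_complex_ofReal] at h1
  rw [Complex.ofReal_inj.mp h1, occupationMeasure, integral_map hpath.aemeasurable
    b.continuous.aestronglyMeasurable, integral_Icc_eq_integral_Ioc, integral_Ico_eq_integral_Ioc]

end LocalTime

/-! ### Passage to the limit in the moment bounds -/

namespace LocalTime

variable {Ω : Type*} [MeasurableSpace Ω] {P : Measure Ω} {X : ℝ → Ω → ℝ} {T : ℝ}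

/-- Tested on equally spaced times, where the covariance matrix has entries at most 1. The bound on
A allows negative powers of A to be replaced by more negative ones, up to a constant depending only
on m. -/
lemma HasDetLowerBound.le_factorial [IsProbabilityMeasure P] (hX : IsCenteredGaussianStatIncr P T X)
    (hT : 0 < T) {m : ℕ} {A : ℝ} (hA : HasDetLowerBound P T X m A) : A ≤ m.factorial := by
  set t : Fin (m + 1) → ℝ := fun j => T * ((j : ℝ) / (m + 1)) with ht
  have hlt : ∀ j, t j < T := fun j => by
    have h1 : (j : ℝ) < m + 1 := by exact_mod_cast j.2
    have h2 : (j : ℝ) / (m + 1) < 1 := by rw [div_lt_one (by positivity)]; exact h1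
    simp only [ht]
    nlinarith
  have htm : ∀ j, t j ∈ Icc 0 T := fun j => ⟨by positivity, (hlt j).le⟩
  have hmono : StrictMono t := fun i j hij => by
    have : (i : ℝ) < j := by exact_mod_cast hij
    simp only [ht]
    gcongr
  have h := hA.2 t (by simp [ht]) hmono (hlt _)
  have hR := posSemidef_normIncrCov hX htm
  have hdiag : ∀ j, normIncrCov P X t j j ≤ 1 := fun j => by
    -- If σ vanishes at the gap, the division by zero makes the normalized increment 0, and the
    -- diagonal entry with it.
    rcases (Real.sqrt_nonneg (variance (X (t j.succ - t j.castSucc)) P)).eq_or_lt with h0 | h0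
    · have h1 : sigma P X (t j.succ - t j.castSucc) = 0 := h0.symm
      have h2 : normIncrCov P X t j j = 0 := by
        simp only [normIncrCov, Matrix.of_apply, h1, div_zero, covariance, integral_zero, sub_zero,
          mul_zero]
      rw [h2]
      exact zero_le_one
    · exact (normIncrCov_diag hX htm (hmono Fin.castSucc_lt_succ).le h0).le
  obtain ⟨B, hB⟩ := exists_transpose_mul_self hR
  rw [hB] at h hdiag
  exact h.trans ((le_abs_self _).trans (det_le_factorial (abs_entry_le_one hdiag)))

/-- Fatou's lemma; it transfers every bound that is uniform in the truncation to the local time. -/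
lemma lintegral_enorm_pow_le_of_tendsto {f : ℕ → Ω → ℂ} {g : Ω → ℂ} (hf : ∀ n, Measurable (f n))
    (hlim : ∀ᵐ ω ∂P, Tendsto (fun n => f n ω) atTop (𝓝 (g ω))) {m : ℕ} {B : ℝ≥0∞}
    (hB : ∀ᶠ n in atTop, ∫⁻ ω, ‖f n ω‖ₑ ^ m ∂P ≤ B) : ∫⁻ ω, ‖g ω‖ₑ ^ m ∂P ≤ B := by
  calc ∫⁻ ω, ‖g ω‖ₑ ^ m ∂P = ∫⁻ ω, liminf (fun n => ‖f n ω‖ₑ ^ m) atTop ∂P := by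
        refine lintegral_congr_ae ?_
        filter_upwards [hlim] with ω h
        have h1 : Tendsto (fun n => ‖f n ω‖ₑ ^ m) atTop (𝓝 (‖g ω‖ₑ ^ m)) :=
          ((ENNReal.continuous_pow m).tendsto _).comp h.enorm
        exact h1.liminf_eq.symm
    _ ≤ liminf (fun n => ∫⁻ ω, ‖f n ω‖ₑ ^ m ∂P) atTop :=
        lintegral_liminf_le fun n => (hf n).enorm.pow_const m
    _ ≤ B := liminf_le_of_frequently_le' hB.frequently

lemma lintegral_enorm_sq_le [IsProbabilityMeasure P] {f : Ω → ℂ} (hf : Measurable f) {m : ℕ}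
    (hm : 2 ≤ m) :
    ∫⁻ ω, ‖f ω‖ₑ ^ 2 ∂P ≤ (∫⁻ ω, ‖f ω‖ₑ ^ m ∂P) ^ (2 / (m : ℝ)) := by
  have h := eLpNorm'_le_eLpNorm'_of_exponent_le (p := 2) (q := m) (by norm_num)
    (by exact_mod_cast hm) P hf.aestronglyMeasurable
  simp only [eLpNorm'_eq_lintegral_enorm, ENNReal.rpow_natCast, ENNReal.rpow_ofNat] at h
  have h2 := ENNReal.rpow_le_rpow h (show (0 : ℝ) ≤ 2 by norm_num)
  rw [← ENNReal.rpow_mul, ← ENNReal.rpow_mul] at h2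
  norm_num at h2
  rwa [div_eq_inv_mul]

section Regular

variable [IsProbabilityMeasure P] {c δ α K : ℝ}

/-- At the frequency 2^k the tail bound is 2^{-km·min(δ,1)}, which is at most 256^{-k} as soon as
m·min(δ, 1) ≥ 8. -/
theorem exists_goodSet (hX : IsRegularProcess P T X c δ α K) (hT : 0 < T) (hα : 0 < α) {m : ℕ}
    {A : ℝ} (hme : Even m) (hA : HasDetLowerBound P T X m A) (hm8 : 8 ≤ (m : ℝ) * min δ 1) :
    ∃ G : Set Ω, MeasurableSet G ∧ P Gᶜ = 0 ∧ ∀ ω ∈ G, IsGoodPath T X ω := by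
  have hδ := hX.delta_pos
  have hm : m ≠ 0 := by rintro rfl; norm_num at hm8
  obtain ⟨B, hB, h⟩ := exists_lintegral_psi_tail_le hX hα hm hme hA (le_min hδ.le zero_le_one)
    (min_le_right δ 1) (min_le_left δ 1)
  have hae : ∀ᵐ ω ∂P, IsGoodPath T X ω := by
    refine ae_isGoodPath hX.measurable_uncurry hT hm hB fun k x t ht => ?_
    refine (h (2 ^ k) (2 ^ (k + 1)) x t (by positivity)
      (pow_le_pow_right₀ (by norm_num) (by omega)) ht).trans ?_
    have e : ENNReal.ofReal (((2 : ℝ) ^ k) ^ (-(min δ 1))) ^ m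
        = ENNReal.ofReal (((2 : ℝ) ^ (-(m * min δ 1))) ^ k) := by
      rw [← ENNReal.ofReal_pow (by positivity)]
      congr 1
      rw [← Real.rpow_natCast 2 k, ← Real.rpow_natCast _ m, ← Real.rpow_natCast _ k,
        ← Real.rpow_mul (by norm_num), ← Real.rpow_mul (by norm_num), ← Real.rpow_mul (by norm_num)]
      ring_nf
    rw [e, ENNReal.ofReal_pow (by positivity)]
    gcongr
    calc ENNReal.ofReal ((2 : ℝ) ^ (-(m * min δ 1))) ≤ ENNReal.ofReal ((2 : ℝ) ^ (-8 : ℝ)) :=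
          ENNReal.ofReal_le_ofReal
            (Real.rpow_le_rpow_of_exponent_le (by norm_num) (by linarith))
      _ = 1 / 256 := by
          rw [show ((2 : ℝ) ^ (-8 : ℝ)) = 1 / 256 by
            rw [Real.rpow_neg (by norm_num), show (8 : ℝ) = ((8 : ℕ) : ℝ) by norm_num,
              Real.rpow_natCast]; norm_num]
          rw [ENNReal.ofReal_div_of_pos (by norm_num)]
          norm_num
  -- The set of good paths is not shown to be measurable, so G is the complement of a measurable
  -- null set that contains the bad paths.
  obtain ⟨S, hS, hSm, hS0⟩ := exists_measurable_superset_of_null hae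
  refine ⟨Sᶜ, hSm.compl, by rwa [compl_compl], fun ω hω => ?_⟩
  by_contra hcon
  exact hω (hS hcon)

variable {G : Set Ω}

omit [IsProbabilityMeasure P] in
theorem isLocalTime_localTime (hX : IsRegularProcess P T X c δ α K)
    (hGm : MeasurableSet G) (hG0 : P Gᶜ = 0) (hG : ∀ ω ∈ G, IsGoodPath T X ω) :
    IsLocalTime P T X (localTime X G) := by
  refine ⟨fun x t ht => measurable_localTime hG hX.measurable_uncurry hGm x ht, fun t ht => ?_⟩
  filter_upwards [compl_mem_ae_iff.mpr hG0] with ω hω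
  rw [compl_compl] at hω
  obtain ⟨h1, h2⟩ := occupationMeasure_eq_withDensity hG hX.measurable_uncurry hω ht
  refine ⟨?_, ae_of_all _ h1, h2⟩
  have hcont : Continuous fun x => localTime X G x t ω :=
    continuousOn_univ.mp ((continuousOn_localTime hG hX.measurable_uncurry ω).comp
      (f := fun x : ℝ => (x, t)) (by fun_prop) fun x _ => ⟨mem_univ _, ht⟩)
  exact hcont.measurable.aemeasurable

theorem lintegral_localTime_time_le (hX : IsRegularProcess P T X c δ α K)
    (hG0 : P Gᶜ = 0) (hG : ∀ ω ∈ G, IsGoodPath T X ω) {m : ℕ} {A : ℝ} (hm : m ≠ 0) (hme : Even m)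
    (hA : HasDetLowerBound P T X m A) (x : ℝ) {s t : ℝ} (hs : 0 ≤ s) (hst : s ≤ t) (ht : t ≤ T) :
    ∫⁻ ω, ‖((localTime X G x t ω - localTime X G x s ω : ℝ) : ℂ)‖ₑ ^ m ∂P
      ≤ ENNReal.ofReal (m.factorial * kernelConst m A 1 c δ 0)
        * ENNReal.ofReal (K * (t - s) ^ α) ^ m := by
  have hXm := hX.measurable_uncurry
  refine lintegral_enorm_pow_le_of_tendsto
    (f := fun n ω => psi X (2 ^ n) x t ω - psi X (2 ^ n) x s ω) (fun n => ?_) ?_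
    (Eventually.of_forall fun n =>
      lintegral_psi_time_le hX hm hme hA (by positivity) x hs hst ht)
  · exact (measurable_psi hXm (by positivity) (hs.trans hst) x).sub
      (measurable_psi hXm (by positivity) hs x)
  · filter_upwards [compl_mem_ae_iff.mpr hG0] with ω hω
    rw [compl_compl] at hω
    rw [Complex.ofReal_sub]
    exact (tendsto_psi_localTime hG hω x ⟨hs.trans hst, ht⟩).sub
      (tendsto_psi_localTime hG hω x ⟨hs, hst.trans ht⟩)

theorem lintegral_localTime_rect_le (hX : IsRegularProcess P T X c δ α K)
    (hG0 : P Gᶜ = 0) (hG : ∀ ω ∈ G, IsGoodPath T X ω) {m : ℕ} {A : ℝ} (hm : m ≠ 0) (hme : Even m)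
    (hA : HasDetLowerBound P T X m A) {x y : ℝ} (hxy : x ≠ y) {s t : ℝ} (hs : 0 ≤ s) (hst : s ≤ t)
    (ht : t ≤ T) (hδ1 : δ ≤ 1) :
    ∫⁻ ω, ‖(((localTime X G y t ω - localTime X G y s ω)
        - (localTime X G x t ω - localTime X G x s ω) : ℝ) : ℂ)‖ₑ ^ m ∂P
      ≤ ENNReal.ofReal (m.factorial * kernelConst m A (|y - x| ^ δ) c δ δ)
        * ENNReal.ofReal (K * (t - s) ^ α) ^ m := by
  have hXm := hX.measurable_uncurry
  refine lintegral_enorm_pow_le_of_tendsto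
    (f := fun n ω => (psi X (2 ^ n) y t ω - psi X (2 ^ n) y s ω)
      - (psi X (2 ^ n) x t ω - psi X (2 ^ n) x s ω)) (fun n => ?_) ?_
    (Eventually.of_forall fun n =>
      lintegral_psi_rect_le hX hm hme hA (by positivity) hxy hs hst ht hX.delta_pos.le hδ1 le_rfl)
  · exact ((measurable_psi hXm (by positivity) (hs.trans hst) y).sub
      (measurable_psi hXm (by positivity) hs y)).sub
      ((measurable_psi hXm (by positivity) (hs.trans hst) x).sub
      (measurable_psi hXm (by positivity) hs x))
  · filter_upwards [compl_mem_ae_iff.mpr hG0] with ω hω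
    rw [compl_compl] at hω
    have htm : t ∈ Icc 0 T := ⟨hs.trans hst, ht⟩
    have hsm : s ∈ Icc 0 T := ⟨hs, hst.trans ht⟩
    simp only [Complex.ofReal_sub]
    exact ((tendsto_psi_localTime hG hω y htm).sub (tendsto_psi_localTime hG hω y hsm)).sub
      ((tendsto_psi_localTime hG hω x htm).sub (tendsto_psi_localTime hG hω x hsm))

/-- Fatou's lemma along the dyadic frequencies bounds the m-th moment of ψ_N - L by the tail
estimate, uniformly in (x, t), and the monotonicity of L^p norms under a probability passes from m
to 2. -/
theorem isUniformL2Limit_localTime (hX : IsRegularProcess P T X c δ α K) (hα : 0 < α)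
    (hGm : MeasurableSet G) (hG0 : P Gᶜ = 0) (hG : ∀ ω ∈ G, IsGoodPath T X ω) {m : ℕ} {A : ℝ}
    (hm : 2 ≤ m) (hme : Even m) (hA : HasDetLowerBound P T X m A) :
    IsUniformL2Limit P T X (localTime X G) := by
  have hXm := hX.measurable_uncurry
  have hδ := hX.delta_pos
  have hθ : 0 < min δ 1 := lt_min hδ zero_lt_one
  have hm0 : (0 : ℝ) < m := by exact_mod_cast (by omega : 0 < m)
  obtain ⟨B, hB, h⟩ := exists_lintegral_psi_tail_le hX hα (by omega) hme hA hθ.le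
    (min_le_right δ 1) (min_le_left δ 1)
  have hpow : Tendsto (fun k : ℕ => (2 : ℝ) ^ k) atTop atTop :=
    tendsto_pow_atTop_atTop_of_one_lt (by norm_num)
  have hbound : ∀ N x t : ℝ, 0 < N → t ∈ Icc 0 T →
      ∫⁻ ω, ‖psi X N x t ω - (localTime X G x t ω : ℂ)‖ₑ ^ 2 ∂P
        ≤ (B * ENNReal.ofReal (N ^ (-(min δ 1))) ^ m) ^ (2 / (m : ℝ)) := by
    intro N x t hN ht
    have hmeasL : Measurable fun ω => (localTime X G x t ω : ℂ) :=
      Complex.measurable_ofReal.comp (measurable_localTime hG hXm hGm x ht)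
    refine (lintegral_enorm_sq_le ((measurable_psi hXm hN.le ht.1 x).sub hmeasL) hm).trans ?_
    gcongr
    refine lintegral_enorm_pow_le_of_tendsto
      (f := fun n ω => psi X N x t ω - psi X (2 ^ n) x t ω) (fun n => ?_) ?_ ?_
    · exact (measurable_psi hXm hN.le ht.1 x).sub (measurable_psi hXm (by positivity) ht.1 x)
    · filter_upwards [compl_mem_ae_iff.mpr hG0] with ω hω
      rw [compl_compl] at hω
      exact (tendsto_psi_localTime hG hω x ht).const_sub _
    · filter_upwards [hpow.eventually_ge_atTop N] with n hn
      simp only [enorm_sub_rev (psi X N x t _)]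
      exact h N (2 ^ n) x t hN hn ht
  have hzero : Tendsto (fun N : ℝ => (B * ENNReal.ofReal (N ^ (-(min δ 1))) ^ m) ^ (2 / (m : ℝ)))
      atTop (𝓝 0) := by
    have h1 : Tendsto (fun N : ℝ => ENNReal.ofReal (N ^ (-(min δ 1)))) atTop (𝓝 0) := by
      rw [← ENNReal.ofReal_zero]
      exact ENNReal.tendsto_ofReal (tendsto_rpow_neg_atTop hθ)
    have h2 : Tendsto (fun N : ℝ => B * ENNReal.ofReal (N ^ (-(min δ 1))) ^ m) atTop (𝓝 0) := by
      have h3 := ((ENNReal.continuous_pow m).tendsto 0).comp h1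
      rw [zero_pow (by omega)] at h3
      have h4 := ENNReal.Tendsto.const_mul (a := B) h3 (Or.inr hB)
      rwa [mul_zero] at h4
    have h5 := (ENNReal.continuous_rpow_const (y := 2 / (m : ℝ))).tendsto 0
    rw [ENNReal.zero_rpow_of_pos (by positivity)] at h5
    exact h5.comp h2
  refine tendsto_of_tendsto_of_tendsto_of_le_of_le' tendsto_const_nhds hzero
    (Eventually.of_forall fun _ => zero_le) ?_
  filter_upwards [eventually_gt_atTop 0] with N hN
  exact iSup_le fun x => iSup₂_le fun t ht => hbound N x t hN ht

end Regular

/-! ### Reduction to a process jointly measurable on the whole line -/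

/-- The process stopped outside `[0, T]`, which is measurable on the whole of `ℝ × Ω`. -/
noncomputable def clampPath (T : ℝ) (X : ℝ → Ω → ℝ) (t : ℝ) : Ω → ℝ := X (max 0 (min T t))

omit [MeasurableSpace Ω] in
lemma clampPath_of_mem {t : ℝ} (ht : t ∈ Icc 0 T) : clampPath T X t = X t := by
  rw [clampPath, min_eq_right ht.2, max_eq_right ht.1]

lemma measurable_clampPath (hT : 0 ≤ T) (hX : IsMeasurableProcess T X) :
    Measurable (Function.uncurry (clampPath T X)) := by
  have hmem : ∀ t : ℝ, max 0 (min T t) ∈ Icc 0 T := fun t =>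
    ⟨le_max_left _ _, max_le hT (min_le_left _ _)⟩
  have h1 : Measurable fun p : ℝ × Ω => ((⟨max 0 (min T p.1), hmem p.1⟩ : Icc (0 : ℝ) T), p.2) := by
    refine Measurable.prodMk (Measurable.subtype_mk ?_) measurable_snd
    fun_prop
  exact hX.comp h1

lemma isCenteredGaussianStatIncr_clampPath (hT : 0 ≤ T) (hX : IsCenteredGaussianStatIncr P T X) :
    IsCenteredGaussianStatIncr P T (clampPath T X) where
  measurable := by
    have : (fun p : Icc (0 : ℝ) T × Ω => clampPath T X p.1 p.2) = fun p => X p.1 p.2 := by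
      ext p; rw [clampPath_of_mem p.1.2]
    unfold IsMeasurableProcess
    rw [this]
    exact hX.measurable
  gaussian := by
    have : (fun t : Icc (0 : ℝ) T => clampPath T X t) = fun t : Icc (0 : ℝ) T => X t := by
      ext t; rw [clampPath_of_mem t.2]
    rw [this]
    exact hX.gaussian
  centered t ht := by rw [clampPath_of_mem ht]; exact hX.centered t ht
  null_at_zero := by rw [clampPath_of_mem ⟨le_rfl, hT⟩]; exact hX.null_at_zero
  stationary s hs t ht hst := by
    rw [clampPath_of_mem hs, clampPath_of_mem ht, clampPath_of_mem ⟨le_rfl, hT⟩,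
      clampPath_of_mem ⟨by linarith, by linarith [hs.1, ht.2]⟩]
    exact hX.stationary s hs t ht hst

lemma sigma_clampPath {t : ℝ} (ht : t ∈ Icc 0 T) :
    sigma P (clampPath T X) t = sigma P X t := by
  rw [sigma, clampPath_of_mem ht, sigma]

omit [MeasurableSpace Ω] in
lemma psi_clampPath {t : ℝ} (ht : t ∈ Icc 0 T) (N x : ℝ) (ω : Ω) :
    psi (clampPath T X) N x t ω = psi X N x t ω := by
  unfold psi
  congr 1
  refine intervalIntegral.integral_congr fun u _ => ?_
  congr 1
  refine intervalIntegral.integral_congr fun r hr => ?_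
  rw [uIcc_of_le ht.1] at hr
  rw [clampPath_of_mem ⟨hr.1, hr.2.trans ht.2⟩]

omit [MeasurableSpace Ω] in
lemma occupationMeasure_clampPath {t : ℝ} (ht : t ∈ Icc 0 T) (ω : Ω) :
    occupationMeasure (clampPath T X) t ω = occupationMeasure X t ω := by
  unfold occupationMeasure
  refine Measure.map_congr ?_
  filter_upwards [ae_restrict_mem measurableSet_Icc] with s hs
  rw [clampPath_of_mem ⟨hs.1, hs.2.trans ht.2⟩]

lemma IsLocalTime.of_clampPath {L : ℝ → ℝ → Ω → ℝ} (h : IsLocalTime P T (clampPath T X) L) :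
    IsLocalTime P T X L := by
  refine ⟨h.1, fun t ht => ?_⟩
  have := h.2 t ht
  simpa only [occupationMeasure_clampPath ht] using this

lemma IsUniformL2Limit.of_clampPath {L : ℝ → ℝ → Ω → ℝ}
    (h : IsUniformL2Limit P T (clampPath T X) L) : IsUniformL2Limit P T X L := by
  unfold IsUniformL2Limit at h ⊢
  refine h.congr fun N => ?_
  refine iSup_congr fun x => iSup_congr fun t => iSup_congr fun ht => ?_
  simp only [psi_clampPath ht]

lemma hasDetLowerBound_clampPath {m : ℕ} {A : ℝ} (h : HasDetLowerBound P T X m A) :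
    HasDetLowerBound P T (clampPath T X) m A := by
  refine ⟨h.1, fun t h0 hmono hlast => ?_⟩
  have htm : ∀ j, t j ∈ Icc 0 T := fun j =>
    ⟨h0 ▸ hmono.monotone (Fin.zero_le j), (hmono.monotone (Fin.le_last j)).trans hlast.le⟩
  have hd : ∀ j : Fin m, t j.succ - t j.castSucc ∈ Icc 0 T := fun j => by
    have := hmono (Fin.castSucc_lt_succ (i := j))
    exact ⟨by linarith, by linarith [(htm j.succ).2, (htm j.castSucc).1]⟩
  have : normIncrCov P (clampPath T X) t = normIncrCov P X t := by
    ext i j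
    simp only [normIncrCov, Matrix.of_apply, clampPath_of_mem (htm _), sigma_clampPath (hd _)]
  rw [this]
  exact h.2 t h0 hmono hlast

end LocalTime

/-! ### Constants and the final assembly -/

namespace LocalTime

/-- The constant `C_m` of the moment bounds. -/
noncomputable def momentConst (m : ℕ) : ℝ :=
  1 + m.factorial * gaussConst m * (m.factorial : ℝ) ^ m

lemma momentConst_pos (m : ℕ) : 0 < momentConst m := by
  have := gaussConst_pos m
  unfold momentConst
  positivity

lemma one_le_momentConst (m : ℕ) : 1 ≤ momentConst m := by
  have := gaussConst_pos m
  have : 0 ≤ m.factorial * gaussConst m * (m.factorial : ℝ) ^ m := by positivity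
  unfold momentConst
  linarith

/-- The factor A^{q-p} is at most (m!)^m because A ≤ m! and 0 ≤ q - p ≤ m. -/
lemma rpow_neg_le_factorial_pow_mul {m : ℕ} {A p q : ℝ} (hA : 0 < A) (hAF : A ≤ m.factorial)
    (hpq : p ≤ q) (hqm : q - p ≤ m) : A ^ (-p) ≤ (m.factorial : ℝ) ^ m * A ^ (-q) := by
  have hF : (1 : ℝ) ≤ m.factorial := by
    exact_mod_cast Nat.one_le_iff_ne_zero.mpr (Nat.factorial_ne_zero m)
  rw [show -p = (q - p) + -q by ring, Real.rpow_add hA]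
  gcongr
  calc A ^ (q - p) ≤ (m.factorial : ℝ) ^ (q - p) := Real.rpow_le_rpow hA.le hAF (by linarith)
    _ ≤ (m.factorial : ℝ) ^ (m : ℝ) := Real.rpow_le_rpow_of_exponent_le hF hqm
    _ = _ := Real.rpow_natCast _ _

/-- Where √s exceeds 1 it is at most s, so replacing √s by s in the 2δ-th power only increases it.
-/
lemma max_one_sqrt_rpow_le {s δ : ℝ} (hδ : 0 ≤ δ) (m : ℕ) :
    max 1 (Real.sqrt s) ^ (2 * (m : ℝ) * δ) ≤ max 1 (s ^ (2 * δ)) ^ m := by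
  have h : max 1 (Real.sqrt s) ^ (2 * δ) ≤ max 1 (s ^ (2 * δ)) := by
    rcases le_or_gt (Real.sqrt s) 1 with h1 | h1
    · rw [max_eq_left h1, Real.one_rpow]
      exact le_max_left _ _
    · have hs : 1 < s := by
        by_contra hs
        exact absurd (Real.sqrt_le_one.mpr (not_lt.mp hs)) (not_le.mpr h1)
      rw [max_eq_right h1.le]
      refine le_trans ?_ (le_max_right _ _)
      exact Real.rpow_le_rpow (Real.sqrt_nonneg _)
        (Real.sqrt_le_left (by linarith) |>.mpr (by nlinarith)) (by linarith)
  calc max 1 (Real.sqrt s) ^ (2 * (m : ℝ) * δ) = (max 1 (Real.sqrt s) ^ (2 * δ)) ^ m := by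
        rw [← Real.rpow_natCast, ← Real.rpow_mul (le_trans zero_le_one (le_max_left _ _))]
        ring_nf
    _ ≤ _ := by gcongr

/-- No sign is assumed for K: if K h^α < 0 the left side is 0, and K^m ≥ 0 because m is even. -/
lemma ofReal_mul_ofReal_pow_le {m : ℕ} (hm : m ≠ 0) (hme : Even m) {a b K h α : ℝ} (ha : 0 ≤ a)
    (hab : a ≤ b) (hh : 0 ≤ h) :
    ENNReal.ofReal a * ENNReal.ofReal (K * h ^ α) ^ m
      ≤ ENNReal.ofReal (b * K ^ m * h ^ (m * α)) := by
  have hpow : (K * h ^ α) ^ m = K ^ m * h ^ (m * α) := by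
    rw [mul_pow, ← Real.rpow_natCast (h ^ α), ← Real.rpow_mul hh, mul_comm α]
  have h1 : ENNReal.ofReal (K * h ^ α) ^ m ≤ ENNReal.ofReal (K ^ m * h ^ (m * α)) := by
    rcases le_or_gt 0 (K * h ^ α) with h0 | h0
    · rw [← ENNReal.ofReal_pow h0, hpow]
    · rw [ENNReal.ofReal_of_nonpos h0.le, zero_pow hm]
      exact zero_le
  have hK : 0 ≤ K ^ m := hme.pow_nonneg K
  calc _ ≤ ENNReal.ofReal a * ENNReal.ofReal (K ^ m * h ^ (m * α)) := by gcongr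
    _ = ENNReal.ofReal (a * (K ^ m * h ^ (m * α))) := (ENNReal.ofReal_mul ha).symm
    _ ≤ _ := by
        rw [mul_assoc b]
        gcongr

end LocalTime

theorem mainTheorem3 :
    ∃ C : ℕ → ℝ, (∀ m, 0 < C m) ∧
      ∀ (Ω : Type*) [MeasurableSpace Ω] (P : Measure Ω) [IsProbabilityMeasure P]
        (T : ℝ) (_ : 0 < T) (X : ℝ → Ω → ℝ)
        (_ : LocalTime.IsCenteredGaussianStatIncr P T X)
        (Cσ : ℝ) (_ : ∀ t ∈ Icc (0 : ℝ) T, variance (X t) P ≤ Cσ)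
        (m₀ : ℕ) (_ : Even m₀) (A : ℕ → ℝ)
        (_ : ∀ m, m₀ ≤ m → Even m → 0 < A m ∧
          ∀ t : Fin (m + 1) → ℝ, t 0 = 0 → StrictMono t → t (Fin.last m) < T →
            A m ≤ (LocalTime.normIncrCov P X t).det)
        (δ α Cαδ : ℝ) (_ : 0 < δ) (_ : 0 < α)
        (_ : ∀ t ∈ Icc (0 : ℝ) T, ∀ h : ℝ, 0 ≤ h → t + h ≤ T →
          ∫⁻ s in Icc t (t + h), ENNReal.ofReal (LocalTime.sigma P X s) ^ (-(1 + 2 * δ))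
            ≤ ENNReal.ofReal (Cαδ * h ^ α)),
        ∃ L : ℝ → ℝ → Ω → ℝ,
          -- (a) local time, as a limit in quadratic mean uniform in `(x, t)`
          (LocalTime.IsLocalTime P T X L ∧ LocalTime.IsUniformL2Limit P T X L) ∧
          -- (b) moments of the time increments at the level `0`
          (∀ m, m₀ ≤ m → Even m → ∀ t ∈ Icc (0 : ℝ) T, ∀ h : ℝ, t + h ∈ Icc (0 : ℝ) T →
            ∫⁻ ω, ENNReal.ofReal (|L 0 (t + h) ω - L 0 t ω| ^ m) ∂P ≤
              ENNReal.ofReal ((C m * A m ^ (-((m : ℝ) / 2)) * max 1 (Cσ ^ (2 * δ)) ^ m * Cαδ ^ m)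
                * |h| ^ (m * α))) ∧
          -- (c) moments of the rectangular increments
          (δ ≤ 1 → ∀ m, m₀ ≤ m → Even m →
            ∀ x k : ℝ, ∀ t ∈ Icc (0 : ℝ) T, ∀ h : ℝ, t + h ∈ Icc (0 : ℝ) T →
            ∫⁻ ω, ENNReal.ofReal
                (|LocalTime.rectIncr (fun y s => L y s ω) x t (x + k) (t + h)| ^ m) ∂P ≤
              ENNReal.ofReal ((C m * max 1 (A m ^ (-(max (m : ℝ) (1 + m * δ) / 2)))
                * max 1 (Cσ ^ (2 * δ)) ^ m * Cαδ ^ m) * (|h| ^ (m * α) * |k| ^ (m * δ)))) ∧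
          -- jointly continuous version
          ∃ L' : ℝ → ℝ → Ω → ℝ,
            (∀ x, ∀ t ∈ Icc (0 : ℝ) T, ∀ᵐ ω ∂P, L' x t ω = L x t ω) ∧
            LocalTime.IsLocalTime P T X L' ∧
            ∀ ω, ContinuousOn (fun p : ℝ × ℝ => L' p.1 p.2 ω) (univ ×ˢ Icc (0 : ℝ) T) := by
  open LocalTime in
  refine ⟨momentConst, momentConst_pos, ?_⟩
  intro Ω _ P _ T hT X hX Cσ hCσ m₀ hm₀ A hA δ α K hδ hα hint
  set c := max 1 (Real.sqrt Cσ) with hc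
  set Y := clampPath T X with hYdef
  have hXY := isCenteredGaussianStatIncr_clampPath hT.le hX
  have hY : IsRegularProcess P T Y c δ α K :=
    { measurable_uncurry := measurable_clampPath hT.le hX.measurable
      gaussian := hXY
      one_le := le_max_left _ _
      sigma_le := fun t ht => by
        rw [hYdef, sigma_clampPath ht]
        exact (Real.sqrt_le_sqrt (hCσ t ht)).trans (le_max_right _ _)
      delta_pos := hδ
      lintegral_le := fun t ht h h0 hth => by
        refine le_trans (le_of_eq ?_) (hint t ht h h0 hth)
        refine setLIntegral_congr_fun measurableSet_Icc fun s hs => ?_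
        rw [hYdef, sigma_clampPath ⟨ht.1.trans hs.1, hs.2.trans hth⟩] }
  have hdet : ∀ m, m₀ ≤ m → Even m → HasDetLowerBound P T Y m (A m) := fun m hm hme =>
    hasDetLowerBound_clampPath (hA m hm hme)
  have hAF : ∀ m, m₀ ≤ m → Even m → A m ≤ m.factorial := fun m hm hme =>
    (hdet m hm hme).le_factorial hXY hT
  obtain ⟨n, hn⟩ := exists_nat_ge (8 / min δ 1)
  have hθ : 0 < min δ 1 := lt_min hδ zero_lt_one
  -- One even exponent M ≥ m₀, at least 2 and with M·min(δ, 1) ≥ 8, is enough to construct L; the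
  -- moment bounds for the other m then concern this same L.
  set M := m₀ + 2 * (n + 1) with hM
  have hMe : Even M := hm₀.add (even_two_mul _)
  have hM8 : 8 ≤ (M : ℝ) * min δ 1 := by
    rw [div_le_iff₀ hθ] at hn
    refine hn.trans (mul_le_mul_of_nonneg_right ?_ hθ.le)
    exact_mod_cast (by omega : n ≤ M)
  obtain ⟨G, hGm, hG0, hG⟩ := exists_goodSet hY hT hα hMe (hdet M (by omega) hMe) hM8
  have hloc := (isLocalTime_localTime hY hGm hG0 hG).of_clampPath
  have henorm : ∀ (y : ℝ) (m : ℕ), ENNReal.ofReal (|y| ^ m) = ‖(y : ℂ)‖ₑ ^ m := fun y m => by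
    rw [ENNReal.ofReal_pow (abs_nonneg _), ← ofReal_norm, Complex.norm_real, Real.norm_eq_abs]
  have hcpow : ∀ m : ℕ, c ^ (2 * (m : ℝ) * δ) ≤ max 1 (Cσ ^ (2 * δ)) ^ m :=
    max_one_sqrt_rpow_le hδ.le
  have hc1 : 1 ≤ c := le_max_left _ _
  have hmax0 : (0 : ℝ) < max 1 (Cσ ^ (2 * δ)) := lt_max_of_lt_left zero_lt_one
  refine ⟨localTime Y G, ⟨hloc, (isUniformL2Limit_localTime hY hα hGm hG0 hG (by omega) hMe
    (hdet M (by omega) hMe)).of_clampPath⟩, ?_, ?_, localTime Y G,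
    fun _ _ _ => ae_of_all _ fun _ => rfl, hloc,
    fun ω => continuousOn_localTime hG hY.measurable_uncurry ω⟩
  · intro m hmm hme t ht h hth
    -- For m = 0 the left side is the total mass 1, which the summand 1 in `momentConst` covers; the
    -- Gaussian estimate needs m ≠ 0.
    rcases eq_or_ne m 0 with rfl | hm
    · simpa using one_le_momentConst 0
    have hgc := gaussConst_pos m
    have hA0 := (hA m hmm hme).1
    have hconst : m.factorial * kernelConst m (A m) 1 c δ 0
        ≤ momentConst m * A m ^ (-((m : ℝ) / 2)) * max 1 (Cσ ^ (2 * δ)) ^ m := by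
      have h1m : (1 : ℝ) ≤ m := by exact_mod_cast Nat.one_le_iff_ne_zero.mpr hm
      -- The estimate gives the exponent -1/2, and the weaker -m/2 is reached through A ≤ m!.
      have h1 : A m ^ (-((1 + (m : ℝ) * 0) / 2)) ≤ (m.factorial : ℝ) ^ m * A m ^ (-((m : ℝ) / 2)) :=
        rpow_neg_le_factorial_pow_mul hA0 (hAF m hmm hme) (by linarith) (by linarith)
      calc _ = m.factorial * gaussConst m * A m ^ (-((1 + (m : ℝ) * 0) / 2))
            * c ^ (2 * (m : ℝ) * δ) := by
            rw [kernelConst]; ring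
        _ ≤ m.factorial * gaussConst m * ((m.factorial : ℝ) ^ m * A m ^ (-((m : ℝ) / 2)))
            * max 1 (Cσ ^ (2 * δ)) ^ m := by
            gcongr
            exact hcpow m
        _ = m.factorial * gaussConst m * (m.factorial : ℝ) ^ m * A m ^ (-((m : ℝ) / 2))
            * max 1 (Cσ ^ (2 * δ)) ^ m := by ring
        _ ≤ _ := by
            gcongr
            rw [momentConst]
            linarith
    have hk := kernelConst_pos (m := m) (δ := δ) (θ := 0) hA0 zero_lt_one hc1
    have key : ∀ s t : ℝ, 0 ≤ s → s ≤ t → t ≤ T →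
        ∫⁻ ω, ENNReal.ofReal (|localTime Y G 0 t ω - localTime Y G 0 s ω| ^ m) ∂P
          ≤ ENNReal.ofReal ((momentConst m * A m ^ (-((m : ℝ) / 2))
            * max 1 (Cσ ^ (2 * δ)) ^ m * K ^ m) * (t - s) ^ (m * α)) := by
      intro s t hs hst ht
      simp only [henorm]
      exact (lintegral_localTime_time_le hY hG0 hG hm hme (hdet m hmm hme) 0 hs hst ht).trans
        (ofReal_mul_ofReal_pow_le hm hme (by positivity) hconst (by linarith))
    rcases le_total 0 h with h0 | h0
    · have := key t (t + h) ht.1 (by linarith) hth.2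
      rw [add_sub_cancel_left] at this
      rwa [abs_of_nonneg h0]
    · have := key (t + h) t hth.1 (by linarith) ht.2
      rw [sub_add_cancel_left, ← abs_of_nonpos h0] at this
      simpa only [abs_sub_comm (localTime Y G 0 t _)] using this
  · intro hδ1 m hmm hme x k t ht h hth
    rcases eq_or_ne m 0 with rfl | hm
    · have h1 := one_le_momentConst 0
      have h2 : (1 : ℝ) ≤ max 1 (A 0 ^ (-(max ((0 : ℕ) : ℝ) (1 + (0 : ℕ) * δ) / 2))) := le_max_left _ _
      have h3 := mul_le_mul h1 h2 zero_le_one (by linarith)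
      simpa using h3
    -- For k = 0 the rectangular increment vanishes; otherwise |k|^δ is a positive kernel constant,
    -- as the estimate requires.
    rcases eq_or_ne k 0 with rfl | hk0
    · simp [rectIncr, hm]
    have hgc := gaussConst_pos m
    have hA0 := (hA m hmm hme).1
    have hk0' : 0 < |k| := abs_pos.mpr hk0
    set E := max 1 (A m ^ (-(max (m : ℝ) (1 + m * δ) / 2))) with hE
    have hE0 : 0 < E := lt_max_of_lt_left zero_lt_one
    have hconst : m.factorial * kernelConst m (A m) (|k| ^ δ) c δ δ
        ≤ momentConst m * E * max 1 (Cσ ^ (2 * δ)) ^ m * |k| ^ (m * δ) := by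
      have h1 : A m ^ (-((1 + (m : ℝ) * δ) / 2)) ≤ (m.factorial : ℝ) ^ m * E := by
        have h1m : (0 : ℝ) ≤ m := Nat.cast_nonneg m
        have h2 : A m ^ (-((1 + (m : ℝ) * δ) / 2))
            ≤ (m.factorial : ℝ) ^ m * A m ^ (-(max (m : ℝ) (1 + m * δ) / 2)) := by
          refine rpow_neg_le_factorial_pow_mul hA0 (hAF m hmm hme) ?_ ?_
          · linarith [le_max_right (m : ℝ) (1 + m * δ)]
          · have h3 : 0 ≤ (m : ℝ) * δ := by positivity
            rcases max_cases (m : ℝ) (1 + m * δ) with h4 | h4 <;> linarith [h4.1]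
        refine h2.trans ?_
        gcongr
        exact le_max_right _ _
      have h5 : (|k| ^ δ) ^ m = |k| ^ (m * δ) := by
        rw [← Real.rpow_natCast, ← Real.rpow_mul hk0'.le, mul_comm]
      calc _ = m.factorial * gaussConst m * A m ^ (-((1 + (m : ℝ) * δ) / 2))
            * c ^ (2 * (m : ℝ) * δ) * |k| ^ (m * δ) := by
            rw [kernelConst, h5]; ring
        _ ≤ m.factorial * gaussConst m * ((m.factorial : ℝ) ^ m * E)
            * max 1 (Cσ ^ (2 * δ)) ^ m * |k| ^ (m * δ) := by
            gcongr
            exact hcpow m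
        _ = m.factorial * gaussConst m * (m.factorial : ℝ) ^ m * E
            * max 1 (Cσ ^ (2 * δ)) ^ m * |k| ^ (m * δ) := by ring
        _ ≤ _ := by
            gcongr
            rw [momentConst]
            linarith
    have hkp := kernelConst_pos (m := m) (δ := δ) (θ := δ) hA0 (Real.rpow_pos_of_pos hk0' δ) hc1
    have key : ∀ s t : ℝ, 0 ≤ s → s ≤ t → t ≤ T →
        ∫⁻ ω, ENNReal.ofReal (|rectIncr (fun y s => localTime Y G y s ω) x s (x + k) t| ^ m) ∂P
          ≤ ENNReal.ofReal ((momentConst m * E * max 1 (Cσ ^ (2 * δ)) ^ m * K ^ m)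
            * ((t - s) ^ (m * α) * |k| ^ (m * δ))) := by
      intro s t hs hst ht
      have h1 := lintegral_localTime_rect_le hY hG0 hG hm hme (hdet m hmm hme) (x := x) (y := x + k)
        (by simpa using hk0) hs hst ht hδ1
      rw [add_sub_cancel_left] at h1
      have h2 : ∀ ω, rectIncr (fun y s => localTime Y G y s ω) x s (x + k) t
          = (localTime Y G (x + k) t ω - localTime Y G (x + k) s ω)
            - (localTime Y G x t ω - localTime Y G x s ω) := fun ω => by
        rw [rectIncr]; ring
      simp only [henorm, h2]
      refine (h1.trans (ofReal_mul_ofReal_pow_le hm hme (by positivity) hconst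
        (by linarith))).trans (le_of_eq ?_)
      congr 1
      ring
    rcases le_total 0 h with h0 | h0
    · have := key t (t + h) ht.1 (by linarith) hth.2
      rw [add_sub_cancel_left] at this
      rwa [abs_of_nonneg h0]
    · have := key (t + h) t hth.1 (by linarith) ht.2
      rw [sub_add_cancel_left, ← abs_of_nonpos h0] at this
      -- Exchanging t and t + h changes the sign of the rectangular increment, not its modulus.
      refine le_trans (le_of_eq ?_) this
      refine lintegral_congr fun ω => ?_
      congr 2
      rw [← abs_neg]
      congr 1
      simp only [rectIncr]
      ring
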